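/- For $\sigma\in\mathbb R$ let $H^\sigma(\mathbb R)$ be the Sobolev space of real tempered distributions $f$ on $\mathbb R$ with norm $\|f\|_{H^\sigma}=\left(\int_{\mathbb R}(1+|\xi|^2)^\sigma|\hat f(\xi)|^2\,d\xi\right)^{1/2}<\infty$. Let $s>1/2$ and put $$\mathcal D^{s+1}(\mathbb R)=\{\varphi:\mathbb R\to\mathbb R \mid \varphi-\mathrm{id}\in H^{s+1}(\mathbb R),\ \varphi_x(x)>0\text{ for all }x\in\mathbb R\},$$ $$U^s=\{h:\mathbb R\to\mathbb R \mid h-1\in H^s(\mathbb R),\ h(x)>0\text{ for all }x\in\mathbb R\}$$ (elements of $H^s(\mathbb R)$ and $H^{s+1}(\mathbb R)$ are identified with their continuous representatives). Via $\varphi\mapsto\varphi-\mathrm{id}$ and $h\mapsto h-1$ these sets are identified with subsets of $H^{s+1}(\mathbb R)$ and $H^s(\mathbb R)$. For $h\in U^s$ let $$A_h:H^{s+1}(\mathbb R)\to H^{s-1}(\mathbb R),\qquad A_h w=3hw-\partial_x(h^3 w_x).$$ For $\varphi\in\mathcal D^{s+1}(\mathbb R)$, $v\in H^{s+1}(\mathbb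 R)$ and $h_0\in U^s$ put $h=(h_0/\varphi_x)\circ\varphi^{-1}$, $u=v\circ\varphi^{-1}$ and $$F(\varphi,v,h_0)=-\Big(A_h^{-1}\big(3h\,h_x+2\,\partial_x(h^3u_x^2)\big)\Big)\circ\varphi ,$$ where for $s<1$ the product of $h$ with $h_x\in H^{s-1}(\mathbb R)$ is defined through the duality of $H^{s-1}(\mathbb R)$ and $H^{1-s}(\mathbb R)$, $\langle h\,h_x,\psi\rangle=\langle h_x,h\psi\rangle$. (Thus $\varphi_{tt}=F(\varphi,\varphi_t,h_0)$ is the 1D Green–Naghdi system $u_t+uu_x=-A_h^{-1}(3hh_x+2\partial_x(h^3u_x^2))$, $h_t+\partial_x(hu)=0$, $h(0)=h_0$, in the Lagrangian variable $\varphi$ given by $\varphi_t=u\circ\varphi$, $\varphi(0)=\mathrm{id}$.) Theorem. The sets above are such that $\mathcal D^{s+1}(\mathbb R)\times H^{s+1}(\mathbb R)\times U^s$ is identified with an open subset of $H^{s+1}(\mathbb R)\times H^{s+1}(\mathbb R)\times H^s(\mathbb R)$. The map $F$ is well defined on it with values in $H^{s+1}(\mathbb R)$: $A_h$ is bijective from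 $H^{s+1}(\mathbb R)$ onto $H^{s-1}(\mathbb R)$ for all $h\in U^s$, and for all $\varphi\in\mathcal D^{s+1}(\mathbb R)$, $v\in H^{s+1}(\mathbb R)$, $h_0\in U^s$ and $h,u$ as above, $\varphi$ is bijective, $h\in U^s$, $u\in H^{s+1}(\mathbb R)$, $3hh_x+2\partial_x(h^3u_x^2)\in H^{s-1}(\mathbb R)$ and $F(\varphi,v,h_0)\in H^{s+1}(\mathbb R)$. Moreover $$\mathcal D^{s+1}(\mathbb R)\times H^{s+1}(\mathbb R)\times U^s\to H^{s+1}(\mathbb R),\qquad(\varphi,v,h_0)\mapsto F(\varphi,v,h_0),$$ is real analytic. -/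

import Mathlib

open MeasureTheory TemperedDistribution
open scoped SchwartzMap LineDeriv

noncomputable section

namespace GreenNaghdi

/-- The distribution on `ℝ` given by a square integrable function `f`
(it is `0` if `f` is not square integrable). -/
def ofFun (f : ℝ → ℂ) : 𝓢'(ℝ, ℂ) :=
  open Classical in
  if hf : MemLp f 2 (volume : Measure ℝ) then
    ((hf.toLp f : Lp ℂ 2 (volume : Measure ℝ)) : 𝓢'(ℝ, ℂ)) else 0

/-- A tempered distribution is real if it takes real values on real valued test functions. -/
def IsRealDist (T : 𝓢'(ℝ, ℂ)) : Prop :=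
  ∀ ψ : 𝓢(ℝ, ℂ), (∀ x, (ψ x).im = 0) → (T ψ).im = 0

/-- The real Sobolev space `H^σ(ℝ)` of any real order `σ`, as a space of real tempered
distributions `T` with `(1 + |ξ|²)^{σ/2} T̂ ∈ L²`. -/
def sobolevSubmodule (σ : ℝ) : Submodule ℝ 𝓢'(ℝ, ℂ) where
  carrier := {T | MemSobolev σ 2 T ∧ IsRealDist T}
  add_mem' := by
    rintro S T ⟨hS, hS'⟩ ⟨hT, hT'⟩
    refine ⟨hS.add hT, fun ψ hψ => ?_⟩
    have : (S + T) ψ = S ψ + T ψ := rfl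
    simp [this, hS' ψ hψ, hT' ψ hψ]
  zero_mem' := by
    refine ⟨memSobolev_fun_zero ℝ ℂ σ 2, fun ψ _ => ?_⟩
    have : (0 : 𝓢'(ℝ, ℂ)) ψ = 0 := rfl
    simp [this]
  smul_mem' := by
    rintro c T ⟨hT, hT'⟩
    refine ⟨?_, fun ψ hψ => ?_⟩
    · have h : c • T = (c : ℂ) • T := by
        ext ψ
        change c • T ψ = (c : ℂ) • T ψ
        simp
      rw [h]
      exact hT.smul _
    · have : (c • T) ψ = c • T ψ := rfl
      simp [this, hT' ψ hψ]

/-- The real Sobolev space `H^σ(ℝ)` as a type of its own (it carries the Sobolev norm below and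
not the topology of the space of distributions). -/
def Sob (σ : ℝ) : Type := sobolevSubmodule σ

instance (σ : ℝ) : AddCommGroup (Sob σ) := inferInstanceAs (AddCommGroup (sobolevSubmodule σ))

instance (σ : ℝ) : Module ℝ (Sob σ) := inferInstanceAs (Module ℝ (sobolevSubmodule σ))

/-- The element of `H^σ(ℝ)` given by a distribution in it. -/
def Sob.mk {σ : ℝ} (T : 𝓢'(ℝ, ℂ)) (hT : T ∈ sobolevSubmodule σ) : Sob σ := ⟨T, hT⟩

/-- The distribution underlying an element of `H^σ(ℝ)`. -/
def Sob.dist {σ : ℝ} : Sob σ →ₗ[ℝ] 𝓢'(ℝ, ℂ) := (sobolevSubmodule σ).subtype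

theorem Sob.memSobolev_dist {σ : ℝ} (T : Sob σ) : MemSobolev σ 2 T.dist := T.2.1

theorem Lp_dist_injective {f g : Lp ℂ 2 (volume : Measure ℝ)}
    (h : (f : 𝓢'(ℝ, ℂ)) = (g : 𝓢'(ℝ, ℂ))) : f = g := by
  have hk := Lp.ker_toTemperedDistributionCLM_eq_bot (F := ℂ) (μ := (volume : Measure ℝ)) (p := 2)
  rw [LinearMap.ker_eq_bot] at hk
  exact hk h

/-- The square integrable function `Λ^σ T`, where `Λ^σ` is the Bessel potential, i.e. the Fourier
multiplier `(1 + |ξ|²)^{σ/2}`, for a distribution `T` of Sobolev order `σ` (`0` for all others). -/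
def besselL2 (σ : ℝ) (T : 𝓢'(ℝ, ℂ)) : Lp ℂ 2 (volume : Measure ℝ) :=
  open Classical in
  if hT : MemSobolev σ 2 T then hT.choose else 0

theorem besselL2_spec {σ : ℝ} {T : 𝓢'(ℝ, ℂ)} (hT : MemSobolev σ 2 T) :
    besselPotential ℝ ℂ σ T = (besselL2 σ T : 𝓢'(ℝ, ℂ)) := by
  rw [besselL2, dif_pos hT]
  exact hT.choose_spec

/-- The map `T ↦ Λ^σ T`, `H^σ(ℝ) → L²(ℝ)`. -/
def Sob.bessel (σ : ℝ) : Sob σ →ₗ[ℝ] Lp ℂ 2 (volume : Measure ℝ) where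
  toFun T := besselL2 σ T.dist
  map_add' S T := by
    apply Lp_dist_injective
    rw [← besselL2_spec (Sob.memSobolev_dist (S + T)), ← Lp.toTemperedDistributionCLM_apply, map_add, map_add,
      map_add, Lp.toTemperedDistributionCLM_apply, Lp.toTemperedDistributionCLM_apply,
      besselL2_spec (Sob.memSobolev_dist S), besselL2_spec (Sob.memSobolev_dist T)]
  map_smul' c T := by
    apply Lp_dist_injective
    rw [← besselL2_spec (Sob.memSobolev_dist (c • T)), ← Lp.toTemperedDistributionCLM_apply, map_smul,
      ContinuousLinearMap.map_smul_of_tower, RingHom.id_apply,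
      ContinuousLinearMap.map_smul_of_tower, Lp.toTemperedDistributionCLM_apply,
      besselL2_spec (Sob.memSobolev_dist T)]

theorem Sob.bessel_injective (σ : ℝ) : Function.Injective (Sob.bessel σ) := by
  intro S T h
  have h' : besselL2 σ S.dist = besselL2 σ T.dist := h
  have h2 : besselPotential ℝ ℂ σ S.dist = besselPotential ℝ ℂ σ T.dist := by
    rw [besselL2_spec (Sob.memSobolev_dist S), besselL2_spec (Sob.memSobolev_dist T), h']
  apply Subtype.ext
  have h3 := congrArg (besselPotential ℝ ℂ (-σ)) h2
  simp only [besselPotential_besselPotential_apply, add_neg_cancel, besselPotential_zero,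
    ContinuousLinearMap.id_apply] at h3
  exact h3

/-- The Sobolev norm: `‖T‖ = ‖Λ^σ T‖_{L²}`, which by Plancherel is
`(∫ (1 + |ξ|²)^σ |T̂(ξ)|² dξ)^{1/2}`. -/
instance (σ : ℝ) : NormedAddCommGroup (Sob σ) :=
  NormedAddCommGroup.induced (Sob σ) (Lp ℂ 2 (volume : Measure ℝ)) (Sob.bessel σ)
    (Sob.bessel_injective σ)

instance (σ : ℝ) : NormedSpace ℝ (Sob σ) :=
  NormedSpace.induced ℝ (Sob σ) (Lp ℂ 2 (volume : Measure ℝ)) (Sob.bessel σ)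

/-- A function `f : ℝ → ℝ` belongs to `H^σ(ℝ)`, `σ ≥ 0`. -/
def MemH (σ : ℝ) (f : ℝ → ℝ) : Prop :=
  MemLp f 2 (volume : Measure ℝ) ∧ ofFun (fun x => (f x : ℂ)) ∈ sobolevSubmodule σ

/-- The element of `H^σ(ℝ)` given by a function in it (`0` for all other functions). -/
def toSob (σ : ℝ) (f : ℝ → ℝ) : Sob σ :=
  open Classical in
  if hf : MemH σ f then Sob.mk (ofFun (fun x => (f x : ℂ))) hf.2 else 0

/-- The continuous representative of an element of `H^σ(ℝ)`, `σ > 1/2`. -/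
def Sob.rep {σ : ℝ} (T : Sob σ) : ℝ → ℝ :=
  open Classical in
  if h : ∃ f : ℝ → ℝ, Continuous f ∧ MemLp f 2 (volume : Measure ℝ) ∧
      ofFun (fun x => (f x : ℂ)) = T.dist then h.choose else 0

/-- The group `𝒟^σ(ℝ)`, `σ > 3/2`, of the `φ : ℝ → ℝ` with `φ - id ∈ H^σ(ℝ)` and `φ_x > 0`
everywhere (such `φ` are continuously differentiable). -/
def DiffGroup (σ : ℝ) : Set (ℝ → ℝ) :=
  {φ | ContDiff ℝ 1 φ ∧ MemH σ (fun x => φ x - x) ∧ ∀ x, 0 < deriv φ x}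

/-- The set `U^s`, `s > 1/2`, of the positive (continuous) `h : ℝ → ℝ` with
`h - 1 ∈ H^s(ℝ)`. -/
def HeightSet (s : ℝ) : Set (ℝ → ℝ) :=
  {h | Continuous h ∧ MemH s (fun x => h x - 1) ∧ ∀ x, 0 < h x}

/-- The duality pairing `⟨T, g⟩ = ∫ Λ^σ T · Λ^{-σ} g dx` of `T ∈ H^σ(ℝ; ℂ)` and
`g ∈ H^{-σ}(ℝ; ℂ)`, which extends `(T, g) ↦ ∫ T g dx`. -/
def dualPairing (σ : ℝ) (T g : 𝓢'(ℝ, ℂ)) : ℂ :=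
  ∫ x : ℝ, besselL2 σ T x * besselL2 (-σ) g x

/-- The product `f T` of a function `f` and a distribution `T ∈ H^σ(ℝ)`, `σ ≤ 0`, defined by
`⟨f T, ψ⟩ = ⟨T, f ψ⟩` for Schwartz functions `ψ`. -/
def mulDist (σ : ℝ) (f : ℝ → ℝ) (T : 𝓢'(ℝ, ℂ)) : 𝓢'(ℝ, ℂ) :=
  open Classical in
  if h : ∃ P : 𝓢'(ℝ, ℂ), ∀ ψ : 𝓢(ℝ, ℂ),
      P ψ = dualPairing σ T (ofFun (fun x => (f x : ℂ) * ψ x)) then h.choose else 0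

/-- The operator `A_h w = 3 h w - ∂_x (h³ w_x)` on `H^{s+1}(ℝ)`, `s > 1/2`. Here `w_x` is a
continuous function, and the outer derivative is the one of distributions. -/
def opA (s : ℝ) (h : ℝ → ℝ) (w : Sob (s + 1)) : 𝓢'(ℝ, ℂ) :=
  ofFun (fun x => ((3 * h x * w.rep x : ℝ) : ℂ)) -
    ∂_{(1 : ℝ)} (ofFun (fun x => ((h x ^ 3 * deriv w.rep x : ℝ) : ℂ)))

/-- The inverse `A_h⁻¹` of `A_h`. -/
def opAInv (s : ℝ) (h : ℝ → ℝ) (T : 𝓢'(ℝ, ℂ)) : Sob (s + 1) :=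
  Function.invFun (opA s h) T

/-- The distribution `3 h h_x + 2 ∂_x (h³ u_x²)` for `h ∈ U^s`, `u ∈ H^{s+1}(ℝ)`, `s > 1/2`.
The factor `h_x = ∂_x (h - 1)` lies in `H^{s-1}(ℝ)`, hence in `H^σ(ℝ)` with
`σ = min 0 (s - 1)`; its product with `h` is the one of functions for `s ≥ 1`, and is given by
the duality of `H^{s-1}(ℝ)` and `H^{1-s}(ℝ)` for `s < 1`. -/
def source (s : ℝ) (h u : ℝ → ℝ) : 𝓢'(ℝ, ℂ) :=
  (3 : ℂ) • mulDist (min 0 (s - 1)) h (∂_{(1 : ℝ)} (ofFun (fun x => ((h x - 1 : ℝ) : ℂ)))) +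
    (2 : ℂ) • ∂_{(1 : ℝ)} (ofFun (fun x => ((h x ^ 3 * deriv u x ^ 2 : ℝ) : ℂ)))

/-- The Eulerian height `h = (h₀ / φ_x) ∘ φ⁻¹`. -/
def eulerH (φ h₀ : ℝ → ℝ) : ℝ → ℝ :=
  fun y => h₀ (Function.invFun φ y) / deriv φ (Function.invFun φ y)

/-- The Eulerian velocity `u = v ∘ φ⁻¹`. -/
def eulerU (φ v : ℝ → ℝ) : ℝ → ℝ := fun y => v (Function.invFun φ y)

/-- The Lagrangian acceleration `F(φ, v, h₀) = -(A_h⁻¹ (3 h h_x + 2 ∂_x (h³ u_x²))) ∘ φ`, with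
`h = (h₀ / φ_x) ∘ φ⁻¹` and `u = v ∘ φ⁻¹`, as a function on `ℝ`. -/
def forceFun (s : ℝ) (φ v h₀ : ℝ → ℝ) : ℝ → ℝ :=
  fun x => -(opAInv s (eulerH φ h₀) (source s (eulerH φ h₀) (eulerU φ v))).rep (φ x)

/-- The map `φ = id + f` with coordinate `f ∈ H^{s+1}(ℝ)`. -/
def flowOf {σ : ℝ} (f : Sob σ) : ℝ → ℝ := fun x => x + f.rep x

/-- The height `h₀ = 1 + g` with coordinate `g ∈ H^s(ℝ)`. -/
def heightOf {σ : ℝ} (g : Sob σ) : ℝ → ℝ := fun x => 1 + g.rep x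

/-- The set `𝒟^{s+1}(ℝ) × H^{s+1}(ℝ) × U^s` in the global coordinates
`(φ - id, v, h₀ - 1) ∈ H^{s+1}(ℝ) × H^{s+1}(ℝ) × H^s(ℝ)`. -/
def domainF (s : ℝ) : Set (Sob (s + 1) × Sob (s + 1) × Sob s) :=
  {p | flowOf p.1 ∈ DiffGroup (s + 1) ∧ heightOf p.2.2 ∈ HeightSet s}

/-- The map `F` in the global coordinates `(φ - id, v, h₀ - 1)`, with values in
`H^{s+1}(ℝ)`. -/
def force (s : ℝ) (p : Sob (s + 1) × Sob (s + 1) × Sob s) : Sob (s + 1) :=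
  toSob (s + 1) (forceFun s (flowOf p.1) p.2.1.rep (heightOf p.2.2))

end GreenNaghdi

end

noncomputable section

namespace GreenNaghdi

/-! ### Sobolev weights, and distributions whose Fourier transform is a function. -/

open FourierTransform Filter Topology
open scoped ComplexConjugate

/-! In Eulerian variables `F` contains compositions with `φ` and `φ⁻¹`, and differentiating such a
composition in `φ` costs a derivative. Analyticity therefore cannot be read off from the definition.
It becomes visible once the elliptic equation is pulled back by `φ`, for then no composition is
left.

Let `w` solve `A_h w = 3 h h_x + 2 ∂(h³ u_x²)` and put `W = w ∘ φ`. The right side is the pure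
derivative of `(3/2)(h² - 1) + 2 h³ u_x²`. This holds also for `s < 1`, where `h h_x` is defined by
duality (`mulDist_deriv`). Moreover `h ∘ φ = h₀/φ_x`, `u_x ∘ φ = v_x/φ_x`, and `(∂Q) ∘ φ = (Q ∘
φ)_x/φ_x`. Multiplication by `φ_x` gives `3 h₀ W - ∂(h₀³ φ_x⁻⁴ W_x) = ∂G`, `G = (3/2)((h₀/φ_x)² - 1)
+ 2 (h₀/φ_x)³ (v_x/φ_x)²`, and `F = -W` (`opA_lagSol`, `forceFun_eq`). For `s > 1/2` the space `H^s`
is an algebra, so the coefficients and `G` are polynomials in `h₀ - 1`, `v_x` and `1/φ_x - 1`. The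
last of these is analytic in `φ`, because `1/(1+γ) - 1 = -γ/(1+γ)` comes from inverting a
multiplication operator. Inversion of bounded operators is analytic, hence so is `W`
(`analyticAt_lagSol`).

Bijectivity of `w ↦ 3(1+α)w - ∂((1+β)w_x)` from `H^{s+1}` onto `H^{s-1}` (`opB_bijective`) serves
both `A_h` and its conjugate. Injectivity is the energy identity. Surjectivity is Lax–Milgram in
`H¹` (note `s - 1 > -1`), followed by a bootstrap in which each step gains one order, up to `s + 1`.

The function space facts behind this are the product theorem `H^σ · H^r ⊂ H^σ` for `0 ≤ σ ≤ r`, `r >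
1/2` (Young's inequality on the Fourier side), closure of `1 + H^s` under reciprocals
(`MemH.reciprocal`), and invariance of `H^σ`, `0 ≤ σ ≤ s + 1`, under composition with `φ⁻¹`
(`IsDiffeo.memH_comp`). The last two are proved for orders below 1 with the Gagliardo seminorm and
raised to higher orders by weak chain rules. -/

/-- The Sobolev weight `(1 + ξ²)^{σ/2}`. -/
def wt (σ ξ : ℝ) : ℝ := (1 + ξ ^ 2) ^ (σ / 2)

theorem wt_pos (σ ξ : ℝ) : 0 < wt σ ξ := by unfold wt; positivity

theorem wt_add (σ τ ξ : ℝ) : wt (σ + τ) ξ = wt σ ξ * wt τ ξ := by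
  unfold wt
  rw [← Real.rpow_add (by positivity)]
  congr 1; ring

@[simp] theorem wt_zero (ξ : ℝ) : wt 0 ξ = 1 := by simp [wt]

theorem wt_neg_mul (σ ξ : ℝ) : wt (-σ) ξ * wt σ ξ = 1 := by
  rw [← wt_add]; simp

theorem wt_mul_neg (σ ξ : ℝ) : wt σ ξ * wt (-σ) ξ = 1 := by
  rw [← wt_add]; simp

theorem wt_mono {σ τ : ℝ} (h : σ ≤ τ) (ξ : ℝ) : wt σ ξ ≤ wt τ ξ := by
  unfold wt
  exact Real.rpow_le_rpow_of_exponent_le (by nlinarith [sq_nonneg ξ]) (by linarith)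

theorem continuous_wt (σ : ℝ) : Continuous (wt σ) := by
  unfold wt
  refine Continuous.rpow_const (by fun_prop) fun x => Or.inl (by positivity)

@[simp] theorem wt_neg_arg (σ ξ : ℝ) : wt σ (-ξ) = wt σ ξ := by simp [wt]

theorem abs_le_wt_one (ξ : ℝ) : |ξ| ≤ wt 1 ξ := by
  unfold wt
  rw [← Real.sqrt_eq_rpow]
  exact Real.abs_le_sqrt (by linarith)

theorem hasTemperateGrowth_wt (σ : ℝ) :
    Function.HasTemperateGrowth (fun ξ : ℝ => (wt σ ξ : ℂ)) := by
  have := Function.hasTemperateGrowth_one_add_norm_sq_rpow ℝ (σ / 2)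
  have h2 : (fun ξ : ℝ => (wt σ ξ : ℂ)) = fun ξ : ℝ => (((1 + ‖ξ‖ ^ 2) ^ (σ / 2) : ℝ) : ℂ) := by
    ext ξ; simp [wt]
  rw [h2]
  fun_prop

/-- `T` is a distribution of Sobolev order `σ` whose Fourier transform is the function `F`. -/
structure IsHat (σ : ℝ) (T : 𝓢'(ℝ, ℂ)) (F : ℝ → ℂ) : Prop where
  memLp : MemLp (fun ξ => (wt σ ξ : ℂ) * F ξ) 2 (volume : Measure ℝ)
  fourier : ∀ ψ : 𝓢(ℝ, ℂ), 𝓕 T ψ = ∫ ξ, ψ ξ * F ξ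

theorem IsHat.aestronglyMeasurable {σ : ℝ} {T : 𝓢'(ℝ, ℂ)} {F : ℝ → ℂ} (h : IsHat σ T F) :
    AEStronglyMeasurable F (volume : Measure ℝ) := by
  have h1 : F = fun ξ => (wt (-σ) ξ : ℂ) * ((wt σ ξ : ℂ) * F ξ) := by
    ext ξ
    rw [← mul_assoc, ← Complex.ofReal_mul, wt_neg_mul]; simp
  rw [h1]
  refine AEStronglyMeasurable.mul ?_ h.memLp.1
  exact (Complex.continuous_ofReal.comp (continuous_wt _)).aestronglyMeasurable

theorem memLp_wt_mono {σ τ : ℝ} (hτ : τ ≤ σ) {F : ℝ → ℂ}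
    (h : MemLp (fun ξ => (wt σ ξ : ℂ) * F ξ) 2 (volume : Measure ℝ)) :
    MemLp (fun ξ => (wt τ ξ : ℂ) * F ξ) 2 (volume : Measure ℝ) := by
  have h1 : (fun ξ => (wt τ ξ : ℂ) * F ξ) =
      fun ξ => (wt (τ - σ) ξ : ℂ) * ((wt σ ξ : ℂ) * F ξ) := by
    ext ξ
    rw [← mul_assoc, ← Complex.ofReal_mul, ← wt_add]; simp
  refine h.mono ?_ (Filter.Eventually.of_forall fun ξ => ?_)
  · rw [h1]
    refine AEStronglyMeasurable.mul ?_ h.1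
    exact (Complex.continuous_ofReal.comp (continuous_wt _)).aestronglyMeasurable
  · rw [norm_mul, norm_mul, Complex.norm_real, Complex.norm_real, Real.norm_of_nonneg (wt_pos _ _).le,
      Real.norm_of_nonneg (wt_pos _ _).le]
    gcongr
    exact wt_mono hτ ξ

theorem IsHat.mono {σ τ : ℝ} (hτ : τ ≤ σ) {T : 𝓢'(ℝ, ℂ)} {F : ℝ → ℂ} (h : IsHat σ T F) :
    IsHat τ T F :=
  ⟨memLp_wt_mono hτ h.memLp, h.fourier⟩

theorem IsHat.fourier_bessel {σ : ℝ} {T : 𝓢'(ℝ, ℂ)} {F : ℝ → ℂ} (h : IsHat σ T F) :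
    𝓕 (besselPotential ℝ ℂ σ T) = ((h.memLp.toLp _ : Lp ℂ 2 (volume : Measure ℝ)) : 𝓢'(ℝ, ℂ)) := by
  ext ψ
  rw [fourier_besselPotential_eq_smulLeftCLM_fourier_apply, smulLeftCLM_apply_apply, h.fourier,
    Lp.toTemperedDistribution_apply]
  have h2 : (fun ξ : ℝ => (((1 + ‖ξ‖ ^ 2) ^ (σ / 2) : ℝ) : ℂ)) = fun ξ : ℝ => (wt σ ξ : ℂ) := by
    ext ξ; simp [wt]
  rw [h2]
  apply integral_congr_ae
  filter_upwards [h.memLp.coeFn_toLp] with ξ hξ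
  rw [hξ, SchwartzMap.smulLeftCLM_apply_apply (hasTemperateGrowth_wt σ)]
  simp only [smul_eq_mul]; ring

theorem IsHat.memSobolev {σ : ℝ} {T : 𝓢'(ℝ, ℂ)} {F : ℝ → ℂ} (h : IsHat σ T F) :
    MemSobolev σ 2 T := by
  refine ⟨𝓕⁻ (h.memLp.toLp _), ?_⟩
  rw [← Lp.fourierInv_toTemperedDistribution_eq, ← h.fourier_bessel, fourierInv_fourier_eq]

theorem IsHat.fourier_besselL2 {σ : ℝ} {T : 𝓢'(ℝ, ℂ)} {F : ℝ → ℂ} (h : IsHat σ T F) :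
    𝓕 (besselL2 σ T) = h.memLp.toLp _ := by
  apply Lp_dist_injective
  rw [← Lp.fourier_toTemperedDistribution_eq, ← besselL2_spec h.memSobolev, h.fourier_bessel]

theorem IsHat.fourier_besselL2_ae {σ : ℝ} {T : 𝓢'(ℝ, ℂ)} {F : ℝ → ℂ} (h : IsHat σ T F) :
    (𝓕 (besselL2 σ T) : Lp ℂ 2 (volume : Measure ℝ)) =ᵐ[volume] fun ξ => (wt σ ξ : ℂ) * F ξ := by
  rw [h.fourier_besselL2]
  exact h.memLp.coeFn_toLp

theorem IsHat.norm_besselL2 {σ : ℝ} {T : 𝓢'(ℝ, ℂ)} {F : ℝ → ℂ} (h : IsHat σ T F) :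
    ‖besselL2 σ T‖ = (eLpNorm (fun ξ => (wt σ ξ : ℂ) * F ξ) 2 volume).toReal := by
  rw [← Lp.norm_fourier_eq, h.fourier_besselL2, Lp.norm_toLp]

/-- The function is the `L²` Fourier transform of `besselL2 σ T`, divided by the weight. -/
theorem exists_isHat {σ : ℝ} {T : 𝓢'(ℝ, ℂ)} (hT : MemSobolev σ 2 T) : ∃ F, IsHat σ T F := by
  set u : Lp ℂ 2 (volume : Measure ℝ) := 𝓕 (besselL2 σ T) with hu
  have h1 : (fun ξ => (wt σ ξ : ℂ) * ((wt (-σ) ξ : ℂ) * u ξ)) = u := by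
    ext ξ
    rw [← mul_assoc, ← Complex.ofReal_mul, wt_mul_neg]; simp
  refine ⟨fun ξ => (wt (-σ) ξ : ℂ) * u ξ, ?_, fun ψ => ?_⟩
  · rw [h1]; exact Lp.memLp u
  · have h2 : T = besselPotential ℝ ℂ (-σ) (besselL2 σ T) := by
      rw [← besselL2_spec hT, besselPotential_besselPotential_apply]; simp
    conv_lhs => rw [h2]
    rw [fourier_besselPotential_eq_smulLeftCLM_fourier_apply, smulLeftCLM_apply_apply,
      Lp.fourier_toTemperedDistribution_eq, ← hu, Lp.toTemperedDistribution_apply]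
    have h2 : (fun ξ : ℝ => (((1 + ‖ξ‖ ^ 2) ^ (-σ / 2) : ℝ) : ℂ)) =
        fun ξ : ℝ => (wt (-σ) ξ : ℂ) := by
      ext ξ; simp [wt]
    rw [h2]
    refine integral_congr_ae (Filter.Eventually.of_forall fun ξ => ?_)
    dsimp only
    rw [SchwartzMap.smulLeftCLM_apply_apply (hasTemperateGrowth_wt (-σ))]
    simp only [smul_eq_mul]; ring

/-- The two orders may differ. Both descriptions are compared at the smaller order, where the
positive weight can be cancelled. -/
theorem IsHat.unique {σ τ : ℝ} {T : 𝓢'(ℝ, ℂ)} {F G : ℝ → ℂ} (hF : IsHat σ T F)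
    (hG : IsHat τ T G) : F =ᵐ[volume] G := by
  have hF' := (hF.mono (min_le_left σ τ)).fourier_besselL2_ae
  have hG' := (hG.mono (min_le_right σ τ)).fourier_besselL2_ae
  filter_upwards [hF', hG'] with ξ h1 h2
  rw [h1] at h2
  have := (wt_pos (min σ τ) ξ).ne'
  exact mul_left_cancel₀ (by exact_mod_cast this) h2

theorem IsHat.congr {σ : ℝ} {T : 𝓢'(ℝ, ℂ)} {F G : ℝ → ℂ} (hF : IsHat σ T F)
    (h : F =ᵐ[volume] G) : IsHat σ T G := by
  refine ⟨(memLp_congr_ae ?_).mp hF.memLp, fun ψ => ?_⟩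
  · filter_upwards [h] with ξ hξ; rw [hξ]
  · rw [hF.fourier]
    apply integral_congr_ae
    filter_upwards [h] with ξ hξ; rw [hξ]

theorem IsHat.of_memLp {σ τ : ℝ} {T : 𝓢'(ℝ, ℂ)} {F : ℝ → ℂ} (hF : IsHat σ T F)
    (h : MemLp (fun ξ => (wt τ ξ : ℂ) * F ξ) 2 (volume : Measure ℝ)) : IsHat τ T F :=
  ⟨h, hF.fourier⟩

/-- By uniqueness the transform does not depend on the order, so further regularity of the
distribution is further decay of the same function. -/
theorem IsHat.memLp_of_memSobolev {σ τ : ℝ} {T : 𝓢'(ℝ, ℂ)} {F : ℝ → ℂ} (hF : IsHat σ T F)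
    (h : MemSobolev τ 2 T) : IsHat τ T F := by
  obtain ⟨G, hG⟩ := exists_isHat h
  exact hG.congr (hG.unique hF)

/-- The weight is moved onto the test function: `wt (-σ) ψ` is again Schwartz, hence in `L²`, as is
`wt σ F`. -/
theorem IsHat.integrable_mul {σ : ℝ} {T : 𝓢'(ℝ, ℂ)} {F : ℝ → ℂ} (hF : IsHat σ T F)
    (ψ : 𝓢(ℝ, ℂ)) : Integrable (fun ξ => ψ ξ * F ξ) := by
  have h1 : MemLp (SchwartzMap.smulLeftCLM ℂ (fun ξ : ℝ => (wt (-σ) ξ : ℂ)) ψ) 2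
      (volume : Measure ℝ) := SchwartzMap.memLp _ 2 volume
  refine (MemLp.integrable_mul h1 hF.memLp).congr (Filter.Eventually.of_forall fun ξ => ?_)
  simp only [Pi.mul_apply]
  rw [SchwartzMap.smulLeftCLM_apply_apply (hasTemperateGrowth_wt (-σ)), smul_eq_mul]
  have : (wt (-σ) ξ : ℂ) * (wt σ ξ : ℂ) = 1 := by
    rw [← Complex.ofReal_mul, wt_neg_mul]; simp
  linear_combination (ψ ξ * F ξ) * this

theorem IsHat.add {σ : ℝ} {S T : 𝓢'(ℝ, ℂ)} {F G : ℝ → ℂ} (hS : IsHat σ S F) (hT : IsHat σ T G) :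
    IsHat σ (S + T) (fun ξ => F ξ + G ξ) := by
  refine ⟨?_, fun ψ => ?_⟩
  · simp only [mul_add]; exact hS.memLp.add hT.memLp
  · have : 𝓕 (S + T) ψ = 𝓕 S ψ + 𝓕 T ψ := rfl
    rw [this, hS.fourier, hT.fourier, ← integral_add (hS.integrable_mul ψ) (hT.integrable_mul ψ)]
    simp only [mul_add]

theorem IsHat.smul {σ : ℝ} {T : 𝓢'(ℝ, ℂ)} {F : ℝ → ℂ} (c : ℂ) (hT : IsHat σ T F) :
    IsHat σ (c • T) (fun ξ => c * F ξ) := by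
  refine ⟨?_, fun ψ => ?_⟩
  · simp only [mul_left_comm _ c]; exact hT.memLp.const_mul c
  · have : 𝓕 (c • T) ψ = c * 𝓕 T ψ := rfl
    rw [this, hT.fourier, ← integral_const_mul]
    simp only [mul_left_comm _ c]

theorem IsHat.lineDeriv {σ : ℝ} {T : 𝓢'(ℝ, ℂ)} {F : ℝ → ℂ} (hT : IsHat σ T F) :
    IsHat (σ - 1) (∂_{(1 : ℝ)} T) (fun ξ => (2 * Real.pi * Complex.I * ξ) * F ξ) := by
  refine ⟨?_, fun ψ => ?_⟩
  · have h1 : MemLp (fun ξ => ((2 * Real.pi : ℝ) : ℂ) * ((wt σ ξ : ℂ) * F ξ)) 2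
        (volume : Measure ℝ) := hT.memLp.const_mul _
    refine h1.mono ?_ (Filter.Eventually.of_forall fun ξ => ?_)
    · refine AEStronglyMeasurable.mul ?_ (AEStronglyMeasurable.mul ?_ hT.aestronglyMeasurable)
      · exact (Complex.continuous_ofReal.comp (continuous_wt _)).aestronglyMeasurable
      · exact (by fun_prop : Continuous fun ξ : ℝ =>
          (2 * Real.pi * Complex.I * ξ : ℂ)).aestronglyMeasurable
    · simp only [norm_mul, Complex.norm_real, Real.norm_of_nonneg (wt_pos _ _).le, Complex.norm_I,
        Complex.norm_ofNat, Real.norm_of_nonneg Real.pi_pos.le, Real.norm_ofNat, Real.norm_eq_abs ξ]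
      have h3 : wt σ ξ = wt (σ - 1) ξ * wt 1 ξ := by rw [← wt_add]; simp
      rw [h3]
      have := abs_le_wt_one ξ
      have h4 := wt_pos (σ - 1) ξ
      have h5 := Real.pi_pos
      calc wt (σ - 1) ξ * (2 * Real.pi * 1 * |ξ| * ‖F ξ‖)
          = 2 * Real.pi * (wt (σ - 1) ξ * |ξ| * ‖F ξ‖) := by ring
        _ ≤ 2 * Real.pi * (wt (σ - 1) ξ * wt 1 ξ * ‖F ξ‖) := by gcongr
        _ = _ := by ring
  · rw [fourier_lineDerivOp_eq]
    have : ∀ (c : ℂ) (S : 𝓢'(ℝ, ℂ)), (c • S) ψ = c * S ψ := fun c S => rfl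
    rw [this, smulLeftCLM_apply_apply, hT.fourier, ← integral_const_mul]
    refine integral_congr_ae (Filter.Eventually.of_forall fun ξ => ?_)
    dsimp only
    rw [SchwartzMap.smulLeftCLM_apply_apply (by fun_prop)]
    simp
    ring

/-- A square integrable function has a Sobolev order `σ + 1` when its derivative has order `σ`. -/
theorem IsHat.of_lineDeriv {σ τ ρ : ℝ} {T : 𝓢'(ℝ, ℂ)} {F : ℝ → ℂ} (hT : IsHat τ T F)
    (hρ : MemSobolev ρ 2 T) (hρ' : σ ≤ ρ)
    (hD : MemSobolev σ 2 (∂_{(1 : ℝ)} T)) : IsHat (σ + 1) T F := by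
  have h0 : IsHat σ T F := hT.memLp_of_memSobolev (hρ.mono hρ')
  have h1 := hT.lineDeriv.memLp_of_memSobolev hD
  refine hT.of_memLp ?_
  have h2 : MemLp (fun ξ => ‖(wt σ ξ : ℂ) * F ξ‖ +
      ‖(wt σ ξ : ℂ) * ((2 * Real.pi * Complex.I * ξ) * F ξ)‖) 2 (volume : Measure ℝ) :=
    h0.memLp.norm.add h1.memLp.norm
  refine h2.mono ?_ (Filter.Eventually.of_forall fun ξ => ?_)
  · refine AEStronglyMeasurable.mul ?_ hT.aestronglyMeasurable
    exact (Complex.continuous_ofReal.comp (continuous_wt _)).aestronglyMeasurable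
  · rw [Real.norm_of_nonneg (by positivity)]
    simp only [norm_mul, Complex.norm_real, Real.norm_of_nonneg (wt_pos _ _).le, Complex.norm_I,
        Complex.norm_ofNat, Real.norm_of_nonneg Real.pi_pos.le, Real.norm_eq_abs ξ]
    rw [wt_add]
    have h3 : wt 1 ξ ≤ 1 + |ξ| := by
      unfold wt
      rw [← Real.sqrt_eq_rpow]
      apply Real.sqrt_le_iff.mpr
      constructor
      · positivity
      · nlinarith [abs_nonneg ξ, sq_abs ξ]
    have h4 := wt_pos σ ξ
    -- Only `1 ≤ 2π` matters: it bounds `|ξ|` by the modulus of the symbol `2πiξ` of the derivative.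
    have h5 := Real.pi_gt_three
    calc wt σ ξ * wt 1 ξ * ‖F ξ‖ ≤ wt σ ξ * (1 + |ξ|) * ‖F ξ‖ := by gcongr
      _ = wt σ ξ * ‖F ξ‖ + wt σ ξ * (1 * 1 * |ξ| * ‖F ξ‖) := by ring
      _ ≤ _ := by gcongr; linarith

/-! ### Square integrable functions as distributions; real distributions. -/

theorem ofFun_apply {f : ℝ → ℂ} (hf : MemLp f 2 (volume : Measure ℝ)) (ψ : 𝓢(ℝ, ℂ)) :
    ofFun f ψ = ∫ x, ψ x * f x := by
  rw [ofFun, dif_pos hf, Lp.toTemperedDistribution_apply]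
  apply integral_congr_ae
  filter_upwards [hf.coeFn_toLp] with x hx
  rw [hx, smul_eq_mul]

theorem ofFun_coe_Lp (u : Lp ℂ 2 (volume : Measure ℝ)) : ofFun u = (u : 𝓢'(ℝ, ℂ)) := by
  rw [ofFun, dif_pos (Lp.memLp u), Lp.toLp_coeFn]

theorem ofFun_congr {f g : ℝ → ℂ} (h : f =ᵐ[volume] g) : ofFun f = ofFun g := by
  by_cases hf : MemLp f 2 (volume : Measure ℝ)
  · have hg := (memLp_congr_ae h).mp hf
    rw [ofFun, ofFun, dif_pos hf, dif_pos hg, (MemLp.toLp_eq_toLp_iff hf hg).mpr h]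
  · have hg : ¬ MemLp g 2 (volume : Measure ℝ) := fun h' => hf ((memLp_congr_ae h).mpr h')
    rw [ofFun, ofFun, dif_neg hf, dif_neg hg]

theorem ofFun_inj {f g : ℝ → ℂ} (hf : MemLp f 2 (volume : Measure ℝ))
    (hg : MemLp g 2 (volume : Measure ℝ)) (h : ofFun f = ofFun g) : f =ᵐ[volume] g := by
  rw [ofFun, ofFun, dif_pos hf, dif_pos hg] at h
  exact (MemLp.toLp_eq_toLp_iff hf hg).mp (Lp_dist_injective h)

theorem integrable_schwartz_mul {f : ℝ → ℂ} (hf : MemLp f 2 (volume : Measure ℝ))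
    (ψ : 𝓢(ℝ, ℂ)) : Integrable (fun x => ψ x * f x) :=
  MemLp.integrable_mul (SchwartzMap.memLp ψ 2 volume) hf

theorem ofFun_add {f g : ℝ → ℂ} (hf : MemLp f 2 (volume : Measure ℝ))
    (hg : MemLp g 2 (volume : Measure ℝ)) : ofFun (fun x => f x + g x) = ofFun f + ofFun g := by
  ext ψ
  have : (ofFun f + ofFun g) ψ = ofFun f ψ + ofFun g ψ := rfl
  have hfg : MemLp (fun x => f x + g x) 2 (volume : Measure ℝ) := hf.add hg
  rw [this, ofFun_apply hf, ofFun_apply hg, ofFun_apply hfg,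
    ← integral_add (integrable_schwartz_mul hf ψ) (integrable_schwartz_mul hg ψ)]
  simp only [mul_add]

theorem ofFun_const_mul {f : ℝ → ℂ} (c : ℂ) (hf : MemLp f 2 (volume : Measure ℝ)) :
    ofFun (fun x => c * f x) = c • ofFun f := by
  ext ψ
  have : (c • ofFun f) ψ = c * ofFun f ψ := rfl
  rw [this, ofFun_apply hf, ofFun_apply (hf.const_mul c), ← integral_const_mul]
  simp only [mul_left_comm _ c]

theorem memLp_ofReal {f : ℝ → ℝ} (hf : MemLp f 2 (volume : Measure ℝ)) :
    MemLp (fun x => (f x : ℂ)) 2 (volume : Measure ℝ) := hf.ofReal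

theorem ofFun_add_real {f g : ℝ → ℝ} (hf : MemLp f 2 (volume : Measure ℝ))
    (hg : MemLp g 2 (volume : Measure ℝ)) : ofFun (fun x => ((f x + g x : ℝ) : ℂ)) =
      ofFun (fun x => (f x : ℂ)) + ofFun (fun x => (g x : ℂ)) := by
  rw [← ofFun_add (memLp_ofReal hf) (memLp_ofReal hg)]
  push_cast; rfl

theorem ofFun_const_mul_real {f : ℝ → ℝ} (c : ℝ) (hf : MemLp f 2 (volume : Measure ℝ)) :
    ofFun (fun x => ((c * f x : ℝ) : ℂ)) = (c : ℂ) • ofFun (fun x => (f x : ℂ)) := by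
  rw [← ofFun_const_mul _ (memLp_ofReal hf)]
  push_cast; rfl

theorem isHat_ofFun {f : ℝ → ℂ} (hf : MemLp f 2 (volume : Measure ℝ)) :
    IsHat 0 (ofFun f) (𝓕 (hf.toLp f) : Lp ℂ 2 (volume : Measure ℝ)) := by
  refine ⟨?_, fun ψ => ?_⟩
  · simpa using Lp.memLp _
  · rw [ofFun, dif_pos hf, Lp.fourier_toTemperedDistribution_eq, Lp.toTemperedDistribution_apply]
    rfl

theorem exists_ofFun_of_memSobolev {σ : ℝ} (hσ : 0 ≤ σ) {T : 𝓢'(ℝ, ℂ)} (hT : MemSobolev σ 2 T) :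
    ∃ f : ℝ → ℂ, MemLp f 2 (volume : Measure ℝ) ∧ ofFun f = T := by
  obtain ⟨u, hu⟩ := memSobolev_zero_iff.mp (hT.mono hσ)
  exact ⟨u, Lp.memLp u, by rw [ofFun_coe_Lp, hu]⟩

/-- The real part of a Schwartz function. -/
def schwartzRe (ψ : 𝓢(ℝ, ℂ)) : 𝓢(ℝ, ℂ) :=
  SchwartzMap.postcompCLM (𝕜 := ℝ) (Complex.ofRealCLM ∘L Complex.reCLM) ψ

/-- The imaginary part of a Schwartz function. -/
def schwartzIm (ψ : 𝓢(ℝ, ℂ)) : 𝓢(ℝ, ℂ) :=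
  SchwartzMap.postcompCLM (𝕜 := ℝ) (Complex.ofRealCLM ∘L Complex.imCLM) ψ

theorem schwartzRe_apply (ψ : 𝓢(ℝ, ℂ)) (x : ℝ) : schwartzRe ψ x = ((ψ x).re : ℂ) := rfl

theorem schwartzIm_apply (ψ : 𝓢(ℝ, ℂ)) (x : ℝ) : schwartzIm ψ x = ((ψ x).im : ℂ) := rfl

theorem schwartz_decomp (ψ : 𝓢(ℝ, ℂ)) : ψ = schwartzRe ψ + Complex.I • schwartzIm ψ := by
  ext x
  have : (schwartzRe ψ + Complex.I • schwartzIm ψ) x =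
    schwartzRe ψ x + Complex.I * schwartzIm ψ x := rfl
  rw [this, schwartzRe_apply, schwartzIm_apply, mul_comm, Complex.re_add_im]

/-- Complex linearity, applied to the real and imaginary parts of a test function. -/
theorem dist_ext_real {S T : 𝓢'(ℝ, ℂ)} (h : ∀ ψ : 𝓢(ℝ, ℂ), (∀ x, (ψ x).im = 0) → S ψ = T ψ) :
    S = T := by
  ext ψ
  rw [schwartz_decomp ψ, map_add, map_add, map_smul, map_smul,
    h _ (fun x => by simp [schwartzRe_apply]), h _ (fun x => by simp [schwartzIm_apply])]

theorem isRealDist_ofFun (f : ℝ → ℝ) : IsRealDist (ofFun (fun x => (f x : ℂ))) := by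
  intro ψ hψ
  by_cases hf : MemLp (fun x => (f x : ℂ)) 2 (volume : Measure ℝ)
  · rw [ofFun_apply hf]
    have h1 : ∀ x, ψ x * (f x : ℂ) = (((ψ x).re * f x : ℝ) : ℂ) := fun x => by
      apply Complex.ext <;> simp [hψ x]
    simp_rw [h1]
    rw [integral_complex_ofReal, Complex.ofReal_im]
  · rw [ofFun, dif_neg hf]
    have : (0 : 𝓢'(ℝ, ℂ)) ψ = 0 := rfl
    simp [this]

theorem lineDeriv_one_apply (T : 𝓢'(ℝ, ℂ)) (ψ : 𝓢(ℝ, ℂ)) :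
    (∂_{(1 : ℝ)} T) ψ = - T (SchwartzMap.derivCLM ℂ ℂ ψ) := by
  rw [TemperedDistribution.lineDerivOp_apply_apply]
  have h : ∂_{(1 : ℝ)} ψ = SchwartzMap.derivCLM ℂ ℂ ψ := by
    ext x
    rw [SchwartzMap.lineDerivOp_apply_eq_fderiv, SchwartzMap.derivCLM_apply, fderiv_apply_one_eq_deriv]
  rw [h, map_neg]

theorem derivCLM_im_eq_zero {ψ : 𝓢(ℝ, ℂ)} (hψ : ∀ x, (ψ x).im = 0) (x : ℝ) :
    (SchwartzMap.derivCLM ℂ ℂ ψ x).im = 0 := by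
  have h1 := Complex.imCLM.hasFDerivAt.comp_hasDerivAt x (ψ.hasDerivAt x)
  have h2 : (Complex.imCLM ∘ ψ) = fun _ => (0 : ℝ) := by
    ext y; simp [hψ y]
  rw [h2] at h1
  rw [SchwartzMap.derivCLM_apply]
  exact h1.unique (hasDerivAt_const x 0)

theorem isRealDist_lineDeriv {T : 𝓢'(ℝ, ℂ)} (hT : IsRealDist T) :
    IsRealDist (∂_{(1 : ℝ)} T) := fun ψ hψ => by
  rw [lineDeriv_one_apply, Complex.neg_im, hT _ (derivCLM_im_eq_zero hψ), neg_zero]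

/-- The imaginary part of a representing function integrates to zero against every real test
function, hence vanishes almost everywhere. -/
theorem exists_real_ofFun {σ : ℝ} (hσ : 0 ≤ σ) {T : 𝓢'(ℝ, ℂ)} (hT : T ∈ sobolevSubmodule σ) :
    ∃ f : ℝ → ℝ, MemLp f 2 (volume : Measure ℝ) ∧ ofFun (fun x => (f x : ℂ)) = T := by
  obtain ⟨f, hf, hfT⟩ := exists_ofFun_of_memSobolev hσ hT.1
  have him : MemLp (fun x => ((f x).im : ℂ)) 2 (volume : Measure ℝ) := hf.im.ofReal
  have h0 : ofFun (fun x => ((f x).im : ℂ)) = ofFun (fun _ => (0 : ℂ)) := by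
    apply dist_ext_real
    intro ψ hψ
    rw [ofFun_apply him, ofFun_apply (MemLp.zero' (ε := ℂ))]
    have h1 := hT.2 ψ hψ
    rw [← hfT, ofFun_apply hf] at h1
    have h2 : (∫ x, ψ x * f x).im = ∫ x, (ψ x * f x).im :=
      (integral_im (integrable_schwartz_mul hf ψ)).symm
    rw [h2] at h1
    have h3 : ∀ x, ψ x * ((f x).im : ℂ) = (((ψ x * f x).im : ℝ) : ℂ) := fun x => by
      apply Complex.ext <;> simp [hψ x]
    simp_rw [h3]
    rw [integral_complex_ofReal, h1]
    simp
  have h1 := ofFun_inj him (MemLp.zero' (ε := ℂ)) h0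
  refine ⟨fun x => (f x).re, hf.re, ?_⟩
  rw [← hfT]
  apply ofFun_congr
  filter_upwards [h1] with x hx
  apply Complex.ext
  · simp
  · simpa using (congrArg Complex.re hx).symm

/-! ### Functions of Sobolev order `σ` and the elements they define. -/

theorem memH_iff {σ : ℝ} {f : ℝ → ℝ} : MemH σ f ↔
    MemLp f 2 (volume : Measure ℝ) ∧ MemSobolev σ 2 (ofFun (fun x => (f x : ℂ))) :=
  ⟨fun h => ⟨h.1, h.2.1⟩, fun h => ⟨h.1, h.2, isRealDist_ofFun f⟩⟩

theorem MemH.memLp {σ : ℝ} {f : ℝ → ℝ} (h : MemH σ f) : MemLp f 2 (volume : Measure ℝ) := h.1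

theorem MemH.memSobolev {σ : ℝ} {f : ℝ → ℝ} (h : MemH σ f) :
    MemSobolev σ 2 (ofFun (fun x => (f x : ℂ))) := h.2.1

theorem MemH.memLpC {σ : ℝ} {f : ℝ → ℝ} (h : MemH σ f) :
    MemLp (fun x => (f x : ℂ)) 2 (volume : Measure ℝ) := h.1.ofReal

theorem MemH.mono {σ τ : ℝ} {f : ℝ → ℝ} (h : MemH σ f) (hτ : τ ≤ σ) : MemH τ f :=
  memH_iff.mpr ⟨h.1, h.memSobolev.mono hτ⟩

theorem MemH.congr {σ : ℝ} {f g : ℝ → ℝ} (hf : MemH σ f) (h : f =ᵐ[volume] g) : MemH σ g := by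
  refine memH_iff.mpr ⟨(memLp_congr_ae h).mp hf.1, ?_⟩
  have : (fun x => (f x : ℂ)) =ᵐ[volume] fun x => (g x : ℂ) := by
    filter_upwards [h] with x hx; rw [hx]
  rw [← ofFun_congr this]
  exact hf.memSobolev

theorem memH_zero_iff {f : ℝ → ℝ} : MemH 0 f ↔ MemLp f 2 (volume : Measure ℝ) :=
  ⟨fun h => h.1, fun h => memH_iff.mpr ⟨h, (isHat_ofFun h.ofReal).memSobolev⟩⟩

theorem MemH.add {σ : ℝ} {f g : ℝ → ℝ} (hf : MemH σ f) (hg : MemH σ g) :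
    MemH σ (fun x => f x + g x) := by
  refine memH_iff.mpr ⟨hf.1.add hg.1, ?_⟩
  rw [ofFun_add_real hf.1 hg.1]
  exact hf.memSobolev.add hg.memSobolev

theorem MemH.const_mul {σ : ℝ} {f : ℝ → ℝ} (c : ℝ) (hf : MemH σ f) :
    MemH σ (fun x => c * f x) := by
  refine memH_iff.mpr ⟨hf.1.const_mul c, ?_⟩
  rw [ofFun_const_mul_real c hf.1]
  exact hf.memSobolev.smul _

theorem MemH.neg {σ : ℝ} {f : ℝ → ℝ} (hf : MemH σ f) : MemH σ (fun x => -f x) := by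
  simpa using hf.const_mul (-1)

theorem Sob.ext_dist {σ : ℝ} {S T : Sob σ} (h : S.dist = T.dist) : S = T := Subtype.ext h

theorem Sob.dist_mem {σ : ℝ} (T : Sob σ) : T.dist ∈ sobolevSubmodule σ := T.2

@[simp] theorem Sob.dist_mk {σ : ℝ} (T : 𝓢'(ℝ, ℂ)) (hT : T ∈ sobolevSubmodule σ) :
    (Sob.mk T hT).dist = T := rfl

theorem toSob_dist {σ : ℝ} {f : ℝ → ℝ} (hf : MemH σ f) :
    (toSob σ f).dist = ofFun (fun x => (f x : ℂ)) := by
  rw [toSob, dif_pos hf]; rfl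

theorem Sob.norm_eq {σ : ℝ} (T : Sob σ) {F : ℝ → ℂ} (h : IsHat σ T.dist F) :
    ‖T‖ = (eLpNorm (fun ξ => (wt σ ξ : ℂ) * F ξ) 2 volume).toReal := h.norm_besselL2

/-- The Fourier transform of an element of `H^σ(ℝ)`. -/
def Sob.hat {σ : ℝ} (T : Sob σ) : ℝ → ℂ := (exists_isHat T.memSobolev_dist).choose

theorem Sob.isHat {σ : ℝ} (T : Sob σ) : IsHat σ T.dist T.hat :=
  (exists_isHat T.memSobolev_dist).choose_spec

/-- A square integrable function representing an element of `H^σ(ℝ)`, `σ ≥ 0`. -/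
def Sob.fn {σ : ℝ} (T : Sob σ) : ℝ → ℝ :=
  open Classical in
  if h : 0 ≤ σ then (exists_real_ofFun h T.dist_mem).choose else 0

theorem Sob.memLp_fn {σ : ℝ} (hσ : 0 ≤ σ) (T : Sob σ) : MemLp T.fn 2 (volume : Measure ℝ) := by
  rw [Sob.fn, dif_pos hσ]
  exact (exists_real_ofFun hσ T.dist_mem).choose_spec.1

theorem Sob.ofFun_fn {σ : ℝ} (hσ : 0 ≤ σ) (T : Sob σ) :
    ofFun (fun x => (T.fn x : ℂ)) = T.dist := by
  rw [Sob.fn, dif_pos hσ]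
  exact (exists_real_ofFun hσ T.dist_mem).choose_spec.2

theorem Sob.memH_fn {σ : ℝ} (hσ : 0 ≤ σ) (T : Sob σ) : MemH σ T.fn :=
  memH_iff.mpr ⟨T.memLp_fn hσ, by rw [T.ofFun_fn hσ]; exact T.memSobolev_dist⟩

theorem ofFun_real_inj {f g : ℝ → ℝ} (hf : MemLp f 2 (volume : Measure ℝ))
    (hg : MemLp g 2 (volume : Measure ℝ))
    (h : ofFun (fun x => (f x : ℂ)) = ofFun (fun x => (g x : ℂ))) : f =ᵐ[volume] g := by
  filter_upwards [ofFun_inj hf.ofReal hg.ofReal h] with x hx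
  simpa using hx

theorem fn_toSob {σ : ℝ} (hσ : 0 ≤ σ) {f : ℝ → ℝ} (hf : MemH σ f) :
    (toSob σ f).fn =ᵐ[volume] f := by
  apply ofFun_real_inj ((toSob σ f).memLp_fn hσ) hf.1
  rw [Sob.ofFun_fn hσ, toSob_dist hf]

theorem toSob_congr {σ : ℝ} {f g : ℝ → ℝ} (h : f =ᵐ[volume] g) : toSob σ f = toSob σ g := by
  by_cases hf : MemH σ f
  · apply Sob.ext_dist
    rw [toSob_dist hf, toSob_dist (hf.congr h)]
    apply ofFun_congr
    filter_upwards [h] with x hx; rw [hx]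
  · have hg : ¬ MemH σ g := fun hg => hf (hg.congr h.symm)
    rw [toSob, toSob, dif_neg hf, dif_neg hg]

theorem Sob.fn_add {σ : ℝ} (hσ : 0 ≤ σ) (S T : Sob σ) :
    (S + T).fn =ᵐ[volume] fun x => S.fn x + T.fn x := by
  have h : MemLp (fun x => S.fn x + T.fn x) 2 (volume : Measure ℝ) :=
    (S.memLp_fn hσ).add (T.memLp_fn hσ)
  apply ofFun_real_inj ((S + T).memLp_fn hσ) h
  rw [ofFun_add_real (S.memLp_fn hσ) (T.memLp_fn hσ), Sob.ofFun_fn hσ, Sob.ofFun_fn hσ, Sob.ofFun_fn hσ, map_add]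

theorem Sob.fn_smul {σ : ℝ} (hσ : 0 ≤ σ) (c : ℝ) (T : Sob σ) :
    (c • T).fn =ᵐ[volume] fun x => c * T.fn x := by
  apply ofFun_real_inj ((c • T).memLp_fn hσ) ((T.memLp_fn hσ).const_mul c)
  rw [ofFun_const_mul_real c (T.memLp_fn hσ), Sob.ofFun_fn hσ, Sob.ofFun_fn hσ, map_smul]
  ext ψ
  have h1 : (c • T.dist) ψ = c • T.dist ψ := rfl
  have h2 : ((c : ℂ) • T.dist) ψ = c * T.dist ψ := rfl
  rw [h1, h2]; simp

/-! ### The Sobolev embedding and continuous representatives. -/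

/-- The threshold `1/2` enters here: `(1 + ξ²)^{-σ}` is integrable on the line because `2σ > 1`. -/
theorem memLp_wt_neg {σ : ℝ} (hσ : 1 / 2 < σ) : MemLp (wt (-σ)) 2 (volume : Measure ℝ) := by
  rw [memLp_two_iff_integrable_sq (continuous_wt _).aestronglyMeasurable]
  have h := integrable_rpow_neg_one_add_norm_sq (E := ℝ) (μ := volume) (r := 2 * σ)
    (by simp; linarith)
  refine h.congr (Filter.Eventually.of_forall fun ξ => ?_)
  simp only [wt]
  rw [← Real.rpow_natCast ((1 + ξ ^ 2) ^ (-σ / 2)) 2, ← Real.rpow_mul (by positivity)]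
  simp only [Real.norm_eq_abs, sq_abs]
  congr 1
  push_cast; ring

/-- The constant of the Sobolev embedding. -/
def embC (σ : ℝ) : ℝ := (eLpNorm (wt (-σ)) 2 volume).toReal

theorem embC_nonneg (σ : ℝ) : 0 ≤ embC σ := ENNReal.toReal_nonneg

/-- Cauchy–Schwarz for the factorisation `F = wt (-σ) · (wt σ F)`. -/
theorem eLpNorm_one_le {σ : ℝ} {F : ℝ → ℂ}
    (hF : AEStronglyMeasurable F (volume : Measure ℝ)) :
    eLpNorm F 1 volume ≤ eLpNorm (wt (-σ)) 2 volume *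
      eLpNorm (fun ξ => (wt σ ξ : ℂ) * F ξ) 2 volume := by
  have h1 : F = (wt (-σ)) • (fun ξ => (wt σ ξ : ℂ) * F ξ) := by
    ext ξ
    simp only [Pi.smul_apply', Complex.real_smul]
    rw [← mul_assoc, ← Complex.ofReal_mul, wt_neg_mul]; simp
  conv_lhs => rw [h1]
  apply eLpNorm_smul_le_mul_eLpNorm
  · exact AEStronglyMeasurable.mul
      (Complex.continuous_ofReal.comp (continuous_wt _)).aestronglyMeasurable hF
  · exact (continuous_wt _).aestronglyMeasurable

theorem IsHat.integrable {σ : ℝ} (hσ : 1 / 2 < σ) {T : 𝓢'(ℝ, ℂ)} {F : ℝ → ℂ} (h : IsHat σ T F) :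
    Integrable F := by
  rw [← memLp_one_iff_integrable]
  refine ⟨h.aestronglyMeasurable, (eLpNorm_one_le (σ := σ) h.aestronglyMeasurable).trans_lt ?_⟩
  exact ENNReal.mul_lt_top (memLp_wt_neg hσ).2 h.memLp.2

theorem IsHat.integral_norm_le {σ : ℝ} (hσ : 1 / 2 < σ) {T : 𝓢'(ℝ, ℂ)} {F : ℝ → ℂ}
    (h : IsHat σ T F) :
    ∫ ξ, ‖F ξ‖ ≤ embC σ * (eLpNorm (fun ξ => (wt σ ξ : ℂ) * F ξ) 2 volume).toReal := by
  rw [embC, ← ENNReal.toReal_mul, integral_norm_eq_lintegral_enorm h.aestronglyMeasurable,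
    ← eLpNorm_one_eq_lintegral_enorm]
  exact ENNReal.toReal_mono (ENNReal.mul_lt_top (memLp_wt_neg hσ).2 h.memLp.2).ne
    (eLpNorm_one_le h.aestronglyMeasurable)

/-- The inverse transform is the Fourier integral of the form `-⟨x, ξ⟩`, which is symmetric, so the
transform is its own transpose. -/
theorem integral_fourierInv_mul {f g : ℝ → ℂ} (hf : Integrable f) (hg : Integrable g) :
    ∫ ξ, 𝓕⁻ f ξ * g ξ = ∫ x, f x * 𝓕⁻ g x := by
  have h := VectorFourier.integral_fourierIntegral_smul_eq_flip (L := -innerₗ ℝ) (μ := volume)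
    (ν := volume) Real.continuous_fourierChar (by
      have : Continuous fun p : ℝ × ℝ => -(inner ℝ p.1 p.2) := by fun_prop
      exact this) hf hg
  have hL : (-innerₗ ℝ : ℝ →ₗ[ℝ] ℝ →ₗ[ℝ] ℝ).flip = -innerₗ ℝ := by
    ext; simp
  rw [hL] at h
  exact h

theorem norm_fourierInv_le (F : ℝ → ℂ) (x : ℝ) : ‖𝓕⁻ F x‖ ≤ ∫ ξ, ‖F ξ‖ :=
  VectorFourier.norm_fourierIntegral_le_integral_norm _ _ _ _ _

theorem continuous_fourierInv {F : ℝ → ℂ} (hF : Integrable F) : Continuous (𝓕⁻ F) := by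
  have h : 𝓕⁻ F = fun x => 𝓕 F (-x) := by
    ext x; exact Real.fourierInv_eq_fourier_neg F x
  rw [h]
  have h2 : Continuous (𝓕 F) := VectorFourier.fourierIntegral_continuous
    Real.continuous_fourierChar (by
      have : Continuous fun p : ℝ × ℝ => (inner ℝ p.1 p.2) := by fun_prop
      exact this) hF
  exact h2.comp continuous_neg

theorem tendsto_fourierInv_cocompact (F : ℝ → ℂ) :
    Tendsto (𝓕⁻ F) (cocompact ℝ) (𝓝 0) := by
  have h : 𝓕⁻ F = fun x => 𝓕 F (-x) := by
    ext x; exact Real.fourierInv_eq_fourier_neg F x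
  rw [h]
  exact (Real.zero_at_infty_fourier F).comp (Homeomorph.neg ℝ).isClosedEmbedding.tendsto_cocompact

/-- A function with integrable Fourier transform is given by Fourier inversion. -/
theorem IsHat.ae_eq_fourierInv {σ : ℝ} {f F : ℝ → ℂ} (hf : MemLp f 2 (volume : Measure ℝ))
    (h : IsHat σ (ofFun f) F) (hF : Integrable F) : f =ᵐ[volume] 𝓕⁻ F := by
  refine ae_eq_of_integral_contDiff_smul_eq (hf.locallyIntegrable (by norm_num))
    (continuous_fourierInv hF).locallyIntegrable fun g hg hgc => ?_
  have hgc' : HasCompactSupport (fun x => (g x : ℂ)) := hgc.comp_left (g := Complex.ofReal) rfl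
  have hg' : ContDiff ℝ (⊤ : ℕ∞) (fun x => (g x : ℂ)) := Complex.ofRealCLM.contDiff.comp hg
  set ψ : 𝓢(ℝ, ℂ) := hgc'.toSchwartzMap hg' with hψ
  have hψx : ∀ x, ψ x = g x := fun x => rfl
  have h1 : ofFun f ψ = 𝓕 (ofFun f) (𝓕⁻ ψ) := by
    rw [TemperedDistribution.fourier_apply, fourier_fourierInv_eq]
  rw [h.fourier, ofFun_apply hf] at h1
  have h2 := integral_fourierInv_mul (f := ψ) ψ.integrable hF
  rw [← SchwartzMap.fourierInv_coe] at h2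
  rw [h2] at h1
  simpa [hψx, Complex.real_smul] using h1

theorem Sob.rep_spec {σ : ℝ} (hσ : 1 / 2 < σ) (T : Sob σ) : Continuous T.rep ∧
    MemLp T.rep 2 (volume : Measure ℝ) ∧ ofFun (fun x => (T.rep x : ℂ)) = T.dist := by
  have hσ0 : 0 ≤ σ := by linarith
  have hI := T.isHat.integrable hσ
  have h := T.isHat
  rw [← T.ofFun_fn hσ0] at h
  have h1 := h.ae_eq_fourierInv (memLp_ofReal (T.memLp_fn hσ0)) hI
  have h2 : T.fn =ᵐ[volume] fun x => (𝓕⁻ T.hat x).re := by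
    filter_upwards [h1] with x hx
    rw [← hx]; simp
  have hex : ∃ f : ℝ → ℝ, Continuous f ∧ MemLp f 2 (volume : Measure ℝ) ∧
      ofFun (fun x => (f x : ℂ)) = T.dist := by
    refine ⟨fun x => (𝓕⁻ T.hat x).re, Complex.continuous_re.comp (continuous_fourierInv hI),
      (memLp_congr_ae h2).mp (T.memLp_fn hσ0), ?_⟩
    rw [← T.ofFun_fn hσ0]
    apply ofFun_congr
    filter_upwards [h2] with x hx; rw [hx]
  rw [Sob.rep, dif_pos hex]
  exact hex.choose_spec

theorem Sob.continuous_rep {σ : ℝ} (hσ : 1 / 2 < σ) (T : Sob σ) : Continuous T.rep :=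
  (T.rep_spec hσ).1

theorem Sob.memLp_rep {σ : ℝ} (hσ : 1 / 2 < σ) (T : Sob σ) :
    MemLp T.rep 2 (volume : Measure ℝ) := (T.rep_spec hσ).2.1

theorem Sob.ofFun_rep {σ : ℝ} (hσ : 1 / 2 < σ) (T : Sob σ) :
    ofFun (fun x => (T.rep x : ℂ)) = T.dist := (T.rep_spec hσ).2.2

theorem Sob.memH_rep {σ : ℝ} (hσ : 1 / 2 < σ) (T : Sob σ) : MemH σ T.rep :=
  memH_iff.mpr ⟨T.memLp_rep hσ, by rw [T.ofFun_rep hσ]; exact T.memSobolev_dist⟩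

/-- Fourier inversion holds almost everywhere, and both sides are continuous. -/
theorem Sob.rep_eq_fourierInv {σ : ℝ} (hσ : 1 / 2 < σ) (T : Sob σ) {τ : ℝ} {F : ℝ → ℂ}
    (hF : IsHat τ T.dist F) (hI : Integrable F) (x : ℝ) : (T.rep x : ℂ) = 𝓕⁻ F x := by
  rw [← T.ofFun_rep hσ] at hF
  have h1 := hF.ae_eq_fourierInv (memLp_ofReal (T.memLp_rep hσ)) hI
  have h2 := (Continuous.ae_eq_iff_eq volume (Complex.continuous_ofReal.comp (T.continuous_rep hσ))
    (continuous_fourierInv hI)).mp h1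
  exact congrFun h2 x

/-- The sup norm is at most the `L¹` norm of the transform, which Cauchy–Schwarz bounds by the
Sobolev norm. -/
theorem Sob.abs_rep_le {σ : ℝ} (hσ : 1 / 2 < σ) (T : Sob σ) (x : ℝ) :
    |T.rep x| ≤ embC σ * ‖T‖ := by
  have h := T.rep_eq_fourierInv hσ T.isHat (T.isHat.integrable hσ) x
  rw [← Real.norm_eq_abs, ← Complex.norm_real, h, T.norm_eq T.isHat]
  exact (norm_fourierInv_le _ _).trans (T.isHat.integral_norm_le hσ)

theorem Sob.tendsto_rep {σ : ℝ} (hσ : 1 / 2 < σ) (T : Sob σ) :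
    Tendsto T.rep (cocompact ℝ) (𝓝 0) := by
  have h := tendsto_fourierInv_cocompact T.hat
  have h2 := (Complex.continuous_re.tendsto 0).comp h
  refine h2.congr fun x => ?_
  simp [← T.rep_eq_fourierInv hσ T.isHat (T.isHat.integrable hσ) x]

theorem Sob.rep_ae_eq_fn {σ : ℝ} (hσ : 1 / 2 < σ) (T : Sob σ) : T.rep =ᵐ[volume] T.fn :=
  ofFun_real_inj (T.memLp_rep hσ) (T.memLp_fn (by linarith))
    (by rw [T.ofFun_rep hσ, T.ofFun_fn (by linarith)])

theorem Sob.rep_eq_of_continuous {σ : ℝ} (hσ : 1 / 2 < σ) (T : Sob σ) {f : ℝ → ℝ}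
    (hf : Continuous f) (h : f =ᵐ[volume] T.fn) : T.rep = f :=
  (Continuous.ae_eq_iff_eq volume (T.continuous_rep hσ) hf).mp ((T.rep_ae_eq_fn hσ).trans h.symm)

theorem rep_toSob {σ : ℝ} (hσ : 1 / 2 < σ) {f : ℝ → ℝ} (hf : MemH σ f) (hc : Continuous f) :
    (toSob σ f).rep = f :=
  Sob.rep_eq_of_continuous hσ _ hc (fn_toSob (by linarith) hf).symm

theorem toSob_rep {σ : ℝ} (hσ : 1 / 2 < σ) (T : Sob σ) : toSob σ T.rep = T := by
  apply Sob.ext_dist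
  rw [toSob_dist (T.memH_rep hσ), T.ofFun_rep hσ]

theorem Sob.rep_inj {σ : ℝ} (hσ : 1 / 2 < σ) {S T : Sob σ} (h : S.rep = T.rep) : S = T := by
  rw [← toSob_rep hσ S, h, toSob_rep hσ]

theorem Sob.rep_add {σ : ℝ} (hσ : 1 / 2 < σ) (S T : Sob σ) (x : ℝ) :
    (S + T).rep x = S.rep x + T.rep x := by
  refine congrFun (Sob.rep_eq_of_continuous hσ (S + T) (f := fun x => S.rep x + T.rep x)
    ((S.continuous_rep hσ).add (T.continuous_rep hσ)) ?_) x
  filter_upwards [S.rep_ae_eq_fn hσ, T.rep_ae_eq_fn hσ, S.fn_add (by linarith) T] with x h1 h2 h3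
  rw [h1, h2, h3]

theorem Sob.rep_smul {σ : ℝ} (hσ : 1 / 2 < σ) (c : ℝ) (T : Sob σ) (x : ℝ) :
    (c • T).rep x = c * T.rep x := by
  refine congrFun (Sob.rep_eq_of_continuous hσ (c • T) (f := fun x => c * T.rep x)
    (continuous_const.mul (T.continuous_rep hσ)) ?_) x
  filter_upwards [T.rep_ae_eq_fn hσ, T.fn_smul (by linarith) c] with x h1 h2
  rw [h1, h2]

theorem MemH.tendsto {σ : ℝ} (hσ : 1 / 2 < σ) {f : ℝ → ℝ} (hf : MemH σ f) (hc : Continuous f) :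
    Tendsto f (cocompact ℝ) (𝓝 0) := by
  rw [← rep_toSob hσ hf hc]; exact Sob.tendsto_rep hσ _

theorem MemH.bounded {σ : ℝ} (hσ : 1 / 2 < σ) {f : ℝ → ℝ} (hf : MemH σ f) (hc : Continuous f) :
    ∃ C, 0 ≤ C ∧ ∀ x, |f x| ≤ C := by
  refine ⟨embC σ * ‖toSob σ f‖, mul_nonneg (embC_nonneg σ) (norm_nonneg _), fun x => ?_⟩
  have := (toSob σ f).abs_rep_le hσ x
  rwa [rep_toSob hσ hf hc] at this

/-- Functions of Sobolev order `σ > 1/2` have a continuous representative. -/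
theorem MemH.exists_continuous {σ : ℝ} (hσ : 1 / 2 < σ) {f : ℝ → ℝ} (hf : MemH σ f) :
    ∃ g : ℝ → ℝ, Continuous g ∧ f =ᵐ[volume] g ∧ MemH σ g := by
  have h1 := Sob.rep_ae_eq_fn hσ (toSob σ f)
  have h2 := fn_toSob (by linarith) hf
  exact ⟨(toSob σ f).rep, Sob.continuous_rep hσ _, (h1.trans h2).symm, Sob.memH_rep hσ _⟩

/-! ### Inclusions and derivatives as bounded operators; classical derivatives. -/

/-- The derivative `H^σ(ℝ) → H^τ(ℝ)`, `τ + 1 ≤ σ`. -/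
def Sob.derivₗ {σ τ : ℝ} (h : τ + 1 ≤ σ) : Sob σ →ₗ[ℝ] Sob τ where
  toFun T := Sob.mk (∂_{(1 : ℝ)} T.dist)
    ⟨(T.memSobolev_dist.mono h).lineDerivOp.mono (by linarith), isRealDist_lineDeriv T.dist_mem.2⟩
  map_add' S T := Sob.ext_dist (by
    simp only [map_add, Sob.dist_mk]
    exact LineDeriv.lineDerivOp_add _ _ _)
  map_smul' c T := Sob.ext_dist (by
    simp only [map_smul, Sob.dist_mk, RingHom.id_apply]
    exact LineDeriv.lineDerivOp_smul _ _ _)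

theorem IsHat.eLpNorm_mono {σ τ : ℝ} (hτ : τ ≤ σ) {T : 𝓢'(ℝ, ℂ)} {F : ℝ → ℂ} (h : IsHat σ T F) :
    (eLpNorm (fun ξ => (wt τ ξ : ℂ) * F ξ) 2 volume).toReal ≤
      (eLpNorm (fun ξ => (wt σ ξ : ℂ) * F ξ) 2 volume).toReal := by
  refine ENNReal.toReal_mono h.memLp.2.ne (MeasureTheory.eLpNorm_mono fun ξ => ?_)
  rw [norm_mul, norm_mul, Complex.norm_real, Complex.norm_real, Real.norm_of_nonneg (wt_pos _ _).le,
      Real.norm_of_nonneg (wt_pos _ _).le]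
  gcongr
  exact wt_mono hτ ξ

theorem Sob.mem_of_le {σ τ : ℝ} (h : τ ≤ σ) (T : Sob σ) : T.dist ∈ sobolevSubmodule τ :=
  ⟨T.memSobolev_dist.mono h, T.dist_mem.2⟩

theorem Sob.mk_dist_add {σ τ : ℝ} (h : τ ≤ σ) (S T : Sob σ) :
    Sob.mk (S + T).dist ((S + T).mem_of_le h) =
      Sob.mk S.dist (S.mem_of_le h) + Sob.mk T.dist (T.mem_of_le h) := by
  apply Sob.ext_dist
  have h1 := Sob.dist_mk (S + T).dist ((S + T).mem_of_le h)
  have h2 := Sob.dist_mk S.dist (S.mem_of_le h)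
  have h3 := Sob.dist_mk T.dist (T.mem_of_le h)
  have h4 := Sob.dist.map_add (Sob.mk S.dist (S.mem_of_le h)) (Sob.mk T.dist (T.mem_of_le h))
  rw [h2, h3] at h4
  exact h1.trans ((Sob.dist.map_add S T).trans h4.symm)

theorem Sob.mk_dist_smul {σ τ : ℝ} (h : τ ≤ σ) (c : ℝ) (T : Sob σ) :
    Sob.mk (c • T).dist ((c • T).mem_of_le h) = c • Sob.mk T.dist (T.mem_of_le h) := by
  apply Sob.ext_dist
  have h1 := Sob.dist_mk (c • T).dist ((c • T).mem_of_le h)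
  have h3 := Sob.dist_mk T.dist (T.mem_of_le h)
  have h4 := Sob.dist.map_smul c (Sob.mk T.dist (T.mem_of_le h))
  rw [h3] at h4
  exact h1.trans ((Sob.dist.map_smul c T).trans h4.symm)

/-- The inclusion `H^σ(ℝ) → H^τ(ℝ)`, `τ ≤ σ`, as a linear map. -/
def Sob.inclₗ {σ τ : ℝ} (h : τ ≤ σ) : Sob σ →ₗ[ℝ] Sob τ where
  toFun T := Sob.mk T.dist (T.mem_of_le h)
  map_add' S T := Sob.mk_dist_add h S T
  map_smul' c T := Sob.mk_dist_smul h c T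

theorem Sob.dist_inclₗ {σ τ : ℝ} (h : τ ≤ σ) (T : Sob σ) : (Sob.inclₗ h T).dist = T.dist :=
  Sob.dist_mk T.dist (T.mem_of_le h)

theorem Sob.norm_inclₗ_le {σ τ : ℝ} (h : τ ≤ σ) (T : Sob σ) : ‖Sob.inclₗ h T‖ ≤ 1 * ‖T‖ := by
  have h1 : IsHat τ (Sob.inclₗ h T).dist T.hat := by
    rw [Sob.dist_inclₗ]
    exact T.isHat.mono h
  rw [Sob.norm_eq (Sob.inclₗ h T) h1, T.norm_eq T.isHat, one_mul]
  exact T.isHat.eLpNorm_mono h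

/-- The inclusion `H^σ(ℝ) → H^τ(ℝ)`, `τ ≤ σ`. -/
def Sob.incl {σ τ : ℝ} (h : τ ≤ σ) : Sob σ →L[ℝ] Sob τ :=
  LinearMap.mkContinuous (Sob.inclₗ h) 1 (Sob.norm_inclₗ_le h)

@[simp] theorem Sob.dist_incl {σ τ : ℝ} (h : τ ≤ σ) (T : Sob σ) :
    (Sob.incl h T).dist = T.dist := Sob.dist_inclₗ h T

theorem Sob.norm_derivₗ_le {σ τ : ℝ} (h : τ + 1 ≤ σ) (T : Sob σ) :
    ‖Sob.derivₗ h T‖ ≤ 2 * Real.pi * ‖T‖ := by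
  have h1 := (T.isHat.mono h).lineDeriv
  rw [add_sub_cancel_right] at h1
  have h2 : ‖T‖ = _ := T.norm_eq T.isHat
  have h3 := T.isHat.eLpNorm_mono h
  rw [Sob.norm_eq (Sob.derivₗ h T) h1, h2]
  refine le_trans ?_ (mul_le_mul_of_nonneg_left h3 (by positivity))
  have h4 : eLpNorm (fun ξ => (wt τ ξ : ℂ) * ((2 * Real.pi * Complex.I * ξ) * T.hat ξ)) 2 volume ≤
      ENNReal.ofReal (2 * Real.pi) *
        eLpNorm (fun ξ => (wt (τ + 1) ξ : ℂ) * T.hat ξ) 2 volume := by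
    apply eLpNorm_le_mul_eLpNorm_of_ae_le_mul
    refine Filter.Eventually.of_forall fun ξ => ?_
    simp only [norm_mul, Complex.norm_real, Real.norm_of_nonneg (wt_pos _ _).le, Complex.norm_I,
        Complex.norm_ofNat, Real.norm_of_nonneg Real.pi_pos.le, Real.norm_eq_abs ξ]
    rw [wt_add]
    have := abs_le_wt_one ξ
    have h4 := wt_pos τ ξ
    have h5 := Real.pi_pos
    calc wt τ ξ * (2 * Real.pi * 1 * |ξ| * ‖T.hat ξ‖)
        = 2 * Real.pi * (wt τ ξ * |ξ| * ‖T.hat ξ‖) := by ring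
      _ ≤ 2 * Real.pi * (wt τ ξ * wt 1 ξ * ‖T.hat ξ‖) := by gcongr
  have h5 := ENNReal.toReal_mono
    (ENNReal.mul_lt_top ENNReal.ofReal_lt_top (T.isHat.mono h).memLp.2).ne h4
  rwa [ENNReal.toReal_mul, ENNReal.toReal_ofReal (by positivity)] at h5

/-- The derivative `H^σ(ℝ) → H^τ(ℝ)`, `τ + 1 ≤ σ`, as a continuous linear map. -/
def Sob.deriv {σ τ : ℝ} (h : τ + 1 ≤ σ) : Sob σ →L[ℝ] Sob τ :=
  LinearMap.mkContinuous (Sob.derivₗ h) (2 * Real.pi) (Sob.norm_derivₗ_le h)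

@[simp] theorem Sob.dist_deriv {σ τ : ℝ} (h : τ + 1 ≤ σ) (T : Sob σ) :
    (Sob.deriv h T).dist = ∂_{(1 : ℝ)} T.dist := rfl

/-- Differentiation under the inversion integral. It is allowed because `ξ F(ξ)` is integrable, the
derivative having order `τ > 1/2`. The forward transform is used at `-x`. -/
theorem Sob.hasDerivAt_rep {σ τ : ℝ} (h : τ + 1 ≤ σ) (hτ : 1 / 2 < τ) (T : Sob σ) (x : ℝ) :
    HasDerivAt T.rep ((Sob.deriv h T).rep x) x := by
  have hσ : 1 / 2 < σ := by linarith
  have h1 := (T.isHat.mono h).lineDeriv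
  rw [add_sub_cancel_right] at h1
  have hI := T.isHat.integrable hσ
  have hI' := h1.integrable hτ
  have hd := (Sob.deriv h T).rep_eq_fourierInv hτ h1 hI' x
  have hr := fun x => T.rep_eq_fourierInv hσ T.isHat hI x
  have hI2 : Integrable (fun ξ : ℝ => ξ • T.hat ξ) := by
    refine (hI'.const_mul ((2 * Real.pi * Complex.I)⁻¹)).congr
      (Filter.Eventually.of_forall fun ξ => ?_)
    have : (2 * Real.pi * Complex.I : ℂ) ≠ 0 := Complex.two_pi_I_ne_zero
    simp only [Complex.real_smul]
    field_simp
  have h2 := Real.hasDerivAt_fourier hI hI2 (-x)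
  have h3 : HasDerivAt (fun x => 𝓕 T.hat (-x))
      (-(𝓕 (fun ξ : ℝ => (-2 * Real.pi * Complex.I * ξ) • T.hat ξ) (-x))) x := by
    have h := h2.scomp x (hasDerivAt_neg x)
    rw [neg_one_smul] at h
    exact h
  have h4 : -(𝓕 (fun ξ : ℝ => (-2 * Real.pi * Complex.I * ξ : ℂ) • T.hat ξ) (-x)) =
      ((Sob.deriv h T).rep x : ℂ) := by
    rw [hd, Real.fourierInv_eq_fourier_neg, Real.fourier_eq, Real.fourier_eq, ← integral_neg]
    refine integral_congr_ae (Filter.Eventually.of_forall fun ξ => ?_)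
    dsimp only
    rw [← smul_neg]
    congr 1
    simp
  have h5 : (fun x => 𝓕 T.hat (-x)) = fun x => (T.rep x : ℂ) := by
    ext y
    rw [hr y, Real.fourierInv_eq_fourier_neg]
  rw [h4, h5] at h3
  have h6 := Complex.reCLM.hasFDerivAt.comp_hasDerivAt x h3
  simpa [Function.comp_def] using h6

theorem Sob.deriv_rep {σ τ : ℝ} (h : τ + 1 ≤ σ) (hτ : 1 / 2 < τ) (T : Sob σ) :
    _root_.deriv T.rep = (Sob.deriv h T).rep :=
  funext fun x => (T.hasDerivAt_rep h hτ x).deriv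

theorem Sob.contDiff_rep {σ τ : ℝ} (h : τ + 1 ≤ σ) (hτ : 1 / 2 < τ) (T : Sob σ) :
    ContDiff ℝ 1 T.rep := by
  rw [contDiff_one_iff_deriv]
  refine ⟨fun x => (T.hasDerivAt_rep h hτ x).differentiableAt, ?_⟩
  rw [T.deriv_rep h hτ]
  exact Sob.continuous_rep hτ _

/-! ### Convolution estimates and the product theorem. -/

theorem eLpNorm_two_ennreal (f : ℝ → ENNReal) :
    eLpNorm f 2 volume = (∫⁻ x, f x ^ (2 : ℝ)) ^ (1 / 2 : ℝ) := by
  rw [eLpNorm_eq_lintegral_rpow_enorm_toReal (by norm_num) (by norm_num)]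
  simp

theorem lintegral_mul_le_eLpNorm {f g : ℝ → ENNReal} (hf : AEMeasurable f) (hg : AEMeasurable g) :
    ∫⁻ x, f x * g x ≤ eLpNorm f 2 volume * eLpNorm g 2 volume := by
  rw [eLpNorm_two_ennreal, eLpNorm_two_ennreal]
  exact ENNReal.lintegral_mul_le_Lp_mul_Lq volume Real.HolderConjugate.two_two hf hg

/-- The convolution of nonnegative functions. -/
def cv (a b : ℝ → ENNReal) (ξ : ℝ) : ENNReal := ∫⁻ η, b η * a (ξ - η)

theorem cv_comm (a b : ℝ → ENNReal) (ξ : ℝ) : cv a b ξ = cv b a ξ := by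
  unfold cv
  rw [← lintegral_sub_left_eq_self (fun η => a η * b (ξ - η)) ξ]
  simp only [sub_sub_cancel, mul_comm]

theorem aemeasurable_comp_sub {a : ℝ → ENNReal} (ha : AEMeasurable a) :
    AEMeasurable (fun p : ℝ × ℝ => a (p.1 - p.2)) (volume.prod volume) :=
  ha.comp_quasiMeasurePreserving (quasiMeasurePreserving_sub_of_right_invariant volume volume)

theorem aemeasurable_comp_sub_left {a : ℝ → ENNReal} (ha : AEMeasurable a) (ξ : ℝ) :
    AEMeasurable (fun η : ℝ => a (ξ - η)) :=
  ha.comp_quasiMeasurePreserving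
    (Measure.measurePreserving_sub_left volume ξ).quasiMeasurePreserving

theorem aemeasurable_cv_integrand {a b : ℝ → ENNReal} (ha : AEMeasurable a) (hb : AEMeasurable b) :
    AEMeasurable (fun p : ℝ × ℝ => b p.2 * a (p.1 - p.2)) (volume.prod volume) :=
  (hb.comp_quasiMeasurePreserving Measure.quasiMeasurePreserving_snd).mul (aemeasurable_comp_sub ha)

theorem aemeasurable_cv {a b : ℝ → ENNReal} (ha : AEMeasurable a) (hb : AEMeasurable b) :
    AEMeasurable (cv a b) :=
  (aemeasurable_cv_integrand ha hb).lintegral_prod_right'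

/-- Cauchy–Schwarz after writing `b = b^{1/2} · b^{1/2}`, so that one factor integrates to the `L¹`
norm of `b`. -/
theorem cv_sq_le {a b : ℝ → ENNReal} (ha : AEMeasurable a) (hb : AEMeasurable b) (ξ : ℝ) :
    cv a b ξ ^ (2 : ℝ) ≤ (∫⁻ η, b η) * cv (fun x => a x ^ (2 : ℝ)) b ξ := by
  have h1 : cv a b ξ = ∫⁻ η, (b η ^ (1 / 2 : ℝ)) * (b η ^ (1 / 2 : ℝ) * a (ξ - η)) := by
    unfold cv
    congr 1; ext η
    rw [← mul_assoc, ← ENNReal.rpow_add_of_nonneg _ _ (by norm_num) (by norm_num)]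
    norm_num
  have h2 := ENNReal.lintegral_mul_le_Lp_mul_Lq volume Real.HolderConjugate.two_two
    (hb.pow_const (1 / 2 : ℝ)) ((hb.pow_const (1 / 2 : ℝ)).mul (aemeasurable_comp_sub_left ha ξ))
  simp only [Pi.mul_apply] at h2
  rw [← h1] at h2
  have h3 := ENNReal.rpow_le_rpow h2 (by norm_num : (0 : ℝ) ≤ 2)
  rw [ENNReal.mul_rpow_of_nonneg _ _ (by norm_num), ← ENNReal.rpow_mul, ← ENNReal.rpow_mul] at h3
  norm_num at h3
  have h4 : ∀ x : ENNReal, (x ^ (1 / 2 : ℝ)) ^ (2 : ℕ) = x := fun x => by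
    rw [← ENNReal.rpow_natCast, ← ENNReal.rpow_mul]; norm_num
  simpa only [h4, mul_pow, cv, ENNReal.rpow_ofNat] using h3

/-- Young's inequality `L² * L¹ ⊂ L²`. -/
theorem eLpNorm_cv_le {a b : ℝ → ENNReal} (ha : AEMeasurable a) (hb : AEMeasurable b) :
    eLpNorm (cv a b) 2 volume ≤ (∫⁻ η, b η) * eLpNorm a 2 volume := by
  have h1 : ∫⁻ ξ, cv a b ξ ^ (2 : ℝ) ≤ (∫⁻ η, b η) ^ (2 : ℝ) * ∫⁻ ξ, a ξ ^ (2 : ℝ) := by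
    have hcv : AEMeasurable (cv (fun x => a x ^ (2 : ℝ)) b) :=
      aemeasurable_cv (ha.pow_const _) hb
    calc ∫⁻ ξ, cv a b ξ ^ (2 : ℝ) ≤ ∫⁻ ξ, (∫⁻ η, b η) * cv (fun x => a x ^ (2 : ℝ)) b ξ :=
          lintegral_mono fun ξ => cv_sq_le ha hb ξ
      _ = (∫⁻ η, b η) * ∫⁻ ξ, cv (fun x => a x ^ (2 : ℝ)) b ξ := lintegral_const_mul'' _ hcv
      _ = (∫⁻ η, b η) * ∫⁻ η, ∫⁻ ξ, b η * a (ξ - η) ^ (2 : ℝ) := by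
          unfold cv
          rw [lintegral_lintegral_swap (aemeasurable_cv_integrand (ha.pow_const _) hb)]
      _ = (∫⁻ η, b η) * ∫⁻ η, b η * ∫⁻ ξ, a ξ ^ (2 : ℝ) := by
          congr 2; ext η
          have hm : AEMeasurable (fun ξ => a (ξ - η) ^ (2 : ℝ)) :=
            (ha.comp_quasiMeasurePreserving
              (measurePreserving_sub_right volume η).quasiMeasurePreserving).pow_const _
          rw [lintegral_const_mul'' _ hm, lintegral_sub_right_eq_self (fun ξ => a ξ ^ (2 : ℝ)) η]
      _ = (∫⁻ η, b η) ^ (2 : ℝ) * ∫⁻ ξ, a ξ ^ (2 : ℝ) := by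
          rw [lintegral_mul_const'' _ hb, ← mul_assoc]
          norm_num
          rw [sq]
  rw [eLpNorm_two_ennreal, eLpNorm_two_ennreal]
  have h2 := ENNReal.rpow_le_rpow h1 (by norm_num : (0 : ℝ) ≤ 1 / 2)
  rw [ENNReal.mul_rpow_of_nonneg _ _ (by norm_num), ← ENNReal.rpow_mul] at h2
  norm_num at h2 ⊢
  exact h2

/-- The modulus of a function with a weight. -/
def wabs (σ : ℝ) (F : ℝ → ℂ) (ξ : ℝ) : ENNReal := ‖(wt σ ξ : ℂ) * F ξ‖ₑ

theorem wabs_eq (σ : ℝ) (F : ℝ → ℂ) (ξ : ℝ) : wabs σ F ξ = ENNReal.ofReal (wt σ ξ) * ‖F ξ‖ₑ := by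
  rw [wabs, enorm_mul]
  congr 1
  rw [← ofReal_norm, Complex.norm_real, Real.norm_of_nonneg (wt_pos _ _).le]

theorem aestronglyMeasurable_wt_mul (σ : ℝ) {F : ℝ → ℂ}
    (hF : AEStronglyMeasurable F (volume : Measure ℝ)) :
    AEStronglyMeasurable (fun ξ => (wt σ ξ : ℂ) * F ξ) (volume : Measure ℝ) :=
  (Complex.continuous_ofReal.comp (continuous_wt _)).aestronglyMeasurable.mul hF

theorem aemeasurable_wabs (σ : ℝ) {F : ℝ → ℂ}
    (hF : AEStronglyMeasurable F (volume : Measure ℝ)) : AEMeasurable (wabs σ F) :=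
  (aestronglyMeasurable_wt_mul σ hF).enorm

theorem eLpNorm_wabs (σ : ℝ) (F : ℝ → ℂ) (p : ENNReal) :
    eLpNorm (wabs σ F) p volume = eLpNorm (fun ξ => (wt σ ξ : ℂ) * F ξ) p volume := by
  unfold wabs
  exact eLpNorm_enorm _

theorem lintegral_wabs_le {τ r : ℝ} {F : ℝ → ℂ}
    (hF : AEStronglyMeasurable F (volume : Measure ℝ)) :
    ∫⁻ ξ, wabs τ F ξ ≤ eLpNorm (wt (-r)) 2 volume *
      eLpNorm (fun ξ => (wt (r + τ) ξ : ℂ) * F ξ) 2 volume := by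
  have h := eLpNorm_one_le (σ := r) (aestronglyMeasurable_wt_mul τ hF)
  rw [eLpNorm_one_eq_lintegral_enorm] at h
  refine h.trans (le_of_eq ?_)
  congr 2
  ext ξ
  rw [← mul_assoc, ← Complex.ofReal_mul, ← wt_add]

/-- The larger of `|η|` and `|ξ - η|` is at least `|ξ|/2`, which explains the constant `4^{σ/2}`. If
it is `|ξ - η|`, the first term suffices. If it is `|η|`, write `wt σ η = wt r η · wt (σ - r) η`.
The second factor has a nonpositive exponent, hence only grows when `η` is replaced by the smaller
`ξ - η`. -/
theorem wt_le_add {σ r : ℝ} (hσ : 0 ≤ σ) (hr : σ ≤ r) (ξ η : ℝ) :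
    wt σ ξ ≤ 4 ^ (σ / 2) * (wt σ (ξ - η) + wt r η * wt (σ - r) (ξ - η)) := by
  have key : ∀ a : ℝ, 1 + ξ ^ 2 ≤ 4 * (1 + a ^ 2) → wt σ ξ ≤ 4 ^ (σ / 2) * wt σ a := fun a ha => by
    unfold wt
    rw [← Real.mul_rpow (by norm_num) (by positivity)]
    exact Real.rpow_le_rpow (by positivity) ha (by linarith)
  have h4 : (0 : ℝ) < 4 ^ (σ / 2) := by positivity
  rcases le_total (η ^ 2) ((ξ - η) ^ 2) with h | h
  · refine (key (ξ - η) (by nlinarith [sq_nonneg (ξ - 2 * η)])).trans ?_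
    have := mul_pos (wt_pos r η) (wt_pos (σ - r) (ξ - η))
    gcongr
    linarith
  · refine (key η (by nlinarith [sq_nonneg (ξ - 2 * η)])).trans ?_
    have h1 : wt (σ - r) η ≤ wt (σ - r) (ξ - η) := by
      unfold wt
      exact Real.rpow_le_rpow_of_nonpos (by positivity) (by linarith) (by linarith)
    have h2 : wt σ η = wt r η * wt (σ - r) η := by rw [← wt_add]; simp
    have h3 := wt_pos σ (ξ - η)
    have h5 := wt_pos r η
    rw [h2]
    gcongr
    nlinarith

theorem wt_mul_cv_le {σ r : ℝ} (hσ : 0 ≤ σ) (hr : σ ≤ r) {F G : ℝ → ℂ}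
    (hF : AEStronglyMeasurable F (volume : Measure ℝ))
    (hG : AEStronglyMeasurable G (volume : Measure ℝ)) (ξ : ℝ) :
    ENNReal.ofReal (wt σ ξ) * cv (wabs 0 F) (wabs 0 G) ξ ≤
      ENNReal.ofReal (4 ^ (σ / 2)) *
        (cv (wabs σ F) (wabs 0 G) ξ + cv (wabs (σ - r) F) (wabs r G) ξ) := by
  unfold cv
  have hm1 : AEMeasurable (fun η => wabs 0 G η * wabs σ F (ξ - η)) :=
    (aemeasurable_wabs 0 hG).mul (aemeasurable_comp_sub_left (aemeasurable_wabs σ hF) ξ)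
  rw [← lintegral_add_left' hm1, ← lintegral_const_mul' _ _ ENNReal.ofReal_ne_top,
    ← lintegral_const_mul' _ _ ENNReal.ofReal_ne_top]
  refine lintegral_mono fun η => ?_
  simp only [wabs_eq, wt_zero, ENNReal.ofReal_one, one_mul]
  have h1 : ENNReal.ofReal (wt σ ξ) ≤ ENNReal.ofReal (4 ^ (σ / 2)) *
      (ENNReal.ofReal (wt σ (ξ - η)) + ENNReal.ofReal (wt r η) *
        ENNReal.ofReal (wt (σ - r) (ξ - η))) := by
    rw [← ENNReal.ofReal_mul (wt_pos _ _).le, ← ENNReal.ofReal_add (wt_pos _ _).le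
      (mul_pos (wt_pos _ _) (wt_pos _ _)).le, ← ENNReal.ofReal_mul (by positivity)]
    exact ENNReal.ofReal_le_ofReal (wt_le_add hσ hr ξ η)
  calc ENNReal.ofReal (wt σ ξ) * (‖G η‖ₑ * ‖F (ξ - η)‖ₑ)
      ≤ (ENNReal.ofReal (4 ^ (σ / 2)) *
      (ENNReal.ofReal (wt σ (ξ - η)) + ENNReal.ofReal (wt r η) *
        ENNReal.ofReal (wt (σ - r) (ξ - η)))) * (‖G η‖ₑ * ‖F (ξ - η)‖ₑ) := by gcongr
    _ = _ := by ring

/-- Young's inequality for each of the two terms of `wt_le_add`. In the first, `G` is the `L¹`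
factor. In the second it is `wt (σ - r) F = wt (-r) · (wt σ F)`, so that both cost the same
constant, the `L²` norm of `wt (-r)`. -/
theorem eLpNorm_wt_cv_le {σ r : ℝ} (hσ : 0 ≤ σ) (hr : σ ≤ r) {F G : ℝ → ℂ}
    (hF : AEStronglyMeasurable F (volume : Measure ℝ))
    (hG : AEStronglyMeasurable G (volume : Measure ℝ)) :
    eLpNorm (fun ξ => ENNReal.ofReal (wt σ ξ) * cv (wabs 0 F) (wabs 0 G) ξ) 2 volume ≤
      ENNReal.ofReal (4 ^ (σ / 2)) * (2 * eLpNorm (wt (-r)) 2 volume) *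
      (eLpNorm (fun ξ => (wt σ ξ : ℂ) * F ξ) 2 volume *
        eLpNorm (fun ξ => (wt r ξ : ℂ) * G ξ) 2 volume) := by
  have m1 := aemeasurable_cv (aemeasurable_wabs σ hF) (aemeasurable_wabs 0 hG)
  have m2 := aemeasurable_cv (aemeasurable_wabs (σ - r) hF) (aemeasurable_wabs r hG)
  have h1 : eLpNorm (cv (wabs σ F) (wabs 0 G)) 2 volume ≤
      eLpNorm (wt (-r)) 2 volume * (eLpNorm (fun ξ => (wt σ ξ : ℂ) * F ξ) 2 volume *
        eLpNorm (fun ξ => (wt r ξ : ℂ) * G ξ) 2 volume) := by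
    refine (eLpNorm_cv_le (aemeasurable_wabs σ hF) (aemeasurable_wabs 0 hG)).trans ?_
    have := lintegral_wabs_le (τ := 0) (r := r) hG
    rw [add_zero] at this
    rw [eLpNorm_wabs]
    calc _ ≤ (eLpNorm (wt (-r)) 2 volume * eLpNorm (fun ξ => (wt r ξ : ℂ) * G ξ) 2 volume) *
          eLpNorm (fun ξ => (wt σ ξ : ℂ) * F ξ) 2 volume := by gcongr
      _ = _ := by ring
  have h2 : eLpNorm (cv (wabs (σ - r) F) (wabs r G)) 2 volume ≤
      eLpNorm (wt (-r)) 2 volume * (eLpNorm (fun ξ => (wt σ ξ : ℂ) * F ξ) 2 volume *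
        eLpNorm (fun ξ => (wt r ξ : ℂ) * G ξ) 2 volume) := by
    have h3 : cv (wabs (σ - r) F) (wabs r G) = cv (wabs r G) (wabs (σ - r) F) :=
      funext fun ξ => cv_comm _ _ ξ
    rw [h3]
    refine (eLpNorm_cv_le (aemeasurable_wabs r hG) (aemeasurable_wabs (σ - r) hF)).trans ?_
    have := lintegral_wabs_le (τ := σ - r) (r := r) hF
    rw [add_sub_cancel] at this
    rw [eLpNorm_wabs, ← mul_assoc]
    gcongr
  calc _ ≤ eLpNorm (fun ξ => ENNReal.ofReal (4 ^ (σ / 2)) *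
        (cv (wabs σ F) (wabs 0 G) ξ + cv (wabs (σ - r) F) (wabs r G) ξ)) 2 volume :=
        eLpNorm_mono_enorm fun ξ => wt_mul_cv_le hσ hr hF hG ξ
    _ = ENNReal.ofReal (4 ^ (σ / 2)) * eLpNorm (cv (wabs σ F) (wabs 0 G) +
          cv (wabs (σ - r) F) (wabs r G)) 2 volume := by
        rw [eLpNorm_two_ennreal, eLpNorm_two_ennreal]
        simp only [ENNReal.mul_rpow_of_nonneg _ _ (by norm_num : (0 : ℝ) ≤ 2), Pi.add_apply]
        rw [lintegral_const_mul' _ _ (by simp),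
          ENNReal.mul_rpow_of_nonneg _ _ (by norm_num : (0 : ℝ) ≤ 1 / 2), ← ENNReal.rpow_mul]
        norm_num
    _ ≤ ENNReal.ofReal (4 ^ (σ / 2)) * (eLpNorm (cv (wabs σ F) (wabs 0 G)) 2 volume +
          eLpNorm (cv (wabs (σ - r) F) (wabs r G)) 2 volume) := by
        gcongr
        exact eLpNorm_add_le m1.aestronglyMeasurable m2.aestronglyMeasurable (by norm_num)
    _ ≤ ENNReal.ofReal (4 ^ (σ / 2)) * (eLpNorm (wt (-r)) 2 volume *
          (eLpNorm (fun ξ => (wt σ ξ : ℂ) * F ξ) 2 volume *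
        eLpNorm (fun ξ => (wt r ξ : ℂ) * G ξ) 2 volume) + eLpNorm (wt (-r)) 2 volume *
          (eLpNorm (fun ξ => (wt σ ξ : ℂ) * F ξ) 2 volume *
        eLpNorm (fun ξ => (wt r ξ : ℂ) * G ξ) 2 volume)) := by gcongr
    _ = _ := by ring

/-- The convolution of two functions. -/
def conv (F G : ℝ → ℂ) (ξ : ℝ) : ℂ := ∫ η, G η * F (ξ - η)

theorem enorm_conv_le (F G : ℝ → ℂ) (ξ : ℝ) : ‖conv F G ξ‖ₑ ≤ cv (wabs 0 F) (wabs 0 G) ξ := by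
  refine (enorm_integral_le_lintegral_enorm _).trans (le_of_eq ?_)
  simp only [cv, wabs, wt_zero, enorm_mul, Complex.ofReal_one, one_mul]

theorem aestronglyMeasurable_conv_integrand {F G : ℝ → ℂ}
    (hF : AEStronglyMeasurable F (volume : Measure ℝ))
    (hG : AEStronglyMeasurable G (volume : Measure ℝ)) :
    AEStronglyMeasurable (fun p : ℝ × ℝ => G p.2 * F (p.1 - p.2)) (volume.prod volume) :=
  AEStronglyMeasurable.convolution_integrand (ContinuousLinearMap.mul ℂ ℂ) hG hF

theorem aestronglyMeasurable_conv {F G : ℝ → ℂ}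
    (hF : AEStronglyMeasurable F (volume : Measure ℝ))
    (hG : AEStronglyMeasurable G (volume : Measure ℝ)) :
    AEStronglyMeasurable (conv F G) (volume : Measure ℝ) :=
  (aestronglyMeasurable_conv_integrand hF hG).integral_prod_right'

theorem eLpNorm_wt_conv_le {σ r : ℝ} (hσ : 0 ≤ σ) (hr : σ ≤ r) {F G : ℝ → ℂ}
    (hF : AEStronglyMeasurable F (volume : Measure ℝ))
    (hG : AEStronglyMeasurable G (volume : Measure ℝ)) :
    eLpNorm (fun ξ => (wt σ ξ : ℂ) * conv F G ξ) 2 volume ≤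
      ENNReal.ofReal (4 ^ (σ / 2)) * (2 * eLpNorm (wt (-r)) 2 volume) *
      (eLpNorm (fun ξ => (wt σ ξ : ℂ) * F ξ) 2 volume *
        eLpNorm (fun ξ => (wt r ξ : ℂ) * G ξ) 2 volume) := by
  refine le_trans (eLpNorm_mono_enorm fun ξ => ?_) (eLpNorm_wt_cv_le hσ hr hF hG)
  change wabs σ (conv F G) ξ ≤ _
  rw [wabs_eq]
  change _ ≤ ENNReal.ofReal (wt σ ξ) * cv (wabs 0 F) (wabs 0 G) ξ
  gcongr
  exact enorm_conv_le F G ξ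

/-- The constant of the product estimate `H^σ · H^r ⊂ H^σ`. -/
def mulC (σ r : ℝ) : ℝ := 4 ^ (σ / 2) * (2 * embC r)

/-- Justifies Fubini in the convolution formula: integrating in the second variable leaves a
convolution, which is in `L²` by Young's inequality and is paired with `ψ`. -/
theorem integrable_schwartz_mul_conv_integrand {F G : ℝ → ℂ}
    (hF : MemLp F 2 (volume : Measure ℝ)) (hG : Integrable G) (ψ : 𝓢(ℝ, ℂ)) :
    Integrable (fun p : ℝ × ℝ => ψ p.1 * (G p.2 * F (p.1 - p.2))) (volume.prod volume) := by
  have hm : AEStronglyMeasurable (fun p : ℝ × ℝ => ψ p.1 * (G p.2 * F (p.1 - p.2)))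
      (volume.prod volume) :=
    (ψ.continuous.comp continuous_fst).aestronglyMeasurable.mul
      (aestronglyMeasurable_conv_integrand hF.1 hG.1)
  refine ⟨hm, ?_⟩
  rw [hasFiniteIntegral_iff_enorm, lintegral_prod _ hm.enorm]
  have ha := aemeasurable_wabs 0 hF.1
  have hb := aemeasurable_wabs 0 hG.1
  have h1 : ∀ ξ, ∫⁻ η, ‖ψ ξ * (G η * F (ξ - η))‖ₑ = ‖ψ ξ‖ₑ * cv (wabs 0 F) (wabs 0 G) ξ := by
    intro ξ
    simp only [enorm_mul]
    rw [lintegral_const_mul' _ _ enorm_ne_top]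
    simp [cv, wabs]
  simp only [h1]
  refine (lintegral_mul_le_eLpNorm ψ.continuous.aestronglyMeasurable.enorm
    (aemeasurable_cv ha hb)).trans_lt ?_
  rw [eLpNorm_enorm (fun x => ψ x)]
  refine ENNReal.mul_lt_top (SchwartzMap.memLp ψ 2 volume).2 ((eLpNorm_cv_le ha hb).trans_lt ?_)
  refine ENNReal.mul_lt_top ?_ ?_
  · simpa [wabs] using hasFiniteIntegral_iff_enorm.mp hG.2
  · rw [eLpNorm_wabs]; simpa using hF.2

/-- The Fourier transform of a product is the convolution of the Fourier transforms. -/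
theorem fourier_ofFun_mul {f g F G : ℝ → ℂ} (hf : MemLp f 2 (volume : Measure ℝ))
    (hfF : IsHat 0 (ofFun f) F) (hG : Integrable G) (hg : ∀ x, g x = 𝓕⁻ G x)
    (hfg : MemLp (fun x => f x * g x) 2 (volume : Measure ℝ)) (ψ : 𝓢(ℝ, ℂ)) :
    𝓕 (ofFun (fun x => f x * g x)) ψ = ∫ ξ, ψ ξ * conv F G ξ := by
  have hF : MemLp F 2 (volume : Measure ℝ) := by simpa using hfF.memLp
  rw [TemperedDistribution.fourier_apply, ofFun_apply hfg]
  have hI1 : Integrable (fun x => 𝓕 ψ x * f x) := integrable_schwartz_mul hf _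
  -- the first exchange of integrals
  have h1 : ∫ x, 𝓕 ψ x * (f x * g x) =
      ∫ η, G η * ∫ x, (Real.fourierChar (x * η) : ℂ) * 𝓕 ψ x * f x := by
    have hP : Integrable (Function.uncurry fun x η : ℝ =>
        (Real.fourierChar (x * η) : ℂ) * ((𝓕 ψ x * f x) * G η)) (volume.prod volume) := by
      have h0 := hI1.mul_prod hG
      refine h0.mono ?_ (Eventually.of_forall fun p => ?_)
      · refine AEStronglyMeasurable.mul ?_ h0.1
        have : Continuous fun p : ℝ × ℝ => (Real.fourierChar (p.1 * p.2) : ℂ) :=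
          continuous_subtype_val.comp (Real.continuous_fourierChar.comp (by fun_prop))
        exact this.aestronglyMeasurable
      · simp [Function.uncurry, Circle.norm_coe]
    have h2 : ∀ x, 𝓕 ψ x * (f x * g x) =
        ∫ η, (Real.fourierChar (x * η) : ℂ) * ((𝓕 ψ x * f x) * G η) := by
      intro x
      rw [hg, Real.fourierInv_eq, ← mul_assoc, ← integral_const_mul]
      refine integral_congr_ae (Eventually.of_forall fun η => ?_)
      simp only [Circle.smul_def, smul_eq_mul]
      simp only [RCLike.inner_apply, conj_trivial]
      ring
    simp_rw [h2]
    rw [integral_integral_swap hP]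
    refine integral_congr_ae (Eventually.of_forall fun η => ?_)
    dsimp only
    rw [← integral_const_mul]
    refine integral_congr_ae (Eventually.of_forall fun x => ?_)
    dsimp only
    ring
  rw [h1]
  -- the inner integral is the Fourier transform of `f` tested with a translate of `ψ`
  have h2 : ∀ η, ∫ x, (Real.fourierChar (x * η) : ℂ) * 𝓕 ψ x * f x = ∫ ξ, ψ ξ * F (ξ - η) := by
    intro η
    set ψ' : 𝓢(ℝ, ℂ) := SchwartzMap.compSubConstCLM ℂ (-η) ψ with hψ'
    have hψx : ∀ y, ψ' y = ψ (y + η) := fun y => by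
      rw [hψ', SchwartzMap.compSubConstCLM_apply, sub_neg_eq_add]
    have h3 : ∀ x, (Real.fourierChar (x * η) : ℂ) * 𝓕 ψ x = 𝓕 ψ' x := by
      intro x
      rw [SchwartzMap.fourier_coe, SchwartzMap.fourier_coe, Real.fourier_eq, Real.fourier_eq,
        ← integral_const_mul]
      simp only [hψx]
      rw [← integral_sub_right_eq_self (fun y : ℝ => Real.fourierChar (-inner ℝ y x) • ψ (y + η)) η]
      refine integral_congr_ae (Eventually.of_forall fun y => ?_)
      simp only [Circle.smul_def, smul_eq_mul, sub_add_cancel, RCLike.inner_apply, conj_trivial]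
      rw [← mul_assoc, ← Circle.coe_mul, ← AddChar.map_add_eq_mul]
      congr 3
      ring
    simp_rw [h3]
    rw [← ofFun_apply hf, ← TemperedDistribution.fourier_apply, hfF.fourier]
    rw [← integral_sub_right_eq_self (fun ξ => ψ' ξ * F ξ) η]
    simp only [hψx, sub_add_cancel]
  simp_rw [h2]
  have hP2 := integrable_schwartz_mul_conv_integrand hF hG ψ
  have h4 : ∀ η, G η * ∫ ξ, ψ ξ * F (ξ - η) = ∫ ξ, ψ ξ * (G η * F (ξ - η)) := by
    intro η
    rw [← integral_const_mul]
    refine integral_congr_ae (Eventually.of_forall fun ξ => ?_)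
    dsimp only; ring
  simp_rw [h4]
  rw [← integral_integral_swap (f := fun ξ η => ψ ξ * (G η * F (ξ - η))) hP2]
  refine integral_congr_ae (Eventually.of_forall fun ξ => ?_)
  dsimp only
  rw [integral_const_mul]
  rfl

theorem isHat_mul {σ r : ℝ} (hσ : 0 ≤ σ) (hr : σ ≤ r) (hr' : 1 / 2 < r) {f g F G : ℝ → ℂ}
    (hf : MemLp f 2 (volume : Measure ℝ)) (hfF : IsHat σ (ofFun f) F)
    (hgG : IsHat r (ofFun g) G) (hg : ∀ x, g x = 𝓕⁻ G x)
    (hfg : MemLp (fun x => f x * g x) 2 (volume : Measure ℝ)) :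
    IsHat σ (ofFun (fun x => f x * g x)) (conv F G) := by
  have hG := hgG.integrable hr'
  refine ⟨⟨?_, ?_⟩, fun ψ => fourier_ofFun_mul hf (hfF.mono hσ) hG hg hfg ψ⟩
  · exact aestronglyMeasurable_wt_mul σ
      (aestronglyMeasurable_conv hfF.aestronglyMeasurable hgG.aestronglyMeasurable)
  · refine (eLpNorm_wt_conv_le hσ hr hfF.aestronglyMeasurable hgG.aestronglyMeasurable).trans_lt ?_
    refine ENNReal.mul_lt_top (ENNReal.mul_lt_top ENNReal.ofReal_lt_top
      (ENNReal.mul_lt_top (by simp) (memLp_wt_neg hr').2))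
      (ENNReal.mul_lt_top hfF.memLp.2 hgG.memLp.2)

theorem MemH.isHat {σ : ℝ} {f : ℝ → ℝ} (hf : MemH σ f) :
    IsHat σ (ofFun (fun x => (f x : ℂ))) (toSob σ f).hat := by
  rw [← toSob_dist hf]; exact (toSob σ f).isHat

theorem MemH.memLp_mul {r : ℝ} (hr : 1 / 2 < r) {f g : ℝ → ℝ}
    (hf : MemLp f 2 (volume : Measure ℝ)) (hg : MemH r g) :
    MemLp (fun x => f x * g x) 2 (volume : Measure ℝ) := by
  obtain ⟨g', hc, hgg, hg'⟩ := hg.exists_continuous hr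
  obtain ⟨C, hC, hb⟩ := hg'.bounded hr hc
  have h : MemLp (fun x => f x * g' x) 2 (volume : Measure ℝ) := by
    refine (hf.const_mul C).mono (hf.1.mul hc.aestronglyMeasurable) (Eventually.of_forall fun x => ?_)
    rw [norm_mul, norm_mul, mul_comm, Real.norm_of_nonneg hC]
    gcongr
    exact hb x
  refine (memLp_congr_ae ?_).mp h
  filter_upwards [hgg] with x hx; rw [hx]

/-- The factor `g` is replaced by its continuous representative, for which Fourier inversion holds
at every point. -/
theorem isHat_mul_real {σ r : ℝ} (hσ : 0 ≤ σ) (hr : σ ≤ r) (hr' : 1 / 2 < r) {f g : ℝ → ℝ}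
    (hf : MemH σ f) (hg : MemH r g) {F G : ℝ → ℂ} (hF : IsHat σ (ofFun (fun x => (f x : ℂ))) F)
    (hG : IsHat r (ofFun (fun x => (g x : ℂ))) G) :
    IsHat σ (ofFun (fun x => ((f x * g x : ℝ) : ℂ))) (conv F G) := by
  obtain ⟨g', hc, hgg, hg'⟩ := hg.exists_continuous hr'
  have hGg : ofFun (fun x => (g x : ℂ)) = ofFun (fun x => (g' x : ℂ)) :=
    ofFun_congr (by filter_upwards [hgg] with x hx; rw [hx])
  rw [hGg] at hG
  have hI := hG.integrable hr'
  have hx : ∀ x, (g' x : ℂ) = 𝓕⁻ G x := by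
    have h1 := hG.ae_eq_fourierInv (memLp_ofReal hg'.1) hI
    have h2 := (Continuous.ae_eq_iff_eq volume (Complex.continuous_ofReal.comp hc)
      (continuous_fourierInv hI)).mp h1
    exact fun x => congrFun h2 x
  have hfg : MemLp (fun x => (f x : ℂ) * (g' x : ℂ)) 2 (volume : Measure ℝ) := by
    have := memLp_ofReal (MemH.memLp_mul hr' hf.1 hg')
    simpa only [Complex.ofReal_mul] using this
  have h := isHat_mul hσ hr hr' (memLp_ofReal hf.1) hF hG hx hfg
  have he : ofFun (fun x => ((f x * g x : ℝ) : ℂ)) = ofFun (fun x => (f x : ℂ) * (g' x : ℂ)) :=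
    ofFun_congr (by filter_upwards [hgg] with x hx; rw [hx, Complex.ofReal_mul])
  rw [he]
  exact h

/-- The product theorem `H^σ · H^r ⊂ H^σ` for `0 ≤ σ ≤ r`, `r > 1/2`. -/
theorem MemH.mul {σ r : ℝ} (hσ : 0 ≤ σ) (hr : σ ≤ r) (hr' : 1 / 2 < r) {f g : ℝ → ℝ}
    (hf : MemH σ f) (hg : MemH r g) : MemH σ (fun x => f x * g x) :=
  memH_iff.mpr ⟨MemH.memLp_mul hr' hf.1 hg,
    (isHat_mul_real hσ hr hr' hf hg hf.isHat hg.isHat).memSobolev⟩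

theorem norm_toSob_mul_le {σ r : ℝ} (hσ : 0 ≤ σ) (hr : σ ≤ r) (hr' : 1 / 2 < r) (S : Sob σ)
    (T : Sob r) : ‖toSob σ (fun x => S.fn x * T.fn x)‖ ≤ mulC σ r * ‖S‖ * ‖T‖ := by
  have hS := S.memH_fn hσ
  have hT := T.memH_fn (hσ.trans hr)
  have hSh := S.isHat
  have hTh := T.isHat
  rw [S.norm_eq hSh, T.norm_eq hTh]
  rw [← S.ofFun_fn hσ] at hSh
  rw [← T.ofFun_fn (hσ.trans hr)] at hTh
  have h := isHat_mul_real hσ hr hr' hS hT hSh hTh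
  rw [← toSob_dist (MemH.mul hσ hr hr' hS hT)] at h
  rw [Sob.norm_eq _ h]
  have h1 := eLpNorm_wt_conv_le hσ hr hSh.aestronglyMeasurable hTh.aestronglyMeasurable
  have h2 := ENNReal.toReal_mono (ENNReal.mul_lt_top (ENNReal.mul_lt_top ENNReal.ofReal_lt_top
      (ENNReal.mul_lt_top (by simp) (memLp_wt_neg hr').2))
      (ENNReal.mul_lt_top hSh.memLp.2 hTh.memLp.2)).ne h1
  rw [ENNReal.toReal_mul, ENNReal.toReal_mul, ENNReal.toReal_mul, ENNReal.toReal_mul,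
    ENNReal.toReal_ofReal (by positivity)] at h2
  rw [mulC, embC, mul_assoc]
  exact h2

theorem toSob_add {σ : ℝ} {f g : ℝ → ℝ} (hf : MemH σ f) (hg : MemH σ g) :
    toSob σ (fun x => f x + g x) = toSob σ f + toSob σ g := by
  apply Sob.ext_dist
  rw [toSob_dist (hf.add hg), map_add, toSob_dist hf, toSob_dist hg, ofFun_add_real hf.1 hg.1]

theorem dist_smul_real {σ : ℝ} (c : ℝ) (T : Sob σ) : (c • T).dist = (c : ℂ) • T.dist := by
  ext ψ
  rw [map_smul]
  have h1 : (c • T.dist) ψ = c • T.dist ψ := rfl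
  have h2 : ((c : ℂ) • T.dist) ψ = c * T.dist ψ := rfl
  rw [h1, h2]; simp

theorem toSob_const_mul {σ : ℝ} (c : ℝ) {f : ℝ → ℝ} (hf : MemH σ f) :
    toSob σ (fun x => c * f x) = c • toSob σ f := by
  apply Sob.ext_dist
  rw [toSob_dist (hf.const_mul c), dist_smul_real, toSob_dist hf, ofFun_const_mul_real c hf.1]

/-- The multiplication `H^σ(ℝ) × H^r(ℝ) → H^σ(ℝ)` as a bilinear map. -/
def Sob.mulₗ {σ r : ℝ} (hσ : 0 ≤ σ) (hr : σ ≤ r) (hr' : 1 / 2 < r) :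
    Sob σ →ₗ[ℝ] Sob r →ₗ[ℝ] Sob σ :=
  LinearMap.mk₂ ℝ (fun S T => toSob σ (fun x => S.fn x * T.fn x))
    (fun S S' T => by
      have hr0 := hσ.trans hr
      rw [← toSob_add ((S.memH_fn hσ).mul hσ hr hr' (T.memH_fn hr0))
        ((S'.memH_fn hσ).mul hσ hr hr' (T.memH_fn hr0))]
      apply toSob_congr
      filter_upwards [Sob.fn_add hσ S S'] with x hx
      rw [hx]; ring)
    (fun c S T => by
      have hr0 := hσ.trans hr
      rw [← toSob_const_mul c ((S.memH_fn hσ).mul hσ hr hr' (T.memH_fn hr0))]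
      apply toSob_congr
      filter_upwards [Sob.fn_smul hσ c S] with x hx
      rw [hx]; ring)
    (fun S T T' => by
      have hr0 := hσ.trans hr
      rw [← toSob_add ((S.memH_fn hσ).mul hσ hr hr' (T.memH_fn hr0))
        ((S.memH_fn hσ).mul hσ hr hr' (T'.memH_fn hr0))]
      apply toSob_congr
      filter_upwards [Sob.fn_add hr0 T T'] with x hx
      rw [hx]; ring)
    (fun c S T => by
      have hr0 := hσ.trans hr
      rw [← toSob_const_mul c ((S.memH_fn hσ).mul hσ hr hr' (T.memH_fn hr0))]
      apply toSob_congr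
      filter_upwards [Sob.fn_smul hr0 c T] with x hx
      rw [hx]; ring)

/-- The multiplication `H^σ(ℝ) × H^r(ℝ) → H^σ(ℝ)`, `0 ≤ σ ≤ r`, `r > 1/2`. -/
def Sob.mul {σ r : ℝ} (hσ : 0 ≤ σ) (hr : σ ≤ r) (hr' : 1 / 2 < r) :
    Sob σ →L[ℝ] Sob r →L[ℝ] Sob σ :=
  LinearMap.mkContinuous₂ (Sob.mulₗ hσ hr hr') (mulC σ r) (norm_toSob_mul_le hσ hr hr')

theorem Sob.mul_apply {σ r : ℝ} (hσ : 0 ≤ σ) (hr : σ ≤ r) (hr' : 1 / 2 < r) (S : Sob σ)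
    (T : Sob r) : Sob.mul hσ hr hr' S T = toSob σ (fun x => S.fn x * T.fn x) := rfl

theorem Sob.fn_mul {σ r : ℝ} (hσ : 0 ≤ σ) (hr : σ ≤ r) (hr' : 1 / 2 < r) (S : Sob σ)
    (T : Sob r) : (Sob.mul hσ hr hr' S T).fn =ᵐ[volume] fun x => S.fn x * T.fn x := by
  rw [Sob.mul_apply]
  exact fn_toSob hσ ((S.memH_fn hσ).mul hσ hr hr' (T.memH_fn (hσ.trans hr)))

theorem Sob.rep_mul {σ r : ℝ} (hσ : 1 / 2 < σ) (hr : σ ≤ r) (S : Sob σ)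
    (T : Sob r) (x : ℝ) :
    (Sob.mul (by linarith) hr (by linarith) S T).rep x = S.rep x * T.rep x := by
  have hr' : 1 / 2 < r := by linarith
  refine congrFun (Sob.rep_eq_of_continuous hσ _ (f := fun x => S.rep x * T.rep x)
    ((S.continuous_rep hσ).mul (T.continuous_rep hr')) ?_) x
  filter_upwards [S.rep_ae_eq_fn hσ, T.rep_ae_eq_fn hr',
    Sob.fn_mul (by linarith) hr (by linarith) S T] with x h1 h2 h3
  rw [h1, h2, h3]

/-! ### Completeness and the scalar product. -/

theorem continuous_dist_apply (ψ : 𝓢(ℝ, ℂ)) : Continuous fun T : 𝓢'(ℝ, ℂ) => T ψ :=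
  (PointwiseConvergenceCLM.evalCLM (RingHom.id ℂ) ℂ ψ).continuous

theorem continuous_besselPotential_Lp_apply (σ : ℝ) (ψ : 𝓢(ℝ, ℂ)) :
    Continuous fun v : Lp ℂ 2 (volume : Measure ℝ) =>
      besselPotential ℝ ℂ σ (Lp.toTemperedDistributionCLM ℂ volume 2 v) ψ := by
  have h1 := (besselPotential ℝ ℂ σ).continuous
  have h2 := (Lp.toTemperedDistributionCLM (E := ℝ) ℂ volume 2).continuous
  exact (continuous_dist_apply ψ).comp (h1.comp h2)

/-- `Λ^σ` is an isometry into `L²`, so it suffices that its range is closed. A limit `u` in `L²`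
comes from the distribution `Λ^{-σ} u`, which is real because it is the pointwise limit of real
distributions. -/
instance (σ : ℝ) : CompleteSpace (Sob σ) := by
  have hiso : Isometry (Sob.bessel σ) := AddMonoidHomClass.isometry_of_norm _ fun T => rfl
  refine Metric.complete_of_cauchySeq_tendsto fun T hT => ?_
  obtain ⟨u, hu⟩ := cauchySeq_tendsto_of_complete (hiso.uniformContinuous.comp_cauchySeq hT)
  set S : 𝓢'(ℝ, ℂ) := besselPotential ℝ ℂ (-σ) (u : 𝓢'(ℝ, ℂ)) with hS
  have hS1 : besselPotential ℝ ℂ σ S = (u : 𝓢'(ℝ, ℂ)) := by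
    rw [hS, besselPotential_besselPotential_apply]; simp
  have hSm : MemSobolev σ 2 S := ⟨u, hS1⟩
  have hTd : ∀ n, (T n).dist = besselPotential ℝ ℂ (-σ) ((Sob.bessel σ (T n) : Lp ℂ 2 volume) :
      𝓢'(ℝ, ℂ)) := by
    intro n
    have : besselPotential ℝ ℂ σ (T n).dist = ((Sob.bessel σ (T n) : Lp ℂ 2 volume) : 𝓢'(ℝ, ℂ)) :=
      besselL2_spec (T n).memSobolev_dist
    rw [← this, besselPotential_besselPotential_apply]; simp
  have hlim : ∀ ψ : 𝓢(ℝ, ℂ), Tendsto (fun n => (T n).dist ψ) atTop (𝓝 (S ψ)) := by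
    intro ψ
    have hc := continuous_besselPotential_Lp_apply (-σ) ψ
    have := (hc.tendsto u).comp hu
    refine this.congr fun n => ?_
    rw [hTd n]; rfl
  have hSr : IsRealDist S := by
    intro ψ hψ
    have h1 := (Complex.continuous_im.tendsto _).comp (hlim ψ)
    have h2 : (Complex.im ∘ fun n => (T n).dist ψ) = fun _ => 0 := by
      ext n; exact (T n).dist_mem.2 ψ hψ
    rw [h2] at h1
    exact tendsto_nhds_unique h1 tendsto_const_nhds
  refine ⟨Sob.mk S ⟨hSm, hSr⟩, ?_⟩
  rw [hiso.isEmbedding.tendsto_nhds_iff]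
  have : Sob.bessel σ (Sob.mk S ⟨hSm, hSr⟩) = u := by
    apply Lp_dist_injective
    rw [← hS1]
    exact (besselL2_spec hSm).symm
  rw [this]
  exact hu

/-- The scalar product of `H^σ(ℝ)`. -/
instance (σ : ℝ) : InnerProductSpace ℝ (Sob σ) where
  inner S T := RCLike.re (inner ℂ (Sob.bessel σ S) (Sob.bessel σ T))
  norm_sq_eq_re_inner T := by
    have : ‖T‖ = ‖Sob.bessel σ T‖ := rfl
    rw [this]
    exact norm_sq_eq_re_inner (𝕜 := ℂ) (Sob.bessel σ T)
  conj_inner_symm S T := by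
    simp only [conj_trivial]
    exact inner_re_symm (𝕜 := ℂ) _ _
  add_left S T U := by
    rw [map_add, inner_add_left, map_add]
  smul_left S T c := by
    have : inner ℂ (Sob.bessel σ (c • S)) (Sob.bessel σ T) =
        (c : ℂ) * inner ℂ (Sob.bessel σ S) (Sob.bessel σ T) := by
      rw [map_smul]
      exact inner_smul_real_left _ _ c
    rw [this]
    simp

theorem Sob.inner_def {σ : ℝ} (S T : Sob σ) :
    inner ℝ S T = RCLike.re (inner ℂ (Sob.bessel σ S) (Sob.bessel σ T)) := rfl

theorem Sob.bessel_zero_ae (T : Sob 0) :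
    (Sob.bessel 0 T : ℝ → ℂ) =ᵐ[volume] fun x => (T.fn x : ℂ) := by
  apply ofFun_inj (Lp.memLp _) (memLp_ofReal (T.memLp_fn le_rfl))
  rw [ofFun_coe_Lp, T.ofFun_fn le_rfl]
  have := besselL2_spec T.memSobolev_dist
  simp only [besselPotential_zero, ContinuousLinearMap.id_apply] at this
  exact this.symm

theorem Sob.inner_zero_eq (S T : Sob 0) : inner ℝ S T = ∫ x, S.fn x * T.fn x := by
  rw [Sob.inner_def, L2.inner_def]
  have : ∫ a, inner ℂ ((Sob.bessel 0 S : ℝ → ℂ) a) ((Sob.bessel 0 T : ℝ → ℂ) a) =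
      ∫ a, ((S.fn a * T.fn a : ℝ) : ℂ) := by
    apply integral_congr_ae
    filter_upwards [S.bessel_zero_ae, T.bessel_zero_ae] with x h1 h2
    rw [h1, h2]
    simp [mul_comm]
  rw [this, integral_complex_ofReal]
  simp

/-! ### Translations, difference quotients in `L²` and integration by parts. -/

theorem IsHat.eLpNorm_eq {f F : ℝ → ℂ} (hf : MemLp f 2 (volume : Measure ℝ))
    (h : IsHat 0 (ofFun f) F) : eLpNorm F 2 volume = eLpNorm f 2 volume := by
  have h1 := (isHat_ofFun hf).unique h
  rw [← eLpNorm_congr_ae h1, ← eLpNorm_congr_ae hf.coeFn_toLp]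
  have h2 := Lp.norm_fourier_eq (hf.toLp f)
  rw [Lp.norm_def, Lp.norm_def] at h2
  exact (ENNReal.toReal_eq_toReal_iff' (Lp.eLpNorm_ne_top _) (Lp.eLpNorm_ne_top _)).mp h2

theorem memLp_comp_add {f : ℝ → ℂ} (hf : MemLp f 2 (volume : Measure ℝ)) (h : ℝ) :
    MemLp (fun x => f (x + h)) 2 (volume : Measure ℝ) :=
  hf.comp_measurePreserving (measurePreserving_add_right volume h)

theorem isHat_comp_add {f F : ℝ → ℂ} (hf : MemLp f 2 (volume : Measure ℝ))
    (hF : IsHat 0 (ofFun f) F) (h : ℝ) :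
    IsHat 0 (ofFun (fun x => f (x + h))) (fun ξ => (Real.fourierChar (h * ξ) : ℂ) * F ξ) := by
  have hFm : MemLp F 2 (volume : Measure ℝ) := by simpa using hF.memLp
  have hc : Continuous fun ξ : ℝ => (Real.fourierChar (h * ξ) : ℂ) :=
    continuous_subtype_val.comp (Real.continuous_fourierChar.comp (by fun_prop))
  refine ⟨?_, fun ψ => ?_⟩
  · simp only [wt_zero, Complex.ofReal_one, one_mul]
    refine hFm.mono (hc.aestronglyMeasurable.mul hF.aestronglyMeasurable)
      (Eventually.of_forall fun ξ => ?_)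
    rw [norm_mul, Circle.norm_coe, one_mul]
  · set χ : 𝓢(ℝ, ℂ) := SchwartzMap.compSubConstCLM ℂ h (𝓕 ψ) with hχ
    have hχx : ∀ x, χ x = 𝓕 ψ (x - h) := fun x => SchwartzMap.compSubConstCLM_apply _ _ _
    have h1 : 𝓕 (ofFun fun x => f (x + h)) ψ = 𝓕 (ofFun f) (𝓕⁻ χ) := by
      rw [TemperedDistribution.fourier_apply, TemperedDistribution.fourier_apply,
        fourier_fourierInv_eq, ofFun_apply hf, ofFun_apply (memLp_comp_add hf h),
        ← integral_sub_right_eq_self (fun x : ℝ => 𝓕 ψ x * f (x + h)) h]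
      simp only [hχx, sub_add_cancel]
    rw [h1, hF.fourier]
    refine integral_congr_ae (Eventually.of_forall fun ξ => ?_)
    have h2 : (𝓕⁻ χ) ξ = (Real.fourierChar (h * ξ) : ℂ) * ψ ξ := by
      have h3 : ψ ξ = (𝓕⁻ (𝓕 ψ)) ξ := by rw [fourierInv_fourier_eq]
      rw [h3, SchwartzMap.fourierInv_coe, SchwartzMap.fourierInv_coe, Real.fourierInv_eq,
        Real.fourierInv_eq, ← integral_const_mul]
      simp only [hχx]
      rw [← integral_add_right_eq_self (fun y : ℝ => Real.fourierChar (inner ℝ y ξ) • 𝓕 ψ (y - h)) h]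
      refine integral_congr_ae (Eventually.of_forall fun y => ?_)
      simp only [Circle.smul_def, smul_eq_mul, add_sub_cancel_right, RCLike.inner_apply, conj_trivial]
      rw [← mul_assoc, ← Circle.coe_mul, ← AddChar.map_add_eq_mul]
      congr 3
      ring
    dsimp only
    rw [h2]; ring

theorem isHat_sub {σ : ℝ} {f g F G : ℝ → ℂ} (hf : MemLp f 2 (volume : Measure ℝ))
    (hg : MemLp g 2 (volume : Measure ℝ)) (hF : IsHat σ (ofFun f) F) (hG : IsHat σ (ofFun g) G) :
    IsHat σ (ofFun (fun x => f x - g x)) (fun ξ => F ξ - G ξ) := by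
  have h := hF.add (hG.smul (-1))
  rw [← ofFun_const_mul _ hg, ← ofFun_add hf (hg.const_mul (-1))] at h
  simpa [sub_eq_add_neg] using h

/-- Plancherel for differences of translates. -/
theorem eLpNorm_diff_eq {f F : ℝ → ℂ} (hf : MemLp f 2 (volume : Measure ℝ))
    (hF : IsHat 0 (ofFun f) F) (h : ℝ) :
    eLpNorm (fun x => f (x + h) - f x) 2 volume =
      eLpNorm (fun ξ => ((Real.fourierChar (h * ξ) : ℂ) - 1) * F ξ) 2 volume := by
  have h1 := isHat_sub (memLp_comp_add hf h) hf (isHat_comp_add hf hF h) hF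
  have m1 : MemLp (fun x => f (x + h) - f x) 2 (volume : Measure ℝ) := (memLp_comp_add hf h).sub hf
  rw [← h1.eLpNorm_eq m1]
  congr 1; ext ξ; ring

theorem norm_fourierChar_sub_one_le (t : ℝ) :
    ‖(Real.fourierChar t : ℂ) - 1‖ ≤ 2 * Real.pi * |t| := by
  rw [Real.fourierChar_apply]
  have h := Real.norm_exp_I_mul_ofReal_sub_one_le (x := 2 * Real.pi * t)
  rw [mul_comm Complex.I] at h
  refine h.trans (le_of_eq ?_)
  rw [Real.norm_eq_abs, abs_mul, abs_of_pos (by positivity)]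

theorem tendsto_fourierChar_slope (ξ : ℝ) :
    Tendsto (fun δ : ℝ => ((Real.fourierChar (δ * ξ) : ℂ) - 1) / δ) (𝓝[≠] 0)
      (𝓝 (2 * Real.pi * Complex.I * ξ)) := by
  have h1 : HasDerivAt (fun δ : ℝ => Complex.exp ((2 * Real.pi * ξ * Complex.I) * (δ : ℂ)))
      (2 * Real.pi * Complex.I * ξ) 0 := by
    have h2 : HasDerivAt (fun δ : ℝ => (2 * Real.pi * ξ * Complex.I) * (δ : ℂ))
        (2 * Real.pi * ξ * Complex.I) 0 := by
      simpa using (Complex.ofRealCLM.hasDerivAt (x := (0 : ℝ))).const_mul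
        (2 * Real.pi * ξ * Complex.I : ℂ)
    have h3 := h2.cexp
    simp only [Complex.ofReal_zero, mul_zero, Complex.exp_zero, one_mul] at h3
    convert h3 using 1
    ring
  have h2 := hasDerivAt_iff_tendsto_slope.mp h1
  refine h2.congr fun δ => ?_
  rw [slope_def_module, Real.fourierChar_apply]
  simp only [sub_zero, Complex.ofReal_zero, mul_zero, Complex.exp_zero, Complex.real_smul]
  push_cast
  rw [div_eq_inv_mul]
  congr 3
  ring_nf

/-- Dominated convergence to zero in `L²`. -/
theorem tendsto_eLpNorm_two_zero {ι : Type*} {l : Filter ι} [l.IsCountablyGenerated]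
    {u : ι → ℝ → ℂ} {b : ℝ → ℂ} (hu : ∀ i, AEStronglyMeasurable (u i) (volume : Measure ℝ))
    (hb : MemLp b 2 (volume : Measure ℝ)) (hub : ∀ᶠ i in l, ∀ x, ‖u i x‖ ≤ ‖b x‖)
    (h0 : ∀ x, Tendsto (fun i => u i x) l (𝓝 0)) :
    Tendsto (fun i => eLpNorm (u i) 2 volume) l (𝓝 0) := by
  have key : Tendsto (fun i => ∫⁻ ξ, ‖u i ξ‖ₑ ^ (2 : ℝ)) l (𝓝 (∫⁻ ξ : ℝ, 0)) := by
    refine tendsto_lintegral_filter_of_dominated_convergence' (fun ξ => ‖b ξ‖ₑ ^ (2 : ℝ))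
      (Eventually.of_forall fun i => ((hu i).enorm).pow_const _) ?_ ?_ ?_
    · filter_upwards [hub] with i hi
      exact Eventually.of_forall fun ξ =>
        ENNReal.rpow_le_rpow (enorm_le_iff_norm_le.mpr (hi ξ)) (by norm_num)
    · have h2 := (eLpNorm_lt_top_iff_lintegral_rpow_enorm_lt_top (by norm_num) (by norm_num)).mp hb.2
      simpa using h2.ne
    · refine Eventually.of_forall fun ξ => ?_
      have h2 := (h0 ξ).enorm
      rw [enorm_zero] at h2
      have h3 := ((ENNReal.continuous_rpow_const (y := 2)).tendsto (0 : ENNReal)).comp h2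
      rw [ENNReal.zero_rpow_of_pos (by norm_num)] at h3
      exact h3
  rw [lintegral_zero] at key
  have h5 := ((ENNReal.continuous_rpow_const (y := 1 / 2)).tendsto (0 : ENNReal)).comp key
  rw [ENNReal.zero_rpow_of_pos (by norm_num)] at h5
  refine h5.congr fun δ => ?_
  rw [eLpNorm_eq_lintegral_rpow_enorm_toReal (by norm_num) (by norm_num)]
  simp

/-- The difference quotients of a function converge in `L²` to its derivative. -/
theorem tendsto_eLpNorm_diffQuot {f g : ℝ → ℂ} (hf : MemLp f 2 (volume : Measure ℝ))
    (hg : MemLp g 2 (volume : Measure ℝ)) (hfg : ∂_{(1 : ℝ)} (ofFun f) = ofFun g) :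
    Tendsto (fun δ : ℝ => eLpNorm (fun x => (f (x + δ) - f x) / δ - g x) 2 volume)
      (𝓝[≠] 0) (𝓝 0) := by
  obtain ⟨F, hF⟩ : ∃ F, IsHat 0 (ofFun f) F := ⟨_, isHat_ofFun hf⟩
  have hG : IsHat 0 (ofFun g) (fun ξ => (2 * Real.pi * Complex.I * ξ) * F ξ) := by
    have h1 := hF.lineDeriv
    rw [hfg] at h1
    exact h1.memLp_of_memSobolev (isHat_ofFun hg).memSobolev
  have hGm : MemLp (fun ξ => (2 * Real.pi * Complex.I * ξ) * F ξ) 2 (volume : Measure ℝ) := by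
    simpa using hG.memLp
  have hFm : AEStronglyMeasurable F (volume : Measure ℝ) := hF.aestronglyMeasurable
  have hD : ∀ δ : ℝ, eLpNorm (fun x => (f (x + δ) - f x) / δ - g x) 2 volume =
      eLpNorm (fun ξ => (((Real.fourierChar (δ * ξ) : ℂ) - 1) / δ - 2 * Real.pi * Complex.I * ξ) *
        F ξ) 2 volume := by
    intro δ
    have m1 : MemLp (fun x => f (x + δ) - f x) 2 (volume : Measure ℝ) :=
      (memLp_comp_add hf δ).sub hf
    have h1 := isHat_sub (memLp_comp_add hf δ) hf (isHat_comp_add hf hF δ) hF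
    have h2 := h1.smul ((δ : ℂ)⁻¹)
    rw [← ofFun_const_mul _ m1] at h2
    have h3 := isHat_sub (m1.const_mul _) hg h2 hG
    have h4 := h3.eLpNorm_eq ((m1.const_mul _).sub hg)
    calc _ = eLpNorm (fun x => (δ : ℂ)⁻¹ * (f (x + δ) - f x) - g x) 2 volume := by
          congr 1; ext x; rw [div_eq_inv_mul]
      _ = _ := h4.symm
      _ = _ := by congr 1; ext ξ; ring
  simp only [hD]
  -- The factor 2 in the dominating function: the difference quotient of the character and its limit
  -- are each bounded by `2π|ξ|`.
  refine tendsto_eLpNorm_two_zero (b := fun ξ => 2 * ((2 * Real.pi * Complex.I * ξ) * F ξ))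
    (fun δ => ?_) (hGm.const_mul 2) ?_ fun ξ => ?_
  · have : Continuous fun ξ : ℝ => (((Real.fourierChar (δ * ξ) : ℂ) - 1) / δ -
        2 * Real.pi * Complex.I * ξ) := by
      have hc : Continuous fun ξ : ℝ => (Real.fourierChar (δ * ξ) : ℂ) :=
        continuous_subtype_val.comp (Real.continuous_fourierChar.comp (by fun_prop))
      fun_prop
    exact this.aestronglyMeasurable.mul hFm
  · filter_upwards [self_mem_nhdsWithin] with δ hδ ξ
    rw [norm_mul, norm_mul, norm_mul, ← mul_assoc]
    gcongr
    have h1 : ‖((Real.fourierChar (δ * ξ) : ℂ) - 1) / δ‖ ≤ 2 * Real.pi * |ξ| := by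
      rw [norm_div, Complex.norm_real, Real.norm_eq_abs]
      rw [div_le_iff₀ (abs_pos.mpr hδ)]
      refine (norm_fourierChar_sub_one_le _).trans (le_of_eq ?_)
      rw [abs_mul]; ring
    have h2 : ‖(2 * Real.pi * Complex.I * ξ : ℂ)‖ = 2 * Real.pi * |ξ| := by
      simp only [norm_mul, Complex.norm_real, Complex.norm_I,
        Complex.norm_ofNat, Real.norm_of_nonneg Real.pi_pos.le, Real.norm_eq_abs ξ]
      ring
    refine (norm_sub_le _ _).trans ?_
    rw [h2, Complex.norm_ofNat]
    linarith
  · have h1 := ((tendsto_fourierChar_slope ξ).sub_const (2 * Real.pi * Complex.I * ξ)).mul_const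
      (F ξ)
    rwa [sub_self, zero_mul] at h1

theorem norm_integral_mul_le {u v : ℝ → ℂ} (hu : MemLp u 2 (volume : Measure ℝ))
    (hv : MemLp v 2 (volume : Measure ℝ)) :
    ‖∫ x, u x * v x‖ ≤ (eLpNorm u 2 volume * eLpNorm v 2 volume).toReal := by
  rw [← toReal_enorm]
  refine ENNReal.toReal_mono (ENNReal.mul_ne_top hu.2.ne hv.2.ne) ?_
  refine (enorm_integral_le_lintegral_enorm _).trans ?_
  have h := lintegral_mul_le_eLpNorm hu.1.enorm hv.1.enorm
  simp only [enorm_mul]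
  refine h.trans (le_of_eq ?_)
  rw [eLpNorm_enorm, eLpNorm_enorm]

theorem memLp_diffQuot {f g : ℝ → ℂ} (hf : MemLp f 2 (volume : Measure ℝ))
    (hg : MemLp g 2 (volume : Measure ℝ)) (δ : ℝ) :
    MemLp (fun x => (f (x + δ) - f x) / δ - g x) 2 (volume : Measure ℝ) := by
  have h2 : MemLp (fun x => (δ : ℂ)⁻¹ * (f (x + δ) - f x) - g x) 2 (volume : Measure ℝ) :=
    (((memLp_comp_add hf δ).sub hf).const_mul _).sub hg
  simpa only [div_eq_inv_mul] using h2

theorem integrable_mul_of_memLp {u v : ℝ → ℂ} (hu : MemLp u 2 (volume : Measure ℝ))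
    (hv : MemLp v 2 (volume : Measure ℝ)) : Integrable (fun x => u x * v x) volume :=
  hu.integrable_mul hv

theorem tendsto_integral_mul_diffQuot {f g v : ℝ → ℂ} (hf : MemLp f 2 (volume : Measure ℝ))
    (hg : MemLp g 2 (volume : Measure ℝ)) (hv : MemLp v 2 (volume : Measure ℝ))
    (h : Tendsto (fun δ : ℝ => eLpNorm (fun x => (f (x + δ) - f x) / δ - g x) 2 volume)
      (𝓝[≠] 0) (𝓝 0)) :
    Tendsto (fun δ : ℝ => ∫ x, v x * ((f (x + δ) - f x) / δ)) (𝓝[≠] 0) (𝓝 (∫ x, v x * g x)) := by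
  have h1 : Tendsto (fun δ : ℝ => ∫ x, v x * ((f (x + δ) - f x) / δ - g x)) (𝓝[≠] 0) (𝓝 0) := by
    refine squeeze_zero_norm (fun δ => norm_integral_mul_le hv (memLp_diffQuot hf hg δ)) ?_
    have h5 := ENNReal.Tendsto.const_mul h (a := eLpNorm v 2 volume) (Or.inr hv.2.ne)
    rw [mul_zero] at h5
    have h6 := (ENNReal.tendsto_toReal ENNReal.zero_ne_top).comp h5
    rw [ENNReal.toReal_zero] at h6
    exact h6
  have h2 := h1.add_const (∫ x, v x * g x)
  rw [zero_add] at h2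
  refine h2.congr fun δ => ?_
  rw [← integral_add (integrable_mul_of_memLp hv (memLp_diffQuot hf hg δ))
    (integrable_mul_of_memLp hv hg)]
  congr 1; ext x; ring

/-- Integration by parts for functions whose difference quotients converge in `L²`. -/
theorem integral_mul_eq_neg_of_tendsto {f g v w : ℝ → ℂ} (hf : MemLp f 2 (volume : Measure ℝ))
    (hg : MemLp g 2 (volume : Measure ℝ)) (hv : MemLp v 2 (volume : Measure ℝ))
    (hw : MemLp w 2 (volume : Measure ℝ))
    (hfg : Tendsto (fun δ : ℝ => eLpNorm (fun x => (f (x + δ) - f x) / δ - g x) 2 volume)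
      (𝓝[≠] 0) (𝓝 0))
    (hvw : Tendsto (fun δ : ℝ => eLpNorm (fun x => (v (x + δ) - v x) / δ - w x) 2 volume)
      (𝓝[≠] 0) (𝓝 0)) :
    ∫ x, v x * g x = -∫ x, f x * w x := by
  have h1 := tendsto_integral_mul_diffQuot hf hg hv hfg
  have h2 := tendsto_integral_mul_diffQuot hv hw hf hvw
  have hneg : Tendsto (fun δ : ℝ => -δ) (𝓝[≠] 0) (𝓝[≠] 0) := by
    refine tendsto_nhdsWithin_iff.mpr ⟨?_, ?_⟩
    · have : Tendsto (fun δ : ℝ => -δ) (𝓝 0) (𝓝 (-0)) := tendsto_id.neg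
      rw [neg_zero] at this
      exact this.mono_left nhdsWithin_le_nhds
    · filter_upwards [self_mem_nhdsWithin] with δ hδ
      simpa using hδ
  -- Discrete integration by parts: translation invariance turns the difference quotient of `f` with
  -- step `δ` into minus that of `v` with step `-δ`.
  have h3 := (h2.comp hneg).neg
  refine tendsto_nhds_unique h1 (h3.congr fun δ => ?_)
  have e1 : ∫ x, v x * ((f (x + δ) - f x) / δ) =
      (∫ x, v x * f (x + δ)) / δ - (∫ x, v x * f x) / δ := by
    rw [← integral_div, ← integral_div, ← integral_sub
      ((integrable_mul_of_memLp hv (memLp_comp_add hf δ)).div_const _)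
      ((integrable_mul_of_memLp hv hf).div_const _)]
    congr 1; ext x; ring
  have e2 : ∫ x, f x * ((v (x + -δ) - v x) / ((-δ : ℝ) : ℂ)) =
      (∫ x, f x * v x) / δ - (∫ x, f x * v (x + -δ)) / δ := by
    rw [← integral_div, ← integral_div, ← integral_sub
      ((integrable_mul_of_memLp hf hv).div_const _)
      ((integrable_mul_of_memLp hf (memLp_comp_add hv (-δ))).div_const _)]
    congr 1; ext x; push_cast; rw [div_neg]; ring
  have e3 : ∫ x, f x * v (x + -δ) = ∫ x, v x * f (x + δ) := by
    rw [← integral_add_right_eq_self (fun x => f x * v (x + -δ)) δ]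
    congr 1; ext x; rw [add_neg_cancel_right, mul_comm]
  have e4 : ∫ x, f x * v x = ∫ x, v x * f x := by congr 1; ext x; ring
  simp only [Function.comp]
  rw [e1, e2, e3, e4]; ring

theorem lineDeriv_ofFun_apply {f : ℝ → ℂ} (hf : MemLp f 2 (volume : Measure ℝ)) (ψ : 𝓢(ℝ, ℂ)) :
    ∂_{(1 : ℝ)} (ofFun f) ψ = -∫ x, deriv ψ x * f x := by
  rw [lineDeriv_one_apply, ofFun_apply hf]
  rfl

/-- A square integrable classical derivative is the distributional derivative. -/
theorem lineDeriv_ofFun_of_hasDerivAt {v w : ℝ → ℂ} (hv : MemLp v 2 (volume : Measure ℝ))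
    (hw : MemLp w 2 (volume : Measure ℝ)) (hd : ∀ x, HasDerivAt v (w x) x) :
    ∂_{(1 : ℝ)} (ofFun v) = ofFun w := by
  ext ψ
  have hψ : MemLp ψ 2 (volume : Measure ℝ) := ψ.memLp 2 volume
  have hψ' : MemLp (deriv ψ) 2 (volume : Measure ℝ) := (SchwartzMap.derivCLM ℂ ℂ ψ).memLp 2 volume
  rw [lineDeriv_ofFun_apply hv, ofFun_apply hw]
  have h := integral_mul_deriv_eq_deriv_mul_of_integrable (u := ψ) (v := v) (u' := deriv ψ) (v' := w)
    (fun x _ => ψ.differentiableAt.hasDerivAt) (fun x _ => hd x) (integrable_mul_of_memLp hψ hw)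
    (integrable_mul_of_memLp hψ' hv) (integrable_mul_of_memLp hψ hv)
  simpa using h.symm

/-- If the difference quotients of `f` converge in `L²` to `g`, then `g` is the derivative of `f`. -/
theorem lineDeriv_ofFun_of_tendsto {f g : ℝ → ℂ} (hf : MemLp f 2 (volume : Measure ℝ))
    (hg : MemLp g 2 (volume : Measure ℝ))
    (hfg : Tendsto (fun δ : ℝ => eLpNorm (fun x => (f (x + δ) - f x) / δ - g x) 2 volume)
      (𝓝[≠] 0) (𝓝 0)) : ∂_{(1 : ℝ)} (ofFun f) = ofFun g := by
  ext ψ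
  have hψ : MemLp ψ 2 (volume : Measure ℝ) := ψ.memLp 2 volume
  have hψ' : MemLp (deriv ψ) 2 (volume : Measure ℝ) := (SchwartzMap.derivCLM ℂ ℂ ψ).memLp 2 volume
  have h1 := tendsto_eLpNorm_diffQuot hψ hψ' (lineDeriv_ofFun_of_hasDerivAt hψ hψ'
    fun x => ψ.differentiableAt.hasDerivAt)
  rw [lineDeriv_ofFun_apply hf, ofFun_apply hg]
  have h := integral_mul_eq_neg_of_tendsto hf hg hψ hψ' hfg h1
  rw [h]
  congr 2; ext x; ring

/-- Integration by parts in `H¹`. -/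
theorem integral_mul_eq_neg {f g v w : ℝ → ℂ} (hf : MemLp f 2 (volume : Measure ℝ))
    (hg : MemLp g 2 (volume : Measure ℝ)) (hv : MemLp v 2 (volume : Measure ℝ))
    (hw : MemLp w 2 (volume : Measure ℝ)) (hfg : ∂_{(1 : ℝ)} (ofFun f) = ofFun g)
    (hvw : ∂_{(1 : ℝ)} (ofFun v) = ofFun w) : ∫ x, v x * g x = -∫ x, f x * w x :=
  integral_mul_eq_neg_of_tendsto hf hg hv hw (tendsto_eLpNorm_diffQuot hf hg hfg)
    (tendsto_eLpNorm_diffQuot hv hw hvw)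

/-! ### The Gagliardo seminorm for orders between 0 and 1. -/

/-- The weight `|h|^{-1-2σ}` of the Gagliardo seminorm. -/
def gagWt (σ h : ℝ) : ENNReal := ENNReal.ofReal (|h| ^ (-1 - 2 * σ))

/-- The square of the Gagliardo seminorm. -/
def gag (σ : ℝ) (f : ℝ → ℂ) : ENNReal := ∫⁻ x, ∫⁻ y, ‖f y - f x‖ₑ ^ (2 : ℝ) * gagWt σ (y - x)

/-- The constant in the Fourier description of the Gagliardo seminorm. -/
def gagC (σ : ℝ) : ENNReal := ∫⁻ h, gagWt σ h * ‖(Real.fourierChar h : ℂ) - 1‖ₑ ^ (2 : ℝ)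

theorem measurable_gagWt (σ : ℝ) : Measurable (gagWt σ) := by
  unfold gagWt; fun_prop

theorem gagWt_neg (σ h : ℝ) : gagWt σ (-h) = gagWt σ h := by simp [gagWt]

theorem continuous_fourierChar_coe : Continuous fun h : ℝ => (Real.fourierChar h : ℂ) :=
  continuous_subtype_val.comp Real.continuous_fourierChar

theorem integrable_comp_abs_of_integrableOn {f : ℝ → ℝ} (hf : IntegrableOn f (Set.Ioi 0)) :
    Integrable fun x => f |x| := by
  have h1 : IntegrableOn (fun x => f |x|) (Set.Ioi 0) :=
    hf.congr_fun (fun x hx => by rw [abs_of_pos hx]) measurableSet_Ioi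
  have h2 : IntegrableOn (fun x => f |x|) (Set.Iic 0) := by
    rw [← Measure.map_neg_eq_self (volume : Measure ℝ)]
    have m : MeasurableEmbedding fun x : ℝ => -x := (Homeomorph.neg ℝ).measurableEmbedding
    rw [m.integrableOn_map_iff]
    simp_rw [Function.comp_def, abs_neg, Set.neg_preimage, Set.neg_Iic, neg_zero]
    exact Iff.mpr integrableOn_Ici_iff_integrableOn_Ioi h1
  rw [← integrableOn_univ, ← Set.Iic_union_Ioi (a := (0 : ℝ))]
  exact h2.union h1

/-- Near 0 the character differs from 1 by at most `2π|h|`, leaving `|h|^{1-2σ}`, integrable since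
`σ < 1`. Away from 0 it differs by at most 2, leaving `|h|^{-1-2σ}`, integrable since `σ > 0`. -/
theorem gagC_lt_top {σ : ℝ} (h0 : 0 < σ) (h1 : σ < 1) : gagC σ < ⊤ := by
  have hb : ∀ h : ℝ, gagWt σ h * ‖(Real.fourierChar h : ℂ) - 1‖ₑ ^ (2 : ℝ) ≤
      ENNReal.ofReal (if |h| < 1 then (2 * Real.pi) ^ 2 * |h| ^ (1 - 2 * σ)
        else 4 * |h| ^ (-1 - 2 * σ)) := by
    intro h
    rw [gagWt, ← ofReal_norm, ENNReal.ofReal_rpow_of_nonneg (norm_nonneg _) (by norm_num),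
      ← ENNReal.ofReal_mul (by positivity)]
    refine ENNReal.ofReal_le_ofReal ?_
    rw [Real.rpow_two]
    split_ifs with hh
    · rcases eq_or_ne h 0 with rfl | hne
      · simp; positivity
      calc |h| ^ (-1 - 2 * σ) * ‖(Real.fourierChar h : ℂ) - 1‖ ^ 2
          ≤ |h| ^ (-1 - 2 * σ) * (2 * Real.pi * |h|) ^ 2 := by
            gcongr; exact norm_fourierChar_sub_one_le h
        _ = (2 * Real.pi) ^ 2 * (|h| ^ (-1 - 2 * σ) * |h| ^ (2 : ℝ)) := by
            rw [Real.rpow_two]; ring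
        _ = _ := by rw [← Real.rpow_add (abs_pos.mpr hne)]; ring_nf
    · rw [mul_comm]
      gcongr
      have : ‖(Real.fourierChar h : ℂ) - 1‖ ≤ 2 := by
        refine (norm_sub_le _ _).trans ?_
        rw [Circle.norm_coe, norm_one]; norm_num
      nlinarith [norm_nonneg ((Real.fourierChar h : ℂ) - 1)]
  refine (lintegral_mono hb).trans_lt ?_
  have hint : Integrable (fun h : ℝ => (fun r : ℝ => if r < 1 then (2 * Real.pi) ^ 2 * r ^ (1 - 2 * σ)
        else 4 * r ^ (-1 - 2 * σ)) |h|) volume := by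
    refine integrable_comp_abs_of_integrableOn (f := fun r : ℝ => if r < 1 then
      (2 * Real.pi) ^ 2 * r ^ (1 - 2 * σ) else 4 * r ^ (-1 - 2 * σ)) ?_
    rw [← Set.Ioo_union_Ici_eq_Ioi (zero_lt_one (α := ℝ))]
    refine IntegrableOn.union ?_ ?_
    · refine IntegrableOn.congr_fun (f := fun r : ℝ => (2 * Real.pi) ^ 2 * r ^ (1 - 2 * σ)) ?_
        (fun r hr => by simp [hr.2]) measurableSet_Ioo
      refine Integrable.const_mul ?_ _
      exact (intervalIntegral.integrableOn_Ioo_rpow_iff zero_lt_one).mpr (by linarith)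
    · refine IntegrableOn.congr_fun (f := fun r : ℝ => 4 * r ^ (-1 - 2 * σ)) ?_
        (fun r hr => by simp [not_lt.mpr (Set.mem_Ici.mp hr)]) measurableSet_Ici
      refine Integrable.const_mul ?_ _
      rw [← IntegrableOn, integrableOn_Ici_iff_integrableOn_Ioi]
      exact integrableOn_Ioi_rpow_of_lt (by linarith) zero_lt_one
  have h2 := hint.hasFiniteIntegral
  rw [hasFiniteIntegral_iff_ofReal] at h2
  · exact h2
  · refine Eventually.of_forall fun h => ?_
    dsimp only
    split_ifs <;> simp <;> positivity

theorem gagC_ne_zero (σ : ℝ) : gagC σ ≠ 0 := by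
  intro h
  have hm : Measurable fun h => gagWt σ h * ‖(Real.fourierChar h : ℂ) - 1‖ₑ ^ (2 : ℝ) :=
    (measurable_gagWt σ).mul
      (((continuous_fourierChar_coe.sub continuous_const).measurable.enorm).pow_const _)
  rw [gagC, lintegral_eq_zero_iff hm] at h
  have hopen : IsOpen {h : ℝ | h ≠ 0 ∧ (Real.fourierChar h : ℂ) ≠ 1} :=
    isOpen_ne.inter (isOpen_ne_fun continuous_fourierChar_coe continuous_const)
  have hne : {h : ℝ | h ≠ 0 ∧ (Real.fourierChar h : ℂ) ≠ 1}.Nonempty := by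
    -- At `h = 1/2` the character takes the value `-1`, so the integrand is positive on a nonempty
    -- open set.
    refine ⟨1 / 2, by norm_num, ?_⟩
    rw [Real.fourierChar_apply]
    have : (((2 * Real.pi * (1 / 2) : ℝ) : ℂ) * Complex.I) = Real.pi * Complex.I := by
      push_cast; ring
    rw [this, Complex.exp_pi_mul_I]; norm_num
  have hpos := hopen.measure_pos (volume : Measure ℝ) hne
  refine hpos.ne' (measure_mono_null ?_ (ae_iff.mp h))
  rintro x ⟨hx, hx'⟩ h0
  simp only [Pi.zero_apply, mul_eq_zero, gagWt, ENNReal.ofReal_eq_zero] at h0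
  rcases h0 with h0 | h0
  · exact absurd h0 (not_le.mpr (Real.rpow_pos_of_pos (abs_pos.mpr hx) _))
  · rw [ENNReal.rpow_eq_zero_iff_of_pos (by norm_num), enorm_eq_zero, sub_eq_zero] at h0
    exact hx' h0

theorem lintegral_comp_mul_right (g : ℝ → ENNReal) {a : ℝ} (ha : a ≠ 0) :
    ∫⁻ x, g (x * a) = ENNReal.ofReal |a⁻¹| * ∫⁻ x, g x := by
  have h := (Homeomorph.mulRight₀ a ha).toMeasurableEquiv
  have h1 : ∫⁻ x, g x ∂(Measure.map (fun x => x * a) (volume : Measure ℝ)) = ∫⁻ x, g (x * a) :=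
    lintegral_map_equiv (μ := volume) g (Homeomorph.mulRight₀ a ha).toMeasurableEquiv
  rw [← h1, Real.map_volume_mul_right ha, lintegral_smul_measure, smul_eq_mul]

/-- The substitution `h ↦ hξ`: the homogeneous weight contributes `|ξ|^{1+2σ}` and the measure
`|ξ|⁻¹`. -/
theorem lintegral_gagWt_fourierChar (σ : ℝ) {ξ : ℝ} (hξ : ξ ≠ 0) :
    ∫⁻ h, gagWt σ h * ‖(Real.fourierChar (h * ξ) : ℂ) - 1‖ₑ ^ (2 : ℝ) =
      gagC σ * ENNReal.ofReal (|ξ| ^ (2 * σ)) := by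
  have h1 : ∀ h : ℝ, gagWt σ h * ‖(Real.fourierChar (h * ξ) : ℂ) - 1‖ₑ ^ (2 : ℝ) =
      ENNReal.ofReal (|ξ| ^ (1 + 2 * σ)) *
        (gagWt σ (h * ξ) * ‖(Real.fourierChar (h * ξ) : ℂ) - 1‖ₑ ^ (2 : ℝ)) := by
    intro h
    rw [← mul_assoc]
    congr 1
    rw [gagWt, gagWt, ← ENNReal.ofReal_mul (by positivity), abs_mul,
      Real.mul_rpow (abs_nonneg _) (abs_nonneg _), mul_left_comm, ← Real.rpow_add (abs_pos.mpr hξ)]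
    ring_nf
    simp
  simp only [h1]
  rw [lintegral_const_mul' _ _ ENNReal.ofReal_ne_top,
    lintegral_comp_mul_right (fun h => gagWt σ h * ‖(Real.fourierChar h : ℂ) - 1‖ₑ ^ (2 : ℝ)) hξ,
    ← mul_assoc, ← ENNReal.ofReal_mul (by positivity), mul_comm, ← gagC]
  congr 2
  rw [abs_inv, ← Real.rpow_neg_one, ← Real.rpow_add (abs_pos.mpr hξ)]
  ring_nf

theorem lintegral_sq_eq {u v : ℝ → ℂ} (h : eLpNorm u 2 volume = eLpNorm v 2 volume) :
    ∫⁻ x, ‖u x‖ₑ ^ (2 : ℝ) = ∫⁻ x, ‖v x‖ₑ ^ (2 : ℝ) := by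
  rw [eLpNorm_eq_lintegral_rpow_enorm_toReal (by norm_num) (by norm_num),
    eLpNorm_eq_lintegral_rpow_enorm_toReal (by norm_num) (by norm_num)] at h
  have h2 := congrArg (fun t : ENNReal => t ^ (2 : ℝ)) h
  simp only [← ENNReal.rpow_mul] at h2
  norm_num at h2
  simpa using h2

/-- The Gagliardo seminorm on the Fourier side. -/
theorem gag_eq (σ : ℝ) {f F : ℝ → ℂ} (hf : MemLp f 2 (volume : Measure ℝ))
    (hF : IsHat 0 (ofFun f) F) :
    gag σ f = gagC σ * ∫⁻ ξ, ENNReal.ofReal (|ξ| ^ (2 * σ)) * ‖F ξ‖ₑ ^ (2 : ℝ) := by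
  have hFm : AEStronglyMeasurable F (volume : Measure ℝ) := hF.aestronglyMeasurable
  have e1 : gag σ f = ∫⁻ x, ∫⁻ h, gagWt σ h * ‖f (x - h) - f x‖ₑ ^ (2 : ℝ) := by
    unfold gag
    refine lintegral_congr fun x => ?_
    rw [← lintegral_sub_left_eq_self _ x]
    refine lintegral_congr fun h => ?_
    rw [mul_comm, sub_sub_cancel_left, gagWt_neg]
  have hg : AEMeasurable (fun p : ℝ × ℝ => gagWt σ p.2 * ‖f (p.1 - p.2) - f p.1‖ₑ ^ (2 : ℝ))
      (volume.prod volume) := by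
    refine ((measurable_gagWt σ).comp measurable_snd).aemeasurable.mul (AEMeasurable.pow_const ?_ _)
    refine AEStronglyMeasurable.enorm (AEStronglyMeasurable.sub ?_ ?_)
    · exact hf.1.comp_quasiMeasurePreserving
        (quasiMeasurePreserving_sub_of_right_invariant volume volume)
    · exact hf.1.comp_quasiMeasurePreserving Measure.quasiMeasurePreserving_fst
  have e2 : ∀ h : ℝ, ∫⁻ x, ‖f (x - h) - f x‖ₑ ^ (2 : ℝ) =
      ∫⁻ ξ, ‖(Real.fourierChar (h * ξ) : ℂ) - 1‖ₑ ^ (2 : ℝ) * ‖F ξ‖ₑ ^ (2 : ℝ) := by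
    intro h
    -- Plancherel for the translation by `-h`. The sign is harmless, since `χ(-t) - 1` and `χ(t) -
    -- 1` have the same modulus for the character `χ`.
    have h1 := lintegral_sq_eq (eLpNorm_diff_eq hf hF (-h))
    simp only [← sub_eq_add_neg] at h1
    rw [h1]
    refine lintegral_congr fun ξ => ?_
    rw [enorm_mul, ENNReal.mul_rpow_of_nonneg _ _ (by norm_num)]
    congr 2
    rw [← enorm_norm, ← enorm_norm ((Real.fourierChar (h * ξ) : ℂ) - 1)]
    congr 1
    have h3 : (Real.fourierChar (-h * ξ) : ℂ) - 1 =
        -((Real.fourierChar (-h * ξ) : ℂ) * ((Real.fourierChar (h * ξ) : ℂ) - 1)) := by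
      rw [mul_sub, ← Circle.coe_mul, ← AddChar.map_add_eq_mul]
      simp
    rw [h3, norm_neg, norm_mul, Circle.norm_coe, one_mul]
  rw [e1, lintegral_lintegral_swap hg]
  have e3 : ∀ h : ℝ, ∫⁻ x, gagWt σ h * ‖f (x - h) - f x‖ₑ ^ (2 : ℝ) =
      ∫⁻ ξ, gagWt σ h * (‖(Real.fourierChar (h * ξ) : ℂ) - 1‖ₑ ^ (2 : ℝ) * ‖F ξ‖ₑ ^ (2 : ℝ)) := by
    intro h
    have ht : gagWt σ h ≠ ⊤ := ENNReal.ofReal_ne_top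
    rw [lintegral_const_mul' _ _ ht, e2, lintegral_const_mul' _ _ ht]
  simp only [e3]
  rw [lintegral_lintegral_swap]
  · have hm : AEMeasurable fun ξ => ENNReal.ofReal (|ξ| ^ (2 * σ)) * ‖F ξ‖ₑ ^ (2 : ℝ) :=
      (by fun_prop : Measurable fun ξ : ℝ => ENNReal.ofReal (|ξ| ^ (2 * σ))).aemeasurable.mul
        (hFm.enorm.pow_const _)
    rw [← lintegral_const_mul'' _ hm]
    refine lintegral_congr_ae ?_
    have : ∀ᵐ ξ : ℝ, ξ ≠ 0 := by simp [ae_iff, measure_singleton]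
    filter_upwards [this] with ξ hξ
    simp only [← mul_assoc]
    rw [lintegral_mul_const' _ _ (by simp), lintegral_gagWt_fourierChar σ hξ]
  · refine AEMeasurable.mul ((measurable_gagWt σ).comp measurable_fst).aemeasurable
      (AEMeasurable.mul ?_ ?_)
    · have : Continuous fun p : ℝ × ℝ => (Real.fourierChar (p.1 * p.2) : ℂ) - 1 :=
        (continuous_fourierChar_coe.comp (continuous_fst.mul continuous_snd)).sub continuous_const
      exact (this.measurable.enorm.pow_const _).aemeasurable
    · exact (hFm.comp_quasiMeasurePreserving Measure.quasiMeasurePreserving_snd).enorm.pow_const _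

theorem abs_rpow_le_wt {σ : ℝ} (h0 : 0 ≤ σ) (ξ : ℝ) : |ξ| ^ (2 * σ) ≤ wt σ ξ ^ 2 := by
  have h1 : wt σ ξ ^ 2 = (1 + ξ ^ 2) ^ σ := by
    rw [wt, ← Real.rpow_natCast, ← Real.rpow_mul (by positivity)]; norm_num
  rw [h1, Real.rpow_mul (abs_nonneg _)]
  refine Real.rpow_le_rpow (by positivity) ?_ h0
  rw [Real.rpow_two, sq_abs]; linarith

/-- Subadditivity of `t ↦ t^σ` for `0 ≤ σ ≤ 1`. -/
theorem wt_sq_le {σ : ℝ} (h0 : 0 ≤ σ) (h1 : σ ≤ 1) (ξ : ℝ) :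
    wt σ ξ ^ 2 ≤ 1 + |ξ| ^ (2 * σ) := by
  have h2 : wt σ ξ ^ 2 = (1 + ξ ^ 2) ^ σ := by
    rw [wt, ← Real.rpow_natCast, ← Real.rpow_mul (by positivity)]; norm_num
  rw [h2, Real.rpow_mul (abs_nonneg _)]
  rw [Real.rpow_two, sq_abs]
  have h := NNReal.rpow_add_le_add_rpow 1 (⟨ξ ^ 2, sq_nonneg ξ⟩) h0 h1
  have h' := NNReal.coe_le_coe.mpr h
  push_cast at h'
  rwa [Real.one_rpow] at h'

/-- On the Fourier side the seminorm has weight `|ξ|^{2σ}` up to a finite nonzero constant, and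
`|ξ|^{2σ} ≤ (1 + ξ²)^σ ≤ 1 + |ξ|^{2σ}`. The summand 1 is absorbed by the `L²` norm. -/
theorem gag_lt_top_iff {σ : ℝ} (h0 : 0 < σ) (h1 : σ < 1) {f : ℝ → ℂ}
    (hf : MemLp f 2 (volume : Measure ℝ)) : gag σ f < ⊤ ↔ MemSobolev σ 2 (ofFun f) := by
  obtain ⟨F, hF⟩ : ∃ F, IsHat 0 (ofFun f) F := ⟨_, isHat_ofFun hf⟩
  have hFm : AEStronglyMeasurable F (volume : Measure ℝ) := hF.aestronglyMeasurable
  have hF2 : ∫⁻ ξ, ‖F ξ‖ₑ ^ (2 : ℝ) < ⊤ := by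
    have h2 := hF.memLp
    simp only [wt_zero, Complex.ofReal_one, one_mul] at h2
    simpa using (eLpNorm_lt_top_iff_lintegral_rpow_enorm_lt_top (by norm_num) (by norm_num)).mp h2.2
  have hwt : ∀ ξ, ‖(wt σ ξ : ℂ) * F ξ‖ₑ ^ (2 : ℝ) =
      ENNReal.ofReal (wt σ ξ ^ 2) * ‖F ξ‖ₑ ^ (2 : ℝ) := fun ξ => by
    rw [enorm_mul, ENNReal.mul_rpow_of_nonneg _ _ (by norm_num), ← ofReal_norm (wt σ ξ : ℂ),
      Complex.norm_real, Real.norm_of_nonneg (wt_pos σ ξ).le,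
      ENNReal.ofReal_rpow_of_nonneg (wt_pos σ ξ).le (by norm_num), Real.rpow_two]
  have hgoal : gag σ f < ⊤ ↔ ∫⁻ ξ, ENNReal.ofReal (|ξ| ^ (2 * σ)) * ‖F ξ‖ₑ ^ (2 : ℝ) < ⊤ := by
    rw [gag_eq σ hf hF, ENNReal.mul_lt_top_iff]
    simp only [gagC_lt_top h0 h1, true_and, gagC_ne_zero, false_or]
    constructor
    · rintro (h | h)
      · exact h
      · rw [h]; simp
    · exact Or.inl
  rw [hgoal]
  constructor
  · intro h
    refine (hF.of_memLp (τ := σ) ⟨((continuous_wt σ).measurable.complex_ofReal.aestronglyMeasurable).mul hFm, ?_⟩).memSobolev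
    rw [eLpNorm_lt_top_iff_lintegral_rpow_enorm_lt_top (by norm_num) (by norm_num)]
    simp only [ENNReal.toReal_ofNat, hwt]
    calc _ ≤ ∫⁻ ξ, (‖F ξ‖ₑ ^ (2 : ℝ) + ENNReal.ofReal (|ξ| ^ (2 * σ)) * ‖F ξ‖ₑ ^ (2 : ℝ)) := by
          refine lintegral_mono fun ξ => ?_
          dsimp only
          rw [← one_add_mul]
          gcongr
          rw [← ENNReal.ofReal_one, ← ENNReal.ofReal_add (by norm_num) (by positivity)]
          exact ENNReal.ofReal_le_ofReal (wt_sq_le h0.le h1.le ξ)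
      _ < ⊤ := by
          rw [lintegral_add_left' (hFm.enorm.pow_const _)]
          exact ENNReal.add_lt_top.mpr ⟨hF2, h⟩
  · intro h
    have h2 := (hF.memLp_of_memSobolev h).memLp
    have h3 := (eLpNorm_lt_top_iff_lintegral_rpow_enorm_lt_top (by norm_num) (by norm_num)).mp h2.2
    simp only [ENNReal.toReal_ofNat, hwt] at h3
    refine lt_of_le_of_lt (lintegral_mono fun ξ => ?_) h3
    gcongr
    exact abs_rpow_le_wt h0.le ξ

/-! ### Weak derivatives and reciprocals. -/

theorem MemH.exists_deriv {σ : ℝ} (hσ : 0 ≤ σ) {f : ℝ → ℝ} (hf : MemH (σ + 1) f) :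
    ∃ d : ℝ → ℝ, MemH σ d ∧
      ∂_{(1 : ℝ)} (ofFun (fun x => (f x : ℂ))) = ofFun (fun x => (d x : ℂ)) := by
  have h1 : ∂_{(1 : ℝ)} (ofFun (fun x => (f x : ℂ))) ∈ sobolevSubmodule σ := by
    refine ⟨?_, isRealDist_lineDeriv (isRealDist_ofFun f)⟩
    have := hf.isHat.lineDeriv.memSobolev
    rwa [add_sub_cancel_right] at this
  obtain ⟨d, hd, hd'⟩ := exists_real_ofFun hσ h1
  exact ⟨d, ⟨hd, hd' ▸ h1⟩, hd'.symm⟩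

theorem MemH.of_deriv {σ r : ℝ} {f d : ℝ → ℝ} (hf : MemH r f) (hr : σ ≤ r) (hd : MemH σ d)
    (hfd : ∂_{(1 : ℝ)} (ofFun (fun x => (f x : ℂ))) = ofFun (fun x => (d x : ℂ))) :
    MemH (σ + 1) f :=
  memH_iff.mpr ⟨hf.1, (hf.isHat.of_lineDeriv hf.memSobolev hr
    (hfd ▸ hd.memSobolev)).memSobolev⟩

/-- Outside a compact set the function exceeds 1/2, and on the compact set it attains a positive
minimum. -/
theorem exists_pos_le {h : ℝ → ℝ} (hc : Continuous h) (hpos : ∀ x, 0 < h x)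
    (hlim : Tendsto h (cocompact ℝ) (𝓝 1)) : ∃ m, 0 < m ∧ ∀ x, m ≤ h x := by
  have h1 : ∀ᶠ x in cocompact ℝ, 1 / 2 < h x := hlim.eventually (lt_mem_nhds (by norm_num))
  obtain ⟨K, hK, hKs⟩ := mem_cocompact.mp h1
  rcases K.eq_empty_or_nonempty with rfl | hne
  · exact ⟨1 / 2, by norm_num, fun x => le_of_lt (hKs (by simp))⟩
  obtain ⟨x₀, -, hx₀⟩ := hK.exists_isMinOn hne hc.continuousOn
  refine ⟨min (1 / 2) (h x₀), lt_min (by norm_num) (hpos x₀), fun x => ?_⟩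
  by_cases hx : x ∈ K
  · exact (min_le_right _ _).trans (hx₀ hx)
  · exact (min_le_left _ _).trans (le_of_lt (hKs hx))

/-- Membership in `H^σ`, `0 ≤ σ < 1`, passes to functions with smaller increments. -/
theorem MemH.of_abs_sub_le {σ : ℝ} (h0 : 0 ≤ σ) (h1 : σ < 1) {f k : ℝ → ℝ} {C : ℝ} (hC : 0 ≤ C)
    (hf : MemH σ f) (hk : MemLp k 2 (volume : Measure ℝ))
    (h : ∀ x y, |k y - k x| ≤ C * |f y - f x|) : MemH σ k := by
  -- The Gagliardo description requires positive order; at order 0 only square integrability is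
  -- claimed.
  rcases h0.eq_or_lt with rfl | h0
  · exact memH_zero_iff.mpr hk
  refine memH_iff.mpr ⟨hk, ?_⟩
  have hf' := (gag_lt_top_iff h0 h1 hf.memLpC).mpr hf.memSobolev
  refine (gag_lt_top_iff h0 h1 (memLp_ofReal hk)).mp (lt_of_le_of_lt ?_
    (ENNReal.mul_lt_top (ENNReal.ofReal_lt_top (r := C ^ (2 : ℝ))) hf'))
  unfold gag
  have hle : ∀ x y : ℝ, ‖(k y : ℂ) - k x‖ₑ ^ (2 : ℝ) * gagWt σ (y - x) ≤
      ENNReal.ofReal (C ^ (2 : ℝ)) * (‖(f y : ℂ) - f x‖ₑ ^ (2 : ℝ) * gagWt σ (y - x)) := by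
    intro x y
    rw [← mul_assoc, ← ENNReal.ofReal_rpow_of_nonneg hC (by norm_num),
      ← ENNReal.mul_rpow_of_nonneg _ _ (by norm_num)]
    gcongr
    rw [← Complex.ofReal_sub, ← Complex.ofReal_sub, ← ofReal_norm, ← ofReal_norm,
      Complex.norm_real, Complex.norm_real, ← ENNReal.ofReal_mul hC]
    exact ENNReal.ofReal_le_ofReal (h x y)
  calc _ ≤ ∫⁻ x : ℝ, ∫⁻ y : ℝ,
        ENNReal.ofReal (C ^ (2 : ℝ)) * (‖(f y : ℂ) - f x‖ₑ ^ (2 : ℝ) * gagWt σ (y - x)) :=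
        lintegral_mono fun x => lintegral_mono fun y => hle x y
    _ = _ := by
        simp only [lintegral_const_mul' _ _ ENNReal.ofReal_ne_top]

/-- The weak chain rule for the reciprocal. -/
theorem lineDeriv_reciprocal {g d : ℝ → ℝ} (hg : MemLp g 2 (volume : Measure ℝ))
    (hd : MemLp d 2 (volume : Measure ℝ)) (hc : Continuous g) {m : ℝ} (hm : 0 < m)
    (hmg : ∀ x, m ≤ 1 + g x)
    (hk : MemLp (fun x => (1 + g x)⁻¹ - 1) 2 (volume : Measure ℝ))
    (hk' : MemLp (fun x => -(d x * ((1 + g x)⁻¹ * (1 + g x)⁻¹))) 2 (volume : Measure ℝ))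
    (hgd : ∂_{(1 : ℝ)} (ofFun (fun x => (g x : ℂ))) = ofFun (fun x => (d x : ℂ))) :
    ∂_{(1 : ℝ)} (ofFun (fun x => (((1 + g x)⁻¹ - 1 : ℝ) : ℂ))) =
      ofFun (fun x => ((-(d x * ((1 + g x)⁻¹ * (1 + g x)⁻¹)) : ℝ) : ℂ)) := by
  refine lineDeriv_ofFun_of_tendsto (memLp_ofReal hk) (memLp_ofReal hk') ?_
  set κ : ℝ → ℝ := fun x => (1 + g x)⁻¹ with hκ
  have hne : ∀ x, 1 + g x ≠ 0 := fun x => (hm.trans_le (hmg x)).ne'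
  have hκc : Continuous κ := (continuous_const.add hc).inv₀ hne
  have hκ0 : ∀ x, 0 ≤ κ x := fun x => inv_nonneg.mpr (hm.le.trans (hmg x))
  have hκ1 : ∀ x, κ x ≤ m⁻¹ := fun x => inv_anti₀ hm (hmg x)
  have hgl := tendsto_eLpNorm_diffQuot (memLp_ofReal hg) (memLp_ofReal hd) hgd
  -- This remainder comes from evaluating one reciprocal at `x + δ` instead of `x`. It tends to 0 by
  -- continuity of `κ`, dominated by a multiple of `d`.
  have hrl : Tendsto (fun δ : ℝ => eLpNorm (fun x => ((d x * κ x * (κ x - κ (x + δ)) : ℝ) : ℂ)) 2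
      volume) (𝓝[≠] 0) (𝓝 0) := by
    refine tendsto_eLpNorm_two_zero (b := fun x => ((m⁻¹ * m⁻¹ * d x : ℝ) : ℂ)) (fun δ => ?_)
      (memLp_ofReal (hd.const_mul _)) (Eventually.of_forall fun δ x => ?_) fun x => ?_
    · refine Complex.continuous_ofReal.comp_aestronglyMeasurable ((hd.1.mul hκc.aestronglyMeasurable).mul ?_)
      exact (hκc.sub (hκc.comp (continuous_add_const δ))).aestronglyMeasurable
    · rw [Complex.norm_real, Complex.norm_real, norm_mul, norm_mul, norm_mul, norm_mul]
      have e1 : ‖κ x‖ ≤ ‖m⁻¹‖ := by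
        rw [Real.norm_of_nonneg (hκ0 x), Real.norm_of_nonneg (inv_nonneg.mpr hm.le)]; exact hκ1 x
      have e2 : ‖κ x - κ (x + δ)‖ ≤ ‖m⁻¹‖ := by
        rw [Real.norm_of_nonneg (inv_nonneg.mpr hm.le), Real.norm_eq_abs, abs_le]
        constructor <;> linarith [hκ0 x, hκ1 x, hκ0 (x + δ), hκ1 (x + δ)]
      calc ‖d x‖ * ‖κ x‖ * ‖κ x - κ (x + δ)‖ ≤ ‖d x‖ * ‖m⁻¹‖ * ‖m⁻¹‖ := by gcongr
        _ = _ := by ring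
    · have hcont : Continuous fun δ : ℝ => ((d x * κ x * (κ x - κ (x + δ)) : ℝ) : ℂ) := by
        have := hκc.comp (continuous_const_add x)
        fun_prop
      have := hcont.tendsto 0
      simp only [add_zero, sub_self, mul_zero, Complex.ofReal_zero] at this
      exact this.mono_left nhdsWithin_le_nhds
  have hsum := (ENNReal.Tendsto.const_mul hgl (a := ENNReal.ofReal (m⁻¹ * m⁻¹))
    (Or.inr ENNReal.ofReal_ne_top)).add hrl
  rw [mul_zero, add_zero] at hsum
  refine tendsto_of_tendsto_of_tendsto_of_le_of_le' tendsto_const_nhds hsum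
    (Eventually.of_forall fun _ => zero_le) ?_
  filter_upwards [self_mem_nhdsWithin] with δ hδ
  have hδ' : (δ : ℝ) ≠ 0 := hδ
  have hm1 : AEStronglyMeasurable (fun x => ((g (x + δ) : ℂ) - g x) / δ - d x) volume :=
    (memLp_diffQuot (memLp_ofReal hg) (memLp_ofReal hd) δ).1
  have hκd : Continuous fun x => κ (x + δ) := hκc.comp (continuous_add_const δ)
  have hm2 : AEStronglyMeasurable (fun x => ((-(κ x * κ (x + δ)) : ℝ) : ℂ) *
      (((g (x + δ) : ℂ) - g x) / δ - d x)) volume :=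
    (Complex.continuous_ofReal.comp (hκc.mul hκd).neg).aestronglyMeasurable.mul hm1
  have hm3 : AEStronglyMeasurable (fun x => ((d x * κ x * (κ x - κ (x + δ)) : ℝ) : ℂ)) volume :=
    Complex.continuous_ofReal.comp_aestronglyMeasurable
      ((hd.1.mul hκc.aestronglyMeasurable).mul (hκc.sub hκd).aestronglyMeasurable)
  -- The quotient of `κ = 1/(1+g)` is `-κ(x) κ(x+δ)` times that of `g`. The error therefore splits
  -- into a bounded multiple of the error for `g` and the remainder treated above.
  have heq : (fun x => ((((1 + g (x + δ))⁻¹ - 1 : ℝ) : ℂ) - (((1 + g x)⁻¹ - 1 : ℝ) : ℂ)) / δ -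
      ((-(d x * ((1 + g x)⁻¹ * (1 + g x)⁻¹)) : ℝ) : ℂ)) =
      (fun x => ((-(κ x * κ (x + δ)) : ℝ) : ℂ) * (((g (x + δ) : ℂ) - g x) / δ - d x)) +
      (fun x => ((d x * κ x * (κ x - κ (x + δ)) : ℝ) : ℂ)) := by
    ext x
    simp only [Pi.add_apply, hκ]
    norm_cast
    have h1 := hne x
    have h2 := hne (x + δ)
    field_simp
    ring
  rw [heq]
  refine (eLpNorm_add_le hm2 hm3 (by norm_num)).trans ?_
  gcongr
  refine eLpNorm_le_mul_eLpNorm_of_ae_le_mul (Eventually.of_forall fun x => ?_) 2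
  rw [norm_mul, Complex.norm_real, norm_neg, Real.norm_of_nonneg (mul_nonneg (hκ0 _) (hκ0 _))]
  gcongr
  · exact hκ0 _
  · exact hκ1 _
  · exact hκ1 _

/-- The reciprocal of a positive function `1 + g`, `g ∈ H^s`, is in `1 + H^s`. -/
theorem MemH.reciprocal {s : ℝ} (hs : 1 / 2 < s) {g : ℝ → ℝ} (hc : Continuous g) (hg : MemH s g)
    (hpos : ∀ x, 0 < 1 + g x) : MemH s (fun x => (1 + g x)⁻¹ - 1) := by
  obtain ⟨m, hm, hmg⟩ : ∃ m, 0 < m ∧ ∀ x, m ≤ 1 + g x := by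
    have h1 := (hg.tendsto hs hc).const_add 1
    rw [add_zero] at h1
    exact exists_pos_le (continuous_const.add hc) hpos h1
  have hne : ∀ x, 1 + g x ≠ 0 := fun x => (hpos x).ne'
  have hκc : Continuous fun x => (1 + g x)⁻¹ - 1 :=
    ((continuous_const.add hc).inv₀ hne).sub continuous_const
  have hk : MemLp (fun x => (1 + g x)⁻¹ - 1) 2 (volume : Measure ℝ) := by
    refine (hg.1.const_mul m⁻¹).mono hκc.aestronglyMeasurable (Eventually.of_forall fun x => ?_)
    have : (1 + g x)⁻¹ - 1 = -((1 + g x)⁻¹ * g x) := by field_simp [hne x]; ring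
    rw [this, norm_neg, norm_mul, norm_mul, Real.norm_of_nonneg (inv_nonneg.mpr (hpos x).le),
      Real.norm_of_nonneg (inv_nonneg.mpr hm.le)]
    gcongr
    exact hmg x
  -- Induction on the order. Below 1 the increments of the reciprocal are controlled by those of
  -- `g`. From order 1 on, the derivative `-g_x (1+g)⁻²` is estimated with the regularity of the
  -- reciprocal already known.
  have key : ∀ n : ℕ, ∀ σ, 0 ≤ σ → σ ≤ s → σ < 1 + n / 4 → MemH σ (fun x => (1 + g x)⁻¹ - 1) := by
    intro n
    induction n with
    | zero =>
      intro σ h0 hσs h1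
      refine MemH.of_abs_sub_le h0 (by simpa using h1) (C := m⁻¹ * m⁻¹) (by positivity)
        (hg.mono hσs) hk fun x y => ?_
      have : (1 + g y)⁻¹ - 1 - ((1 + g x)⁻¹ - 1) =
          -((1 + g y)⁻¹ * (1 + g x)⁻¹ * (g y - g x)) := by
        field_simp [hne x, hne y]; ring
      rw [this, abs_neg, abs_mul, abs_mul, abs_of_nonneg (inv_nonneg.mpr (hpos x).le),
        abs_of_nonneg (inv_nonneg.mpr (hpos y).le)]
      have := hmg x
      have := hmg y
      gcongr
      exact inv_nonneg.mpr (hpos x).le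
    | succ n ih =>
      intro σ h0 hσs h1
      rcases lt_or_ge σ 1 with hσ1 | hσ1
      · exact ih σ h0 hσs (hσ1.trans_le (by simp; positivity))
      push_cast at h1
      -- The product theorem at order `σ - 1` needs a factor of order at least `σ - 1` and above
      -- 1/2. Here 3/4 could be any number strictly between 1/2 and 1, and is covered by the
      -- induction hypothesis for every `n`.
      have hr : MemH (max (σ - 1) (3 / 4)) (fun x => (1 + g x)⁻¹ - 1) :=
        ih _ (le_max_of_le_right (by norm_num)) (max_le (by linarith) (by linarith))
          (max_lt (by linarith) (by have : (0 : ℝ) ≤ n := Nat.cast_nonneg n; linarith))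
      obtain ⟨d, hd, hgd⟩ := MemH.exists_deriv (σ := σ - 1) (by linarith)
        (by simpa using hg.mono hσs)
      have hr' : 1 / 2 < max (σ - 1) (3 / 4 : ℝ) := lt_max_of_lt_right (by norm_num)
      have h2 := hd.mul (by linarith) (le_max_left _ _) hr' hr
      have h3 := h2.mul (by linarith) (le_max_left _ _) hr' hr
      -- With `k = (1+g)⁻¹ - 1` one has `d (1+g)⁻² = d + 2 d k + d k²`.
      have h4 : MemH (σ - 1) (fun x => -(d x * ((1 + g x)⁻¹ * (1 + g x)⁻¹))) := by
        have h5 := ((hd.add (h2.const_mul 2)).add h3).neg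
        refine h5.congr (Eventually.of_forall fun x => ?_)
        dsimp only; ring
      have h5 := MemH.of_deriv hr (le_max_left _ _) h4
        (lineDeriv_reciprocal hg.1 hd.1 hc hm hmg hk h4.1 hgd)
      simpa using h5
  obtain ⟨n, hn⟩ := exists_nat_gt (4 * s)
  exact key n s (by linarith) le_rfl (by linarith)

/-! ### Composition with diffeomorphisms of the line. -/

/-- `φ` is a `C¹` diffeomorphism of `ℝ` with inverse `ψ` and derivative between `m` and `M`. -/
structure IsDiffeo (φ ψ : ℝ → ℝ) (m M : ℝ) : Prop where
  contDiff : ContDiff ℝ 1 φ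
  left_inv : ∀ x, ψ (φ x) = x
  right_inv : ∀ y, φ (ψ y) = y
  pos : 0 < m
  le_deriv : ∀ x, m ≤ deriv φ x
  deriv_le : ∀ x, deriv φ x ≤ M

namespace IsDiffeo

variable {φ ψ : ℝ → ℝ} {m M : ℝ}

theorem hasDerivAt (h : IsDiffeo φ ψ m M) (x : ℝ) : HasDerivAt φ (deriv φ x) x :=
  (h.contDiff.differentiable (by norm_num) x).hasDerivAt

theorem continuous_deriv (h : IsDiffeo φ ψ m M) : Continuous (deriv φ) :=
  h.contDiff.continuous_deriv le_rfl

theorem deriv_pos (h : IsDiffeo φ ψ m M) (x : ℝ) : 0 < deriv φ x := h.pos.trans_le (h.le_deriv x)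

theorem strictMono (h : IsDiffeo φ ψ m M) : StrictMono φ := strictMono_of_deriv_pos h.deriv_pos

theorem image_univ (h : IsDiffeo φ ψ m M) : φ '' Set.univ = Set.univ :=
  Set.eq_univ_of_forall fun y => ⟨ψ y, trivial, h.right_inv y⟩

theorem continuous_inv (h : IsDiffeo φ ψ m M) : Continuous ψ := by
  have h1 : StrictMono ψ := fun a b hab => by
    rw [← h.right_inv a, ← h.right_inv b] at hab
    exact h.strictMono.lt_iff_lt.mp hab
  exact h1.monotone.continuous_of_surjective fun x => ⟨φ x, h.left_inv x⟩

theorem hasDerivAt_inv (h : IsDiffeo φ ψ m M) (y : ℝ) :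
    HasDerivAt ψ (deriv φ (ψ y))⁻¹ y :=
  HasDerivAt.of_local_left_inverse h.continuous_inv.continuousAt (h.hasDerivAt _)
    (h.deriv_pos _).ne' (Eventually.of_forall h.right_inv)

theorem deriv_inv (h : IsDiffeo φ ψ m M) (y : ℝ) : deriv ψ y = (deriv φ (ψ y))⁻¹ :=
  (h.hasDerivAt_inv y).deriv

theorem symm (h : IsDiffeo φ ψ m M) : IsDiffeo ψ φ M⁻¹ m⁻¹ where
  contDiff := by
    rw [contDiff_one_iff_deriv]
    refine ⟨fun y => (h.hasDerivAt_inv y).differentiableAt, ?_⟩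
    rw [funext h.deriv_inv]
    exact (h.continuous_deriv.comp h.continuous_inv).inv₀ fun y => (h.deriv_pos _).ne'
  left_inv := h.right_inv
  right_inv := h.left_inv
  pos := inv_pos.mpr ((h.deriv_pos 0).trans_le (h.deriv_le 0))
  le_deriv y := by
    rw [h.deriv_inv]; exact inv_anti₀ (h.deriv_pos _) (h.deriv_le _)
  deriv_le y := by
    rw [h.deriv_inv]; exact inv_anti₀ h.pos (h.le_deriv _)

theorem lintegral_comp (h : IsDiffeo φ ψ m M) (G : ℝ → ENNReal) :
    ∫⁻ y, G (ψ y) = ∫⁻ x, ENNReal.ofReal (deriv φ x) * G x := by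
  have h1 := lintegral_image_eq_lintegral_abs_deriv_mul MeasurableSet.univ
    (fun x _ => (h.hasDerivAt x).hasDerivWithinAt) h.strictMono.injective.injOn (fun y => G (ψ y))
  rw [h.image_univ] at h1
  simp only [Measure.restrict_univ, h.left_inv] at h1
  rw [h1]
  exact lintegral_congr fun x => by rw [abs_of_pos (h.deriv_pos x)]

theorem lintegral_comp_le (h : IsDiffeo φ ψ m M) (G : ℝ → ENNReal) :
    ∫⁻ y, G (ψ y) ≤ ENNReal.ofReal M * ∫⁻ x, G x := by
  rw [h.lintegral_comp, ← lintegral_const_mul' _ _ ENNReal.ofReal_ne_top]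
  exact lintegral_mono fun x => by gcongr; exact h.deriv_le x

theorem integral_comp (h : IsDiffeo φ ψ m M) (G : ℝ → ℂ) :
    ∫ y, G (ψ y) = ∫ x, ((deriv φ x : ℝ) : ℂ) * G x := by
  have h1 := integral_image_eq_integral_abs_deriv_smul MeasurableSet.univ
    (fun x _ => (h.hasDerivAt x).hasDerivWithinAt) h.strictMono.injective.injOn (fun y => G (ψ y))
  rw [h.image_univ] at h1
  simp only [Measure.restrict_univ, h.left_inv] at h1
  rw [h1]
  refine integral_congr_ae (Eventually.of_forall fun x => ?_)
  dsimp only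
  rw [abs_of_pos (h.deriv_pos x), Complex.real_smul]

theorem quasiMeasurePreserving (h : IsDiffeo φ ψ m M) :
    Measure.QuasiMeasurePreserving ψ volume volume := by
  refine ⟨h.continuous_inv.measurable, Measure.AbsolutelyContinuous.mk fun s hs h0 => ?_⟩
  rw [Measure.map_apply h.continuous_inv.measurable hs,
    ← lintegral_indicator_one (h.continuous_inv.measurable hs)]
  have h1 := h.lintegral_comp_le (s.indicator 1)
  rw [lintegral_indicator_one hs, h0, mul_zero] at h1
  exact le_antisymm h1 zero_le

theorem memLp_comp (h : IsDiffeo φ ψ m M) {E : Type*} [NormedAddCommGroup E] {f : ℝ → E}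
    (hf : MemLp f 2 (volume : Measure ℝ)) :
    MemLp (fun y => f (ψ y)) 2 (volume : Measure ℝ) := by
  refine ⟨hf.1.comp_quasiMeasurePreserving h.quasiMeasurePreserving, ?_⟩
  have h2 := (eLpNorm_lt_top_iff_lintegral_rpow_enorm_lt_top (by norm_num) (by norm_num)).mp hf.2
  rw [eLpNorm_lt_top_iff_lintegral_rpow_enorm_lt_top (by norm_num) (by norm_num)]
  exact (h.lintegral_comp_le _).trans_lt (ENNReal.mul_lt_top ENNReal.ofReal_lt_top h2)

theorem mul_abs_sub_le (h : IsDiffeo φ ψ m M) (x y : ℝ) : m * |y - x| ≤ |φ y - φ x| := by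
  wlog hxy : x ≤ y generalizing x y with H
  · rw [abs_sub_comm, abs_sub_comm (φ y)]; exact H y x (le_of_not_ge hxy)
  rw [abs_of_nonneg (sub_nonneg.mpr hxy), abs_of_nonneg
    (sub_nonneg.mpr (h.strictMono.monotone hxy))]
  exact mul_sub_le_image_sub_of_le_deriv (h.contDiff.differentiable (by norm_num)) h.le_deriv hxy

/-- The exponent `-1 - 2σ` is negative and `φ` shrinks distances by at most the factor `m`. -/
theorem gagWt_le (h : IsDiffeo φ ψ m M) {σ : ℝ} (hσ : 0 < σ) (x y : ℝ) :
    gagWt σ (φ y - φ x) ≤ ENNReal.ofReal (m ^ (-1 - 2 * σ)) * gagWt σ (y - x) := by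
  rw [gagWt, gagWt, ← ENNReal.ofReal_mul (Real.rpow_nonneg h.pos.le _),
    ← Real.mul_rpow h.pos.le (abs_nonneg _)]
  refine ENNReal.ofReal_le_ofReal ?_
  rcases eq_or_ne x y with rfl | hne
  · simp
  · exact Real.rpow_le_rpow_of_nonpos (mul_pos h.pos (abs_pos.mpr (sub_ne_zero.mpr hne.symm)))
      (h.mul_abs_sub_le x y) (by linarith)

/-- Comparing the kernel at `y - x` with that at `ψ y - ψ x` costs `m^{-1-2σ}`, and the change of
variables costs `M` in each of the two integrals. -/
theorem gag_comp_le (h : IsDiffeo φ ψ m M) {σ : ℝ} (hσ : 0 < σ) (f : ℝ → ℂ) :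
    gag σ (fun y => f (ψ y)) ≤ ENNReal.ofReal M * (ENNReal.ofReal M *
      (ENNReal.ofReal (m ^ (-1 - 2 * σ)) * gag σ f)) := by
  have h1 : ∀ x y, ‖f (ψ y) - f (ψ x)‖ₑ ^ (2 : ℝ) * gagWt σ (y - x) ≤
      ENNReal.ofReal (m ^ (-1 - 2 * σ)) *
        (‖f (ψ y) - f (ψ x)‖ₑ ^ (2 : ℝ) * gagWt σ (ψ y - ψ x)) := by
    intro x y
    rw [mul_left_comm]
    gcongr
    have := h.gagWt_le hσ (ψ x) (ψ y)
    rwa [h.right_inv, h.right_inv] at this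
  calc gag σ (fun y => f (ψ y)) ≤ ∫⁻ x, ∫⁻ y, ENNReal.ofReal (m ^ (-1 - 2 * σ)) *
        (‖f (ψ y) - f (ψ x)‖ₑ ^ (2 : ℝ) * gagWt σ (ψ y - ψ x)) :=
        lintegral_mono fun x => lintegral_mono fun y => h1 x y
    _ ≤ ∫⁻ x, ENNReal.ofReal M * ∫⁻ y', ENNReal.ofReal (m ^ (-1 - 2 * σ)) *
        (‖f y' - f (ψ x)‖ₑ ^ (2 : ℝ) * gagWt σ (y' - ψ x)) :=
        lintegral_mono fun x => h.lintegral_comp_le fun y' => ENNReal.ofReal (m ^ (-1 - 2 * σ)) *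
          (‖f y' - f (ψ x)‖ₑ ^ (2 : ℝ) * gagWt σ (y' - ψ x))
    _ ≤ ENNReal.ofReal M * ∫⁻ x', ENNReal.ofReal M * ∫⁻ y', ENNReal.ofReal (m ^ (-1 - 2 * σ)) *
        (‖f y' - f x'‖ₑ ^ (2 : ℝ) * gagWt σ (y' - x')) :=
        h.lintegral_comp_le fun x' => ENNReal.ofReal M * ∫⁻ y', ENNReal.ofReal (m ^ (-1 - 2 * σ)) *
          (‖f y' - f x'‖ₑ ^ (2 : ℝ) * gagWt σ (y' - x'))
    _ = _ := by
        simp only [lintegral_const_mul' _ _ ENNReal.ofReal_ne_top, gag]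

/-- The weak chain rule for the composition with a diffeomorphism. -/
theorem lineDeriv_comp (h : IsDiffeo φ ψ m M) {f d : ℝ → ℂ}
    (hf : MemLp f 2 (volume : Measure ℝ)) (hd : MemLp d 2 (volume : Measure ℝ))
    (hd' : MemLp (fun x => (((deriv φ x)⁻¹ : ℝ) : ℂ) * d x) 2 (volume : Measure ℝ))
    (hfd : ∂_{(1 : ℝ)} (ofFun f) = ofFun d) :
    ∂_{(1 : ℝ)} (ofFun (fun y => f (ψ y))) =
      ofFun (fun y => (((deriv φ (ψ y))⁻¹ : ℝ) : ℂ) * d (ψ y)) := by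
  ext χ
  have hχ : MemLp χ 2 (volume : Measure ℝ) := χ.memLp 2 volume
  have hχ' : MemLp (deriv χ) 2 (volume : Measure ℝ) := (SchwartzMap.derivCLM ℂ ℂ χ).memLp 2 volume
  rw [lineDeriv_ofFun_apply (h.memLp_comp hf), ofFun_apply (h.memLp_comp hd')]
  have hv : MemLp (fun x => χ (φ x)) 2 (volume : Measure ℝ) := h.symm.memLp_comp hχ
  have hw : MemLp (fun x => ((deriv φ x : ℝ) : ℂ) * deriv χ (φ x)) 2 (volume : Measure ℝ) := by
    refine ((h.symm.memLp_comp hχ').const_mul (M : ℂ)).mono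
      ((Complex.continuous_ofReal.comp h.continuous_deriv).aestronglyMeasurable.mul
        (h.symm.memLp_comp hχ').1) (Eventually.of_forall fun x => ?_)
    rw [norm_mul, norm_mul, Complex.norm_real, Complex.norm_real,
      Real.norm_of_nonneg (h.deriv_pos x).le,
      Real.norm_of_nonneg ((h.deriv_pos x).le.trans (h.deriv_le x))]
    gcongr
    exact h.deriv_le x
  have hvw : ∂_{(1 : ℝ)} (ofFun fun x => χ (φ x)) =
      ofFun fun x => ((deriv φ x : ℝ) : ℂ) * deriv χ (φ x) := by
    refine lineDeriv_ofFun_of_hasDerivAt hv hw fun x => ?_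
    have := (χ.differentiableAt (x := φ x)).hasDerivAt.scomp x (h.hasDerivAt x)
    rw [Complex.real_smul] at this
    exact this
  -- The change of variables moves the diffeomorphism from `f` to the test function. What remains is
  -- integration by parts of `f` against `χ ∘ φ`, which has a classical derivative.
  have e1 : ∫ x, deriv χ x * f (ψ x) = ∫ x, f x * (((deriv φ x : ℝ) : ℂ) * deriv χ (φ x)) := by
    have := h.integral_comp (fun x => deriv χ (φ x) * f x)
    simp only [h.right_inv] at this
    rw [this]
    congr 1; ext x; ring
  have e2 : ∫ y, χ y * ((((deriv φ (ψ y))⁻¹ : ℝ) : ℂ) * d (ψ y)) = ∫ x, χ (φ x) * d x := by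
    have := h.integral_comp (fun x => χ (φ x) * ((((deriv φ x)⁻¹ : ℝ) : ℂ) * d x))
    simp only [h.right_inv] at this
    rw [this]
    refine integral_congr_ae (Eventually.of_forall fun x => ?_)
    have : ((deriv φ x : ℝ) : ℂ) ≠ 0 := Complex.ofReal_ne_zero.mpr (h.deriv_pos x).ne'
    dsimp only
    rw [Complex.ofReal_inv]
    field_simp
  rw [e1, e2, integral_mul_eq_neg hf hd hv hw hfd hvw]

/-- Composition with the inverse of a diffeomorphism of class `H^{s+1}` preserves `H^σ`,
`0 ≤ σ ≤ s + 1`. -/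
theorem memH_comp (h : IsDiffeo φ ψ m M) {s : ℝ} (hs : 1 / 2 < s)
    (hk : MemH s (fun x => (deriv φ x)⁻¹ - 1)) {σ : ℝ} (h0 : 0 ≤ σ) (hσ : σ ≤ s + 1) {f : ℝ → ℝ}
    (hf : MemH σ f) : MemH σ (fun y => f (ψ y)) := by
  -- Induction on the integer part of the order: the Gagliardo seminorm handles orders below 1, and
  -- the chain rule reduces order `σ ≥ 1` to `σ - 1`.
  have key : ∀ n : ℕ, ∀ σ, 0 ≤ σ → σ ≤ s + 1 → σ < n + 1 → ∀ f, MemH σ f →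
      MemH σ (fun y => f (ψ y)) := by
    intro n
    induction n with
    | zero =>
      intro σ h0 _ h1 f hf
      rcases h0.eq_or_lt with rfl | h0
      · exact memH_zero_iff.mpr (h.memLp_comp hf.1)
      have h1 : σ < 1 := by simpa using h1
      refine memH_iff.mpr ⟨h.memLp_comp hf.1, (gag_lt_top_iff h0 h1 (h.memLp_comp hf.memLpC)).mp ?_⟩
      refine (h.gag_comp_le h0 fun x => (f x : ℂ)).trans_lt ?_
      refine ENNReal.mul_lt_top ENNReal.ofReal_lt_top (ENNReal.mul_lt_top ENNReal.ofReal_lt_top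
        (ENNReal.mul_lt_top ENNReal.ofReal_lt_top ((gag_lt_top_iff h0 h1 hf.memLpC).mpr
          hf.memSobolev)))
    | succ n ih =>
      intro σ h0 hσ h1 f hf
      rcases lt_or_ge σ 1 with hσ1 | hσ1
      · exact ih σ h0 hσ (hσ1.trans_le (by simp)) f hf
      push_cast at h1
      obtain ⟨d, hd, hfd⟩ := MemH.exists_deriv (σ := σ - 1) (by linarith) (by simpa using hf)
      -- The derivative of `f ∘ ψ` is `(d/φ_x) ∘ ψ`. The bound `σ ≤ s + 1` is what makes
      -- multiplication by `1/φ_x ∈ 1 + H^s` preserve `H^{σ-1}`.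
      have h2 : MemH (σ - 1) (fun x => (deriv φ x)⁻¹ * d x) := by
        refine (hd.add (hd.mul (by linarith) (by linarith) hs hk)).congr
          (Eventually.of_forall fun x => ?_)
        dsimp only; ring
      have h3 := ih (σ - 1) (by linarith) (by linarith) (by linarith) _ h2
      have h4 := ih (σ - 1) (by linarith) (by linarith) (by linarith) f (hf.mono (by linarith))
      have h5 := h.lineDeriv_comp hf.memLpC hd.memLpC (by simpa using h2.memLpC) hfd
      have h6 := MemH.of_deriv h4 le_rfl h3 (by simpa using h5)
      simpa using h6
  obtain ⟨n, hn⟩ := exists_nat_gt σ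
  exact key n σ h0 hσ (by linarith) f hf

end IsDiffeo

/-! ### Duality on the Fourier side and the product `h h_x`. -/

/-- The function `x ↦ conj (ψ (-x))`. -/
def schwartzConjNeg (ψ : 𝓢(ℝ, ℂ)) : 𝓢(ℝ, ℂ) :=
  SchwartzMap.compCLMOfContinuousLinearEquiv ℂ (ContinuousLinearEquiv.neg ℝ)
    (SchwartzMap.postcompCLM (𝕜 := ℝ) (Complex.conjCLE : ℂ →L[ℝ] ℂ) ψ)

theorem schwartzConjNeg_apply (ψ : 𝓢(ℝ, ℂ)) (x : ℝ) : schwartzConjNeg ψ x = conj (ψ (-x)) := rfl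

theorem fourier_schwartzConjNeg (ψ : 𝓢(ℝ, ℂ)) (x : ℝ) :
    𝓕 (schwartzConjNeg ψ) x = conj (𝓕 ψ x) := by
  rw [SchwartzMap.fourier_coe, SchwartzMap.fourier_coe, Real.fourier_eq, Real.fourier_eq,
    ← integral_conj, ← integral_neg_eq_self]
  refine integral_congr_ae (Eventually.of_forall fun y => ?_)
  simp only [Circle.smul_def, smul_eq_mul, schwartzConjNeg_apply, neg_neg, map_mul,
    ← Circle.coe_inv_eq_conj, ← AddChar.map_neg_eq_inv, inner_neg_left]

theorem apply_eq_fourier (T : 𝓢'(ℝ, ℂ)) (ψ : 𝓢(ℝ, ℂ)) : T ψ = 𝓕 T (𝓕⁻ ψ) := by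
  rw [TemperedDistribution.fourier_apply, fourier_fourierInv_eq]

theorem memLp_comp_neg {f : ℝ → ℂ} (hf : MemLp f 2 (volume : Measure ℝ)) :
    MemLp (fun x => f (-x)) 2 (volume : Measure ℝ) :=
  hf.comp_measurePreserving (Measure.measurePreserving_neg volume)

theorem memLp_conj {f : ℝ → ℂ} (hf : MemLp f 2 (volume : Measure ℝ)) :
    MemLp (fun x => conj (f x)) 2 (volume : Measure ℝ) := hf.star

theorem isHat_conj {f F : ℝ → ℂ} (hf : MemLp f 2 (volume : Measure ℝ))
    (hF : IsHat 0 (ofFun f) F) :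
    IsHat 0 (ofFun (fun x => conj (f x))) (fun ξ => conj (F (-ξ))) := by
  have hFm : MemLp F 2 (volume : Measure ℝ) := by simpa using hF.memLp
  refine ⟨?_, fun ψ => ?_⟩
  · simpa using memLp_conj (memLp_comp_neg hFm)
  · rw [TemperedDistribution.fourier_apply, ofFun_apply (memLp_conj hf)]
    have h1 := hF.fourier (schwartzConjNeg ψ)
    rw [TemperedDistribution.fourier_apply, ofFun_apply hf] at h1
    have h2 := congrArg conj h1
    rw [← integral_conj, ← integral_conj, ← integral_neg_eq_self (fun ξ =>
      conj (schwartzConjNeg ψ ξ * F ξ))] at h2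
    simpa only [map_mul, fourier_schwartzConjNeg, Complex.conj_conj, schwartzConjNeg_apply,
      neg_neg] using h2

theorem IsHat.inner_eq {u v U V : ℝ → ℂ} (hu : MemLp u 2 (volume : Measure ℝ))
    (hv : MemLp v 2 (volume : Measure ℝ)) (hU : IsHat 0 (ofFun u) U) (hV : IsHat 0 (ofFun v) V) :
    ∫ x, conj (u x) * v x = ∫ ξ, conj (U ξ) * V ξ := by
  have h := Lp.inner_fourier_eq (hu.toLp u) (hv.toLp v)
  rw [L2.inner_def, L2.inner_def] at h
  have e1 : ∫ x, inner ℂ ((hu.toLp u : Lp ℂ 2 (volume : Measure ℝ)) x)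
      ((hv.toLp v : Lp ℂ 2 (volume : Measure ℝ)) x) = ∫ x, conj (u x) * v x := by
    refine integral_congr_ae ?_
    filter_upwards [hu.coeFn_toLp, hv.coeFn_toLp] with x h1 h2
    rw [h1, h2, RCLike.inner_apply, mul_comm]
  rw [← e1, ← h]
  refine integral_congr_ae ?_
  filter_upwards [(isHat_ofFun hu).unique hU, (isHat_ofFun hv).unique hV] with x h1 h2
  rw [h1, h2, RCLike.inner_apply, mul_comm]

/-- Plancherel's sesquilinear identity applied to `conj v`, whose transform at `ξ` is `conj (V
(-ξ))`. -/
theorem IsHat.integral_mul_eq {u v U V : ℝ → ℂ} (hu : MemLp u 2 (volume : Measure ℝ))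
    (hv : MemLp v 2 (volume : Measure ℝ)) (hU : IsHat 0 (ofFun u) U) (hV : IsHat 0 (ofFun v) V) :
    ∫ x, u x * v x = ∫ ξ, U ξ * V (-ξ) := by
  have h := IsHat.inner_eq (memLp_conj hv) hu (isHat_conj hv hV) hU
  simp only [Complex.conj_conj] at h
  simpa only [mul_comm] using h

theorem isHat_besselL2 {σ : ℝ} {T : 𝓢'(ℝ, ℂ)} {F : ℝ → ℂ} (hT : IsHat σ T F) :
    IsHat 0 (ofFun (besselL2 σ T)) (fun ξ => (wt σ ξ : ℂ) * F ξ) := by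
  have h := isHat_ofFun (Lp.memLp (besselL2 σ T))
  refine h.congr ?_
  rw [Lp.toLp_coeFn]
  exact hT.fourier_besselL2_ae

/-- The duality pairing on the Fourier side. -/
theorem dualPairing_eq {σ : ℝ} {T S : 𝓢'(ℝ, ℂ)} {F G : ℝ → ℂ} (hT : IsHat σ T F)
    (hS : IsHat (-σ) S G) : dualPairing σ T S = ∫ ξ, F ξ * G (-ξ) := by
  unfold dualPairing
  rw [IsHat.integral_mul_eq (Lp.memLp _) (Lp.memLp _) (isHat_besselL2 hT) (isHat_besselL2 hS)]
  refine integral_congr_ae (Eventually.of_forall fun ξ => ?_)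
  have : (wt σ ξ : ℂ) * (wt (-σ) ξ : ℂ) = 1 := by
    rw [← Complex.ofReal_mul, wt_mul_neg]; simp
  dsimp only
  rw [wt_neg_arg]
  linear_combination (F ξ * G (-ξ)) * this

theorem isHat_schwartz (σ : ℝ) (ψ : 𝓢(ℝ, ℂ)) : IsHat σ (ofFun ψ) (𝓕 ψ : 𝓢(ℝ, ℂ)) := by
  refine ⟨?_, fun χ => ?_⟩
  · have h := (SchwartzMap.smulLeftCLM ℂ (fun ξ : ℝ => (wt σ ξ : ℂ)) (𝓕 ψ)).memLp 2 (volume : Measure ℝ)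
    refine (memLp_congr_ae (Eventually.of_forall fun ξ => ?_)).mp h
    rw [SchwartzMap.smulLeftCLM_apply_apply (hasTemperateGrowth_wt σ), smul_eq_mul]
  · rw [TemperedDistribution.fourier_apply, ofFun_apply (ψ.memLp 2 volume)]
    have h := integral_fourierInv_mul (𝓕 χ).integrable (𝓕 ψ).integrable
    rw [← SchwartzMap.fourierInv_coe, ← SchwartzMap.fourierInv_coe, fourierInv_fourier_eq,
      fourierInv_fourier_eq] at h
    exact h.symm

theorem continuous_fourierInv_schwartz_add (χ : 𝓢(ℝ, ℂ)) :
    Continuous fun z : ℝ × ℝ => χ (z.1 + z.2) := χ.continuous.comp (by fun_prop)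

/-- Integrability in the symmetrisation of the convolution of `ξ F(ξ)` with `F`. -/
theorem integrable_convKernel {s : ℝ} (hs : 1 / 2 < s) {F : ℝ → ℂ}
    (hF : MemLp (fun ξ => (wt s ξ : ℂ) * F ξ) 2 (volume : Measure ℝ))
    (hFm : AEStronglyMeasurable F (volume : Measure ℝ)) (χ : 𝓢(ℝ, ℂ))
    (hχ : ∀ σ, MemLp (fun ξ => (wt σ ξ : ℂ) * χ (-ξ)) 2 (volume : Measure ℝ)) {D : ℝ → ℂ}
    (hD : MemLp (fun ξ => (wt (min 0 (s - 1)) ξ : ℂ) * D ξ) 2 (volume : Measure ℝ))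
    (hDm : AEStronglyMeasurable D (volume : Measure ℝ)) :
    Integrable (fun z : ℝ × ℝ => D z.1 * (F z.2 * χ (z.1 + z.2))) (volume.prod volume) := by
  set τ := min 0 (s - 1) with hτ
  have hτ0 : 0 ≤ -τ := by rw [hτ]; linarith [min_le_left 0 (s - 1)]
  -- Since `-τ = max 0 (1 - s)`, this is `1 - s ≤ s` in the singular range: multiplication by `H^s`
  -- functions preserves the dual space `H^{-τ}`.
  have hτs : -τ ≤ s := by
    rw [hτ, neg_le]; exact le_min (by linarith) (by linarith)
  have hm : AEStronglyMeasurable (fun z : ℝ × ℝ => D z.1 * (F z.2 * χ (z.1 + z.2)))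
      (volume.prod volume) :=
    (hDm.comp_quasiMeasurePreserving Measure.quasiMeasurePreserving_fst).mul
      ((hFm.comp_quasiMeasurePreserving Measure.quasiMeasurePreserving_snd).mul
        (continuous_fourierInv_schwartz_add χ).aestronglyMeasurable)
  refine ⟨hm, ?_⟩
  rw [hasFiniteIntegral_iff_enorm, lintegral_prod _ hm.enorm]
  have hχm : AEStronglyMeasurable (fun ξ => χ (-ξ)) (volume : Measure ℝ) :=
    (χ.continuous.comp continuous_neg).aestronglyMeasurable
  have hcv : AEMeasurable (cv (wabs 0 (fun ξ => χ (-ξ))) (wabs 0 F)) (volume : Measure ℝ) :=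
    aemeasurable_cv (aemeasurable_wabs 0 hχm) (aemeasurable_wabs 0 hFm)
  -- The weights of order `τ` and `-τ` cancel. They are inserted so that Cauchy–Schwarz pairs `D` at
  -- order `τ` with a convolution bounded at order `-τ` by the product estimate.
  have h1 : ∀ ξ, ∫⁻ η, ‖D ξ * (F η * χ (ξ + η))‖ₑ = wabs τ D ξ *
      (fun ξ => ENNReal.ofReal (wt (-τ) ξ) * cv (wabs 0 (fun ξ => χ (-ξ))) (wabs 0 F) ξ) (-ξ) := by
    intro ξ
    have e1 : cv (wabs 0 (fun ξ => χ (-ξ))) (wabs 0 F) (-ξ) = ∫⁻ η, ‖F η * χ (ξ + η)‖ₑ := by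
      unfold cv
      refine lintegral_congr fun η => ?_
      simp only [wabs, wt_zero, Complex.ofReal_one, one_mul, enorm_mul]
      congr 3; ring
    dsimp only
    rw [e1, wabs_eq, wt_neg_arg, mul_mul_mul_comm, ← ENNReal.ofReal_mul (wt_pos _ _).le, wt_mul_neg,
      ENNReal.ofReal_one, one_mul]
    rw [← lintegral_const_mul' _ _ enorm_ne_top]
    simp only [enorm_mul]
  simp only [h1]
  have hm2 : AEMeasurable (fun ξ => ENNReal.ofReal (wt (-τ) ξ) *
      cv (wabs 0 (fun ξ => χ (-ξ))) (wabs 0 F) ξ) (volume : Measure ℝ) :=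
    ((continuous_wt _).measurable.ennreal_ofReal.aemeasurable).mul hcv
  have hm3 := hm2.comp_quasiMeasurePreserving
    (Measure.measurePreserving_neg (volume : Measure ℝ)).quasiMeasurePreserving
  refine (lintegral_mul_le_eLpNorm (aemeasurable_wabs τ hDm) hm3).trans_lt ?_
  refine ENNReal.mul_lt_top (by rw [eLpNorm_wabs]; exact hD.2) ?_
  have e2 : eLpNorm ((fun ξ => ENNReal.ofReal (wt (-τ) ξ) *
      cv (wabs 0 (fun ξ => χ (-ξ))) (wabs 0 F) ξ) ∘ Neg.neg) 2 volume =
      eLpNorm (fun ξ => ENNReal.ofReal (wt (-τ) ξ) *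
      cv (wabs 0 (fun ξ => χ (-ξ))) (wabs 0 F) ξ) 2 volume := by
    rw [eLpNorm_two_ennreal, eLpNorm_two_ennreal]
    congr 1
    exact lintegral_neg_eq_self (fun ξ => (ENNReal.ofReal (wt (-τ) ξ) *
      cv (wabs 0 (fun ξ => χ (-ξ))) (wabs 0 F) ξ) ^ (2 : ℝ))
  refine lt_of_eq_of_lt e2 ((eLpNorm_wt_cv_le hτ0 hτs hχm hFm).trans_lt ?_)
  exact ENNReal.mul_lt_top (ENNReal.mul_lt_top ENNReal.ofReal_lt_top
      (ENNReal.mul_lt_top (by simp) (memLp_wt_neg hs).2)) (ENNReal.mul_lt_top (hχ _).2 hF.2)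

/-- The product `h h_x` defined by duality is `((h² - 1) / 2)_x`. -/
theorem mulDist_deriv {s : ℝ} (hs : 1 / 2 < s) {h : ℝ → ℝ} (hh : h ∈ HeightSet s) :
    mulDist (min 0 (s - 1)) h (∂_{(1 : ℝ)} (ofFun (fun x => ((h x - 1 : ℝ) : ℂ)))) =
      ∂_{(1 : ℝ)} (ofFun (fun x => (((h x ^ 2 - 1) / 2 : ℝ) : ℂ))) := by
  obtain ⟨hc, hg, -⟩ := hh
  set τ := min 0 (s - 1) with hτ
  set g : ℝ → ℝ := fun x => h x - 1 with hgdef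
  have hgc : Continuous g := hc.sub continuous_const
  have hτ0 : 0 ≤ -τ := by rw [hτ]; linarith [min_le_left 0 (s - 1)]
  have hτs : -τ ≤ s := by
    rw [hτ, neg_le]; exact le_min (by linarith) (by linarith)
  -- The derivative on the right is itself a distribution representing the pairing, so the existence
  -- clause of `mulDist` holds, and the chosen distribution is determined by its values.
  suffices key : ∀ ψ : 𝓢(ℝ, ℂ), dualPairing τ (∂_{(1 : ℝ)} (ofFun (fun x => (g x : ℂ))))
      (ofFun (fun x => (h x : ℂ) * ψ x)) =
      ∂_{(1 : ℝ)} (ofFun (fun x => (((h x ^ 2 - 1) / 2 : ℝ) : ℂ))) ψ by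
    have hex : ∃ P : 𝓢'(ℝ, ℂ), ∀ ψ : 𝓢(ℝ, ℂ), P ψ =
        dualPairing τ (∂_{(1 : ℝ)} (ofFun (fun x => (g x : ℂ))))
          (ofFun (fun x => (h x : ℂ) * ψ x)) := ⟨_, fun ψ => (key ψ).symm⟩
    rw [mulDist, dif_pos hex]
    ext ψ
    rw [hex.choose_spec ψ, key ψ]
  intro ψ
  obtain ⟨F, hF⟩ : ∃ F, IsHat s (ofFun (fun x => (g x : ℂ))) F := ⟨_, hg.isHat⟩
  have hI := hF.integrable hs
  have hFm : AEStronglyMeasurable F (volume : Measure ℝ) := hF.aestronglyMeasurable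
  have hgx : ∀ x, (g x : ℂ) = 𝓕⁻ F x := fun x => congrFun
    ((Continuous.ae_eq_iff_eq volume (Complex.continuous_ofReal.comp hgc)
      (continuous_fourierInv hI)).mp (hF.ae_eq_fourierInv (memLp_ofReal hg.1) hI)) x
  set D : ℝ → ℂ := fun ξ => (2 * Real.pi * Complex.I * ξ) * F ξ with hDdef
  have hD : IsHat τ (∂_{(1 : ℝ)} (ofFun (fun x => (g x : ℂ)))) D :=
    hF.lineDeriv.mono (min_le_right _ _)
  have hDm : AEStronglyMeasurable D (volume : Measure ℝ) := hD.aestronglyMeasurable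
  have hgψ : MemLp (fun x => ψ x * (g x : ℂ)) 2 (volume : Measure ℝ) := by
    obtain ⟨C, hC, hb⟩ := hg.bounded hs hgc
    refine ((ψ.memLp 2 volume).const_mul (C : ℂ)).mono (ψ.continuous.mul
      (Complex.continuous_ofReal.comp hgc)).aestronglyMeasurable (Eventually.of_forall fun x => ?_)
    rw [norm_mul, norm_mul, Complex.norm_real, Complex.norm_real, Real.norm_of_nonneg hC, mul_comm]
    gcongr
    exact hb x
  have hS : IsHat (-τ) (ofFun (fun x => (h x : ℂ) * ψ x))
      (fun ξ => (𝓕 ψ : 𝓢(ℝ, ℂ)) ξ + conv (𝓕 ψ : 𝓢(ℝ, ℂ)) F ξ) := by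
    have e1 : (fun x => (h x : ℂ) * ψ x) = fun x => ψ x + ψ x * (g x : ℂ) := by
      ext x; simp only [hgdef]; push_cast; ring
    rw [e1, ofFun_add (ψ.memLp 2 volume) hgψ]
    exact (isHat_schwartz (-τ) ψ).add
      (isHat_mul hτ0 hτs hs (ψ.memLp 2 volume) (isHat_schwartz (-τ) ψ) hF hgx hgψ)
  set χ : 𝓢(ℝ, ℂ) := 𝓕⁻ ψ with hχdef
  have hχ1 : ∀ ξ, (𝓕 ψ : 𝓢(ℝ, ℂ)) ξ = χ (-ξ) := fun ξ => by
    rw [hχdef, SchwartzMap.fourierInv_coe, SchwartzMap.fourier_coe,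
      Real.fourierInv_eq_fourier_neg, neg_neg]
  have hχ : ∀ σ, MemLp (fun ξ => (wt σ ξ : ℂ) * χ (-ξ)) 2 (volume : Measure ℝ) := fun σ => by
    simpa only [hχ1] using (isHat_schwartz σ ψ).memLp
  have hK := integrable_convKernel hs hF.memLp hFm χ hχ hD.memLp hDm
  -- The kernel of `g g_x` tested with `ψ`, with `g = h - 1`: it equals `2πiξ F(ξ) F(η) χ(ξ + η)`.
  -- The summand 1 in `h = 1 + g` contributes `g_x` alone.
  set K : ℝ × ℝ → ℂ := fun z => D z.1 * (F z.2 * χ (z.1 + z.2)) with hKdef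
  have hconv : ∀ ξ, D ξ * conv (𝓕 ψ : 𝓢(ℝ, ℂ)) F (-ξ) = ∫ η, K (ξ, η) := by
    intro ξ
    rw [conv, ← integral_const_mul]
    refine integral_congr_ae (Eventually.of_forall fun η => ?_)
    simp only [hKdef, hχ1]
    congr 3; ring
  have hA : dualPairing τ (∂_{(1 : ℝ)} (ofFun (fun x => (g x : ℂ))))
      (ofFun (fun x => (h x : ℂ) * ψ x)) =
      ∂_{(1 : ℝ)} (ofFun (fun x => (g x : ℂ))) ψ + ∫ z, K z := by
    rw [dualPairing_eq hD hS]
    have e1 : ∀ ξ, D ξ * ((𝓕 ψ : 𝓢(ℝ, ℂ)) (-ξ) + conv (𝓕 ψ : 𝓢(ℝ, ℂ)) F (-ξ)) =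
        χ ξ * D ξ + ∫ η, K (ξ, η) := fun ξ => by
      rw [mul_add, hconv, hχ1, neg_neg, mul_comm]
    simp only [e1]
    rw [integral_add (hD.integrable_mul χ) hK.integral_prod_left, apply_eq_fourier, hD.fourier]
    congr 1
    exact (integral_prod K hK).symm
  have hgg := isHat_mul_real (by linarith) le_rfl hs hg hg hF hF
  have hB : ∂_{(1 : ℝ)} (ofFun (fun x => ((g x * g x : ℝ) : ℂ))) ψ = 2 * ∫ z, K z := by
    rw [apply_eq_fourier, hgg.lineDeriv.fourier]
    set χ₁ : 𝓢(ℝ, ℂ) := SchwartzMap.smulLeftCLM ℂ (fun ξ : ℝ => (2 * Real.pi * Complex.I * ξ : ℂ)) χ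
    have hχ₁ : ∀ ζ, χ₁ ζ = (2 * Real.pi * Complex.I * ζ) * χ ζ := fun ζ =>
      SchwartzMap.smulLeftCLM_apply_apply (by fun_prop) _ _
    have hF2 : MemLp F 2 (volume : Measure ℝ) := by
      simpa using (hF.mono (by linarith : (0 : ℝ) ≤ s)).memLp
    have hP := integrable_schwartz_mul_conv_integrand hF2 hI χ₁
    have e1 : ∀ ζ, (𝓕⁻ ψ : 𝓢(ℝ, ℂ)) ζ * (2 * Real.pi * Complex.I * ζ * conv F F ζ) =
        ∫ η, χ₁ ζ * (F η * F (ζ - η)) := fun ζ => by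
      rw [integral_const_mul, hχ₁, conv, hχdef]; ring
    simp only [e1]
    rw [integral_integral_swap (f := fun ζ η => χ₁ ζ * (F η * F (ζ - η))) hP]
    -- The symmetrisation: after translation, the derivative of `g²` has symbol `2πi(ξ + η)`, the
    -- sum of the symbols of `K` and of `K` with its arguments exchanged. Both have the same
    -- integral.
    have e2 : ∀ η, ∫ ζ, χ₁ ζ * (F η * F (ζ - η)) = ∫ ξ, (K (ξ, η) + K (η, ξ)) := fun η => by
      rw [← integral_add_right_eq_self _ η]
      refine integral_congr_ae (Eventually.of_forall fun ξ => ?_)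
      simp only [hKdef, hDdef, hχ₁, add_sub_cancel_right, add_comm η ξ]
      push_cast
      ring
    simp only [e2]
    have hK' : Integrable (fun z : ℝ × ℝ => K z.swap) (volume.prod volume) := hK.swap
    have e3 := integral_prod_symm (fun z => K z + K z.swap) (hK.add hK')
    simp only [Prod.swap_prod_mk] at e3
    rw [← e3, integral_add hK hK', two_mul]
    congr 1
    exact integral_prod_swap K
  have hgg' := hg.mul (by linarith) le_rfl hs hg
  have hC : ofFun (fun x => (((h x ^ 2 - 1) / 2 : ℝ) : ℂ)) = ofFun (fun x => (g x : ℂ)) +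
      ((1 / 2 : ℝ) : ℂ) • ofFun (fun x => ((g x * g x : ℝ) : ℂ)) := by
    rw [← ofFun_const_mul_real _ hgg'.1, ← ofFun_add_real hg.1 (hgg'.1.const_mul _)]
    congr 1; ext x; simp only [hgdef]; congr 1; ring
  rw [hA, hC, LineDeriv.lineDerivOp_add, LineDeriv.lineDerivOp_smul]
  have e : ∀ (S T : 𝓢'(ℝ, ℂ)) (c : ℂ), (S + c • T) ψ = S ψ + c * T ψ := fun _ _ _ => rfl
  rw [e, hB]
  push_cast; ring

/-! ### Weak solutions by Lax–Milgram and elliptic regularity. -/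

/-- The scalar product of `H^σ` as a bounded bilinear form. -/
def Sob.innerL (σ : ℝ) : Sob σ →L[ℝ] Sob σ →L[ℝ] ℝ :=
  LinearMap.mkContinuous₂ (innerₗ (Sob σ)) 1 fun S T => by
    rw [innerₗ_apply_apply, one_mul]; exact norm_inner_le_norm S T

theorem wt_one_le (ξ : ℝ) : wt 1 ξ ≤ 1 + |ξ| := by
  have h : wt 1 ξ ^ 2 = 1 + ξ ^ 2 := by
    rw [wt, ← Real.rpow_natCast, ← Real.rpow_mul (by positivity)]; norm_num
  refine abs_le_of_sq_le_sq' ?_ (by positivity) |>.2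
  rw [h]
  nlinarith [abs_nonneg ξ, sq_abs ξ]

/-- Pointwise on the Fourier side, `wt 1 ξ ≤ 1 + |ξ| ≤ 1 + 2π|ξ|`. -/
theorem Sob.norm_le_incl_add_deriv (W : Sob 1) :
    ‖W‖ ≤ ‖Sob.incl (zero_le_one : (0 : ℝ) ≤ 1) W‖ + ‖Sob.deriv (by norm_num : (0 : ℝ) + 1 ≤ 1) W‖ := by
  have h0 : IsHat 0 (Sob.incl (zero_le_one : (0 : ℝ) ≤ 1) W).dist W.hat := by
    rw [Sob.dist_incl]; exact W.isHat.mono zero_le_one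
  have h1 : IsHat 0 (Sob.deriv (by norm_num : (0 : ℝ) + 1 ≤ 1) W).dist
      (fun ξ => (2 * Real.pi * Complex.I * ξ) * W.hat ξ) := by
    rw [Sob.dist_deriv]
    have := W.isHat.lineDeriv
    rwa [sub_self] at this
  rw [W.norm_eq W.isHat, Sob.norm_eq _ h0, Sob.norm_eq _ h1,
    ← ENNReal.toReal_add h0.memLp.2.ne h1.memLp.2.ne]
  refine ENNReal.toReal_mono (ENNReal.add_ne_top.mpr ⟨h0.memLp.2.ne, h1.memLp.2.ne⟩) ?_
  rw [← eLpNorm_norm (fun ξ => (wt 0 ξ : ℂ) * W.hat ξ),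
    ← eLpNorm_norm (fun ξ => (wt 0 ξ : ℂ) * ((2 * Real.pi * Complex.I * ξ) * W.hat ξ))]
  refine le_trans ?_ (eLpNorm_add_le h0.memLp.1.norm h1.memLp.1.norm (by norm_num))
  refine eLpNorm_mono_real fun ξ => ?_
  simp only [Pi.add_apply, wt_zero, Complex.ofReal_one, one_mul, norm_mul, Complex.norm_real,
    Complex.norm_I, Complex.norm_ofNat, Real.norm_of_nonneg Real.pi_pos.le, Real.norm_eq_abs ξ,
    mul_one, Real.norm_of_nonneg (wt_pos _ _).le]
  have h2 := wt_one_le ξ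
  have h3 := Real.pi_gt_three
  have h4 : |ξ| ≤ 2 * Real.pi * |ξ| := by nlinarith [abs_nonneg ξ]
  nlinarith [norm_nonneg (W.hat ξ)]

/-- The multiplication by `1 + α`. -/
def Sob.oneAddMul {σ r : ℝ} (hσ : 0 ≤ σ) (hr : σ ≤ r) (hr' : 1 / 2 < r) (α : Sob r) :
    Sob σ →L[ℝ] Sob σ :=
  ContinuousLinearMap.id ℝ _ + (Sob.mul hσ hr hr').flip α

theorem Sob.oneAddMul_apply {σ r : ℝ} (hσ : 0 ≤ σ) (hr : σ ≤ r) (hr' : 1 / 2 < r) (α : Sob r)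
    (S : Sob σ) : Sob.oneAddMul hσ hr hr' α S = S + Sob.mul hσ hr hr' S α := rfl

theorem Sob.fn_oneAddMul {σ r : ℝ} (hσ : 0 ≤ σ) (hr : σ ≤ r) (hr' : 1 / 2 < r) (α : Sob r)
    (S : Sob σ) : (Sob.oneAddMul hσ hr hr' α S).fn =ᵐ[volume] fun x => (1 + α.rep x) * S.fn x := by
  rw [Sob.oneAddMul_apply]
  filter_upwards [Sob.fn_add hσ S (Sob.mul hσ hr hr' S α), Sob.fn_mul hσ hr hr' S α,
    α.rep_ae_eq_fn hr'] with x h1 h2 h3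
  rw [h1, h2, h3]; ring

theorem Sob.dist_oneAddMul {σ r : ℝ} (hσ : 0 ≤ σ) (hr : σ ≤ r) (hr' : 1 / 2 < r) (α : Sob r)
    (S : Sob σ) {f : ℝ → ℝ} (hf : S.fn =ᵐ[volume] f) : (Sob.oneAddMul hσ hr hr' α S).dist =
      ofFun (fun x => (((1 + α.rep x) * f x : ℝ) : ℂ)) := by
  rw [← Sob.ofFun_fn hσ]
  refine ofFun_congr ?_
  filter_upwards [Sob.fn_oneAddMul hσ hr hr' α S, hf] with x h1 h2
  rw [h1, h2]

theorem Sob.mul_norm_sq_le_inner {s : ℝ} (hs : 1 / 2 < s) (α : Sob s) {m : ℝ}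
    (hm : ∀ x, m ≤ 1 + α.rep x) (S : Sob 0) :
    m * ‖S‖ ^ 2 ≤ inner ℝ (Sob.oneAddMul le_rfl (by linarith) hs α S) S := by
  rw [← real_inner_self_eq_norm_sq, Sob.inner_zero_eq, Sob.inner_zero_eq, ← integral_const_mul]
  have hS := S.memLp_fn le_rfl
  have hA := (Sob.oneAddMul le_rfl (by linarith : (0 : ℝ) ≤ s) hs α S).memLp_fn le_rfl
  refine integral_mono_ae ((hS.integrable_mul hS).const_mul m) (hA.integrable_mul hS) ?_
  filter_upwards [Sob.fn_oneAddMul le_rfl (by linarith : (0 : ℝ) ≤ s) hs α S] with x hx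
  rw [hx]
  nlinarith [mul_self_nonneg (S.fn x), hm x]

/-- The bilinear form of the operator `w ↦ 3 (1 + α) w - ∂ ((1 + β) w_x)`. -/
def weakForm {s : ℝ} (hs : 1 / 2 < s) (α β : Sob s) : Sob 1 →L[ℝ] Sob 1 →L[ℝ] ℝ :=
  (3 : ℝ) • (Sob.innerL 0).bilinearComp
    ((Sob.oneAddMul le_rfl (by linarith) hs α).comp (Sob.incl zero_le_one)) (Sob.incl zero_le_one) +
  (Sob.innerL 0).bilinearComp
    ((Sob.oneAddMul le_rfl (by linarith) hs β).comp (Sob.deriv (by norm_num)))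
    (Sob.deriv (by norm_num))

theorem weakForm_apply {s : ℝ} (hs : 1 / 2 < s) (α β : Sob s) (W V : Sob 1) :
    weakForm hs α β W V =
      3 * inner ℝ (Sob.oneAddMul le_rfl (by linarith) hs α
        (Sob.incl (zero_le_one : (0 : ℝ) ≤ 1) W)) (Sob.incl (zero_le_one : (0 : ℝ) ≤ 1) V) +
      inner ℝ (Sob.oneAddMul le_rfl (by linarith) hs β
        (Sob.deriv (by norm_num : (0 : ℝ) + 1 ≤ 1) W)) (Sob.deriv (by norm_num : (0 : ℝ) + 1 ≤ 1) V) :=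
  rfl

theorem isCoercive_weakForm {s : ℝ} (hs : 1 / 2 < s) (α β : Sob s) {m : ℝ} (hm : 0 < m)
    (hα : ∀ x, m ≤ 1 + α.rep x) (hβ : ∀ x, m ≤ 1 + β.rep x) : IsCoercive (weakForm hs α β) := by
  -- The form is at least `m (p² + q²)`, where `p` and `q` are the `L²` norms of `W` and of its
  -- derivative, while `‖W‖² ≤ (p + q)² ≤ 2 (p² + q²)`.
  refine ⟨m / 2, by positivity, fun W => ?_⟩
  rw [weakForm_apply]
  have h1 := Sob.mul_norm_sq_le_inner hs α hα (Sob.incl (zero_le_one : (0 : ℝ) ≤ 1) W)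
  have h2 := Sob.mul_norm_sq_le_inner hs β hβ (Sob.deriv (by norm_num : (0 : ℝ) + 1 ≤ 1) W)
  have h3 := W.norm_le_incl_add_deriv
  set p := ‖Sob.incl (zero_le_one : (0 : ℝ) ≤ 1) W‖
  set q := ‖Sob.deriv (by norm_num : (0 : ℝ) + 1 ≤ 1) W‖
  have h4 : ‖W‖ * ‖W‖ ≤ 2 * (p ^ 2 + q ^ 2) := by
    have h0 := norm_nonneg W
    nlinarith [sq_nonneg (p - q), mul_self_le_mul_self h0 h3]
  have h5 : 0 ≤ m * p ^ 2 := by positivity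
  nlinarith [mul_le_mul_of_nonneg_left h4 hm.le]

/-- The functional on `H¹` given by an element of `H⁻¹`. -/
def functional (T : Sob (-1)) : Sob 1 →L[ℝ] ℝ :=
  LinearMap.mkContinuous
    { toFun := fun V => RCLike.re (inner ℂ (Sob.bessel (-1) T) (Sob.bessel 1 V))
      map_add' := fun V V' => by rw [map_add, inner_add_right, map_add]
      map_smul' := fun c V => by
        have : inner ℂ (Sob.bessel (-1) T) (Sob.bessel 1 (c • V)) =
            (c : ℂ) * inner ℂ (Sob.bessel (-1) T) (Sob.bessel 1 V) := by
          rw [map_smul]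
          exact inner_smul_real_right _ _ c
        rw [this]; simp }
    ‖T‖ fun V => (RCLike.abs_re_le_norm _).trans (norm_inner_le_norm (𝕜 := ℂ) _ _)

theorem functional_apply (T : Sob (-1)) (V : Sob 1) :
    functional T V = RCLike.re (inner ℂ (Sob.bessel (-1) T) (Sob.bessel 1 V)) := rfl

theorem schwartz_eq_re {ψ : 𝓢(ℝ, ℂ)} (hψ : ∀ x, (ψ x).im = 0) (x : ℝ) :
    (((ψ x).re : ℝ) : ℂ) = ψ x := Complex.ext rfl (by simp [hψ x])

theorem memH_schwartz_re (σ : ℝ) {ψ : 𝓢(ℝ, ℂ)} (hψ : ∀ x, (ψ x).im = 0) :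
    MemH σ (fun x => (ψ x).re) := by
  refine memH_iff.mpr ⟨(ψ.memLp 2 volume).re, ?_⟩
  simp only [schwartz_eq_re hψ]
  exact (isHat_schwartz σ ψ).memSobolev

/-- Identifies the Riesz-type functional with the distribution on real test functions: by Plancherel
the weights of orders `-1` and `1` cancel. -/
theorem functional_schwartz (T : Sob (-1)) {ψ : 𝓢(ℝ, ℂ)} (hψ : ∀ x, (ψ x).im = 0) :
    (functional T (toSob 1 (fun x => (ψ x).re)) : ℂ) = T.dist ψ := by
  have hV : (toSob 1 (fun x => (ψ x).re)).dist = ofFun ψ := by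
    rw [toSob_dist (memH_schwartz_re 1 hψ)]
    simp only [schwartz_eq_re hψ]
  have h1 : inner ℂ (Sob.bessel (-1) T) (Sob.bessel 1 (toSob 1 (fun x => (ψ x).re))) =
      conj (T.dist ψ) := by
    rw [L2.inner_def]
    have e1 : ∀ u v : Lp ℂ 2 (volume : Measure ℝ), ∫ x, inner ℂ (u x) (v x) =
        ∫ x, conj (u x) * v x := fun u v =>
      integral_congr_ae (Eventually.of_forall fun x => by
        dsimp only; rw [RCLike.inner_apply, mul_comm])
    rw [e1]
    change ∫ x, conj (besselL2 (-1) T.dist x) *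
      besselL2 1 (toSob 1 (fun x => (ψ x).re)).dist x = _
    rw [hV, IsHat.inner_eq (Lp.memLp _) (Lp.memLp _) (isHat_besselL2 T.isHat)
      (isHat_besselL2 (isHat_schwartz 1 ψ)), apply_eq_fourier, T.isHat.fourier, ← integral_conj]
    refine integral_congr_ae (Eventually.of_forall fun ξ => ?_)
    -- For real `ψ`, conjugation exchanges the Fourier transform and its inverse.
    have h2 : conj ((𝓕⁻ ψ : 𝓢(ℝ, ℂ)) ξ) = (𝓕 ψ : 𝓢(ℝ, ℂ)) ξ := by
      have h3 := fourier_schwartzConjNeg ψ (-ξ)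
      have h4 : schwartzConjNeg ψ = SchwartzMap.compCLMOfContinuousLinearEquiv ℂ
          (ContinuousLinearEquiv.neg ℝ) ψ := by
        ext x
        rw [schwartzConjNeg_apply]
        change _ = ψ (-x)
        rw [← schwartz_eq_re hψ (-x), Complex.conj_ofReal]
      rw [SchwartzMap.fourierInv_coe, Real.fourierInv_eq_fourier_neg, ← SchwartzMap.fourier_coe,
        ← h3, h4, SchwartzMap.fourier_coe, SchwartzMap.fourier_coe, Real.fourier_eq,
        Real.fourier_eq, ← integral_neg_eq_self]
      refine integral_congr_ae (Eventually.of_forall fun y => ?_)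
      simp [Circle.smul_def]
    have h5 : (wt (-1) ξ : ℂ) * (wt 1 ξ : ℂ) = 1 := by
      rw [← Complex.ofReal_mul, wt_neg_mul]; simp
    dsimp only
    rw [map_mul, map_mul, h2, Complex.conj_ofReal]
    linear_combination (conj (T.hat ξ) * (𝓕 ψ : 𝓢(ℝ, ℂ)) ξ) * h5
  rw [functional_apply, h1]
  refine Complex.ext ?_ ?_
  · simp
  · rw [Complex.ofReal_im, T.dist_mem.2 ψ hψ]

/-- Weak solvability of `3 (1 + α) w - ∂ ((1 + β) w_x) = T` in `H¹`. -/
theorem exists_weak_solution {s : ℝ} (hs : 1 / 2 < s) (α β : Sob s) {m : ℝ} (hm : 0 < m)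
    (hα : ∀ x, m ≤ 1 + α.rep x) (hβ : ∀ x, m ≤ 1 + β.rep x) {T : 𝓢'(ℝ, ℂ)}
    (hT : T ∈ sobolevSubmodule (-1)) :
    ∃ w d : ℝ → ℝ, MemH 1 w ∧ MemLp d 2 (volume : Measure ℝ) ∧
      ∂_{(1 : ℝ)} (ofFun (fun x => (w x : ℂ))) = ofFun (fun x => (d x : ℂ)) ∧
      ofFun (fun x => ((3 * ((1 + α.rep x) * w x) : ℝ) : ℂ)) -
        ∂_{(1 : ℝ)} (ofFun (fun x => (((1 + β.rep x) * d x : ℝ) : ℂ))) = T := by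
  have hco := isCoercive_weakForm hs α β hm hα hβ
  set ℓ := functional (Sob.mk T hT) with hℓ
  -- Lax–Milgram, after representing the functional by a vector of `H¹`.
  obtain ⟨W, hW⟩ := hco.continuousLinearEquivOfBilin.surjective
    ((InnerProductSpace.toDual ℝ (Sob 1)).symm ℓ)
  have hWV : ∀ V, weakForm hs α β W V = ℓ V := fun V => by
    rw [← hco.continuousLinearEquivOfBilin_apply, hW, InnerProductSpace.toDual_symm_apply]
  set J := Sob.incl (zero_le_one : (0 : ℝ) ≤ 1) W with hJ
  set E := Sob.deriv (by norm_num : (0 : ℝ) + 1 ≤ 1) W with hE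
  have hs0 : (0 : ℝ) ≤ s := by linarith
  have hJW : W.fn =ᵐ[volume] J.fn := ofFun_real_inj (W.memLp_fn zero_le_one) (J.memLp_fn le_rfl)
    (by rw [Sob.ofFun_fn le_rfl, Sob.ofFun_fn zero_le_one, hJ, Sob.dist_incl])
  have hA1 : MemLp (fun x => (1 + α.rep x) * W.fn x) 2 (volume : Measure ℝ) := by
    refine (memLp_congr_ae ?_).mp ((Sob.oneAddMul le_rfl hs0 hs α J).memLp_fn le_rfl)
    filter_upwards [Sob.fn_oneAddMul le_rfl hs0 hs α J, hJW] with x h1 h2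
    rw [h1, h2]
  have hB1 : MemLp (fun x => (1 + β.rep x) * E.fn x) 2 (volume : Measure ℝ) :=
    (memLp_congr_ae (Sob.fn_oneAddMul le_rfl hs0 hs β E)).mp
      ((Sob.oneAddMul le_rfl hs0 hs β E).memLp_fn le_rfl)
  refine ⟨W.fn, E.fn, W.memH_fn zero_le_one, E.memLp_fn le_rfl, ?_, ?_⟩
  · rw [Sob.ofFun_fn zero_le_one, Sob.ofFun_fn le_rfl, hE, Sob.dist_deriv]
  -- Real Schwartz functions belong to the real space `H¹`, so the weak formulation applies to them,
  -- and they determine the distribution.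
  apply dist_ext_real
  intro ψ hψ
  have hV := memH_schwartz_re 1 hψ
  set V := toSob 1 (fun x => (ψ x).re) with hVdef
  have h1 := hWV V
  rw [weakForm_apply, Sob.inner_zero_eq, Sob.inner_zero_eq] at h1
  have h2 := functional_schwartz (Sob.mk T hT) hψ
  rw [Sob.dist_mk] at h2
  rw [← h2, ← hVdef, ← hℓ, ← h1]
  have hVd : V.dist = ofFun ψ := by
    rw [hVdef, toSob_dist hV]
    simp only [schwartz_eq_re hψ]
  have hV0 : (Sob.incl (zero_le_one : (0 : ℝ) ≤ 1) V).fn =ᵐ[volume] fun x => (ψ x).re := by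
    refine ofFun_real_inj (Sob.memLp_fn le_rfl _) hV.1 ?_
    rw [Sob.ofFun_fn le_rfl, Sob.dist_incl, hVd]
    simp only [schwartz_eq_re hψ]
  have hψ' := derivCLM_im_eq_zero hψ
  have hV1 : (Sob.deriv (by norm_num : (0 : ℝ) + 1 ≤ 1) V).fn =ᵐ[volume]
      fun x => (SchwartzMap.derivCLM ℂ ℂ ψ x).re := by
    refine ofFun_real_inj (Sob.memLp_fn le_rfl _) (memH_schwartz_re 1 hψ').1 ?_
    rw [Sob.ofFun_fn le_rfl, Sob.dist_deriv, hVd]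
    simp only [schwartz_eq_re hψ']
    exact lineDeriv_ofFun_of_hasDerivAt (ψ.memLp 2 volume)
      ((SchwartzMap.derivCLM ℂ ℂ ψ).memLp 2 volume) fun x => ψ.hasDerivAt x
  have e : ∀ (S T : 𝓢'(ℝ, ℂ)), (S - T) ψ = S ψ - T ψ := fun _ _ => rfl
  rw [e, ofFun_apply (memLp_ofReal (hA1.const_mul 3)), lineDeriv_one_apply,
    ofFun_apply (memLp_ofReal hB1), sub_neg_eq_add]
  push_cast
  congr 1
  · rw [← integral_complex_ofReal, ← integral_const_mul]
    refine integral_congr_ae ?_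
    filter_upwards [Sob.fn_oneAddMul le_rfl hs0 hs α J, hJW, hV0] with x h1 h2 h3
    rw [h1, ← h2, h3, ← schwartz_eq_re hψ x]
    push_cast [Complex.ofReal_re]; ring
  · rw [← integral_complex_ofReal]
    refine integral_congr_ae ?_
    filter_upwards [Sob.fn_oneAddMul le_rfl hs0 hs β E, hV1] with x h1 h3
    rw [h1, h3, ← schwartz_eq_re hψ' x]
    push_cast [Complex.ofReal_re]; ring

/-- Elliptic regularity for `3 (1 + α) w - ∂ ((1 + β) w_x) = T`. -/
theorem memH_of_weak_solution {s : ℝ} (hs : 1 / 2 < s) {α β k : ℝ → ℝ} (hα : MemH s α)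
    (hβ : MemH s β) (hk : MemH s k) (hβk : ∀ x, (1 + β x) * (1 + k x) = 1) {w d : ℝ → ℝ}
    (hw : MemH 1 w) (hd : MemLp d 2 (volume : Measure ℝ))
    (hwd : ∂_{(1 : ℝ)} (ofFun (fun x => (w x : ℂ))) = ofFun (fun x => (d x : ℂ)))
    {T : 𝓢'(ℝ, ℂ)} (hT : T ∈ sobolevSubmodule (s - 1))
    (heq : ofFun (fun x => ((3 * ((1 + α x) * w x) : ℝ) : ℂ)) -
        ∂_{(1 : ℝ)} (ofFun (fun x => (((1 + β x) * d x : ℝ) : ℂ))) = T) : MemH (s + 1) w := by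
  -- Bootstrap, gaining one order at a time until the cap `s`. The equation gives the derivative of
  -- the flux `(1 + β) d` one order below `w` and `T`, so the flux gains an order. Multiplying by `1
  -- + k = (1 + β)⁻¹` passes the gain on to `d`, and hence to `w`.
  have step : ∀ n : ℕ, MemH (min s n + 1) w ∧ MemH (min s n) d := by
    intro n
    induction n with
    | zero =>
      have : min s ((0 : ℕ) : ℝ) = 0 := by simp; linarith
      rw [this]
      exact ⟨by simpa using hw, memH_zero_iff.mpr hd⟩
    | succ n ih =>
      obtain ⟨hw', hd'⟩ := ih
      set σ := min s (n : ℝ) with hσ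
      set σ' := min s ((n + 1 : ℕ) : ℝ) with hσ'
      have h0 : 0 ≤ σ := le_min (by linarith) (Nat.cast_nonneg n)
      have hσs : σ ≤ s := min_le_left _ _
      have h1 : σ' ≤ σ + 1 := by
        rw [hσ, hσ', ← min_add_add_right]; push_cast
        exact min_le_min (by linarith) le_rfl
      have h2 : σ' ≤ s := min_le_left _ _
      have h2' : 0 ≤ σ' := le_min (by linarith) (Nat.cast_nonneg _)
      have hQ : MemH σ (fun x => (1 + β x) * d x) := by
        refine (hd'.add (hd'.mul h0 hσs hs hβ)).congr (Eventually.of_forall fun x => ?_)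
        dsimp only; ring
      have haw : MemH σ' (fun x => 3 * ((1 + α x) * w x)) := by
        have hw2 := hw'.mono h1
        refine ((hw2.add (hw2.mul h2' h2 hs hα)).const_mul 3).congr
          (Eventually.of_forall fun x => ?_)
        dsimp only; ring
      have hDQ : MemSobolev (σ' - 1) 2
          (∂_{(1 : ℝ)} (ofFun (fun x => (((1 + β x) * d x : ℝ) : ℂ)))) := by
        have e : ∂_{(1 : ℝ)} (ofFun (fun x => (((1 + β x) * d x : ℝ) : ℂ))) =
            ofFun (fun x => ((3 * ((1 + α x) * w x) : ℝ) : ℂ)) - T := by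
          rw [← heq]; abel
        rw [e]
        exact (haw.memSobolev.mono (by linarith)).sub (hT.1.mono (by linarith))
      have hQ' : MemH σ' (fun x => (1 + β x) * d x) := by
        refine memH_iff.mpr ⟨hQ.1, ?_⟩
        have := (hQ.isHat.of_lineDeriv (σ := σ' - 1) hQ.memSobolev (by linarith) hDQ).memSobolev
        simpa using this
      have hd2 : MemH σ' d := by
        refine (hQ'.add (hQ'.mul h2' h2 hs hk)).congr (Eventually.of_forall fun x => ?_)
        dsimp only
        linear_combination (d x) * hβk x
      exact ⟨MemH.of_deriv hw' h1 hd2 hwd, hd2⟩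
  obtain ⟨n, hn⟩ := exists_nat_ge s
  have := (step n).1
  rwa [min_eq_left hn] at this

/-! ### The elliptic operator from `H^{s+1}` onto `H^{s-1}`. -/

/-- The operator `w ↦ 3 (1 + α) w - ∂ ((1 + β) w_x)` from `H^{s+1}` to `H^{s-1}`, as an affine
function of `(α, β)`. -/
def opB {s : ℝ} (hs : 1 / 2 < s) (α β : Sob s) : Sob (s + 1) →L[ℝ] Sob (s - 1) :=
  (3 : ℝ) • (Sob.incl (by linarith)).comp
    ((Sob.oneAddMul (by linarith) le_rfl hs α).comp (Sob.incl (by linarith))) -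
  (Sob.deriv (by linarith)).comp
    ((Sob.oneAddMul (by linarith) le_rfl hs β).comp (Sob.deriv le_rfl))

theorem opB_apply {s : ℝ} (hs : 1 / 2 < s) (α β : Sob s) (W : Sob (s + 1)) :
    opB hs α β W = (3 : ℝ) • Sob.incl (by linarith)
      (Sob.oneAddMul (by linarith) le_rfl hs α (Sob.incl (by linarith : s ≤ s + 1) W)) -
      Sob.deriv (by linarith) (Sob.oneAddMul (by linarith) le_rfl hs β
        (Sob.deriv (le_refl (s + 1)) W)) := rfl

theorem Sob.rep_incl {σ τ : ℝ} (h : τ ≤ σ) (hτ : 1 / 2 < τ) (W : Sob σ) :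
    (Sob.incl h W).rep = W.rep := by
  refine Sob.rep_eq_of_continuous hτ _ (W.continuous_rep (by linarith)) ?_
  refine ofFun_real_inj (W.memLp_rep (by linarith)) (Sob.memLp_fn (by linarith) _) ?_
  rw [Sob.ofFun_fn (by linarith), Sob.dist_incl, W.ofFun_rep (by linarith)]

theorem dist_opB {s : ℝ} (hs : 1 / 2 < s) (α β : Sob s) (W : Sob (s + 1)) :
    (opB hs α β W).dist = ofFun (fun x => ((3 * ((1 + α.rep x) * W.rep x) : ℝ) : ℂ)) -
      ∂_{(1 : ℝ)} (ofFun (fun x => (((1 + β.rep x) * deriv W.rep x : ℝ) : ℂ))) := by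
  rw [opB_apply, map_sub, dist_smul_real, Sob.dist_incl, Sob.dist_deriv]
  have h1 := Sob.dist_oneAddMul (by linarith) le_rfl hs α (Sob.incl (by linarith : s ≤ s + 1) W)
    (Sob.rep_ae_eq_fn hs _).symm
  have h2 := Sob.dist_oneAddMul (by linarith) le_rfl hs β (Sob.deriv (le_refl (s + 1)) W)
    (Sob.rep_ae_eq_fn hs _).symm
  rw [Sob.rep_incl _ hs] at h1
  rw [← Sob.deriv_rep le_rfl hs] at h2
  rw [h1, h2, ← ofFun_const_mul_real]
  exact (MemH.memLp ((Sob.memH_rep hs (Sob.oneAddMul (by linarith) le_rfl hs α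
    (Sob.incl (by linarith : s ≤ s + 1) W))).congr
    (((Sob.rep_ae_eq_fn hs _).trans (Sob.fn_oneAddMul (by linarith) le_rfl hs α _)).trans (by
      filter_upwards [Sob.rep_ae_eq_fn hs (Sob.incl (by linarith : s ≤ s + 1) W)] with x hx
      rw [← hx, Sob.rep_incl _ hs]))))

/-- Injectivity: testing the homogeneous equation with the solution makes two nonnegative integrals
sum to zero. Surjectivity: since `s - 1 > -1`, the right side lies in `H⁻¹`, where a weak solution
exists, and elliptic regularity lifts it to `H^{s+1}`. Positivity of `1 + α` and `1 + β` gives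
uniform lower bounds, as both tend to 1 at infinity. -/
theorem opB_bijective {s : ℝ} (hs : 1 / 2 < s) (α β : Sob s) (hα : ∀ x, 0 < 1 + α.rep x)
    (hβ : ∀ x, 0 < 1 + β.rep x) : Function.Bijective (opB hs α β) := by
  have hs1 : 1 / 2 < s + 1 := by linarith
  have hlim : ∀ γ : Sob s, (∀ x, 0 < 1 + γ.rep x) → ∃ m, 0 < m ∧ ∀ x, m ≤ 1 + γ.rep x := by
    intro γ hγ
    have h1 := (γ.tendsto_rep hs).const_add 1
    rw [add_zero] at h1
    exact exists_pos_le (continuous_const.add (γ.continuous_rep hs)) hγ h1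
  obtain ⟨m₁, hm₁, hα'⟩ := hlim α hα
  obtain ⟨m₂, hm₂, hβ'⟩ := hlim β hβ
  constructor
  · rw [injective_iff_map_eq_zero]
    intro W hW
    have h1 := dist_opB hs α β W
    rw [hW, map_zero] at h1
    set d := deriv W.rep with hd
    have hdr : d = (Sob.deriv (le_refl (s + 1)) W).rep := Sob.deriv_rep le_rfl hs W
    have hdm : MemH s d := hdr ▸ Sob.memH_rep hs _
    have hwm : MemH s W.rep := (W.memH_rep hs1).mono (by linarith)
    have hwd : ∂_{(1 : ℝ)} (ofFun (fun x => (W.rep x : ℂ))) = ofFun (fun x => (d x : ℂ)) := by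
      rw [W.ofFun_rep hs1, hdr, Sob.ofFun_rep hs, Sob.dist_deriv]
    have hQ : MemH s (fun x => (1 + β.rep x) * d x) := by
      refine (hdm.add (hdm.mul (by linarith) le_rfl hs (β.memH_rep hs))).congr
        (Eventually.of_forall fun x => ?_)
      dsimp only; ring
    have hA : MemH s (fun x => 3 * ((1 + α.rep x) * W.rep x)) := by
      refine ((hwm.add (hwm.mul (by linarith) le_rfl hs (α.memH_rep hs))).const_mul 3).congr
        (Eventually.of_forall fun x => ?_)
      dsimp only; ring
    -- Energy identity: the homogeneous equation says that `3 (1 + α) W` is the derivative of `(1 +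
    -- β) W_x`, and integration by parts moves this derivative onto `W`.
    have h2 := integral_mul_eq_neg hQ.memLpC hA.memLpC hwm.memLpC hdm.memLpC
      (sub_eq_zero.mp h1.symm).symm hwd
    have hI1 : Integrable (fun x => W.rep x * (3 * ((1 + α.rep x) * W.rep x))) :=
      hwm.1.integrable_mul hA.1
    have hI2 : Integrable (fun x => (1 + β.rep x) * d x * d x) := hQ.1.integrable_mul hdm.1
    have h3 : ∫ x, W.rep x * (3 * ((1 + α.rep x) * W.rep x)) =
        -∫ x, (1 + β.rep x) * d x * d x := by
      apply Complex.ofReal_injective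
      rw [Complex.ofReal_neg, ← integral_complex_ofReal, ← integral_complex_ofReal]
      simpa only [Complex.ofReal_mul] using h2
    have h4 : 0 ≤ ∫ x, (1 + β.rep x) * d x * d x := integral_nonneg fun x => by
      dsimp only
      rw [mul_assoc]
      exact mul_nonneg (hβ x).le (mul_self_nonneg _)
    have h5 : ∀ x, 0 ≤ W.rep x * (3 * ((1 + α.rep x) * W.rep x)) := fun x => by
      have := mul_nonneg (hα x).le (mul_self_nonneg (W.rep x))
      nlinarith
    have h6 : ∫ x, W.rep x * (3 * ((1 + α.rep x) * W.rep x)) = 0 :=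
      le_antisymm (by rw [h3]; linarith) (integral_nonneg h5)
    rw [integral_eq_zero_iff_of_nonneg h5 hI1] at h6
    have h7 : W.rep =ᵐ[volume] fun _ => 0 := by
      filter_upwards [h6] with x hx
      have hx' : W.rep x * (3 * ((1 + α.rep x) * W.rep x)) = 0 := hx
      have := hα x
      by_contra hne
      have h8 : 0 < W.rep x * W.rep x := mul_self_pos.mpr hne
      nlinarith [mul_pos (hα x) h8]
    rw [← toSob_rep hs1 W, toSob_congr h7]
    apply Sob.ext_dist
    rw [toSob_dist (memH_iff.mpr ⟨MemLp.zero', by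
      simp only [Complex.ofReal_zero]
      have := (isHat_schwartz (s + 1) 0).memSobolev
      exact this⟩), map_zero]
    ext ψ
    rw [ofFun_apply (memLp_ofReal MemLp.zero')]
    have : (0 : 𝓢'(ℝ, ℂ)) ψ = 0 := rfl
    simp [this]
  · intro T
    obtain ⟨w, d, hw, hd, hwd, heq⟩ := exists_weak_solution hs α β (lt_min hm₁ hm₂)
      (fun x => (min_le_left _ _).trans (hα' x)) (fun x => (min_le_right _ _).trans (hβ' x))
      (T.mem_of_le (by linarith : (-1 : ℝ) ≤ s - 1))
    have hk := (β.memH_rep hs).reciprocal hs (β.continuous_rep hs) hβ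
    have hw' := memH_of_weak_solution hs (α.memH_rep hs) (β.memH_rep hs) hk
      (fun x => by rw [add_sub_cancel]; exact mul_inv_cancel₀ (hβ x).ne') hw hd hwd T.dist_mem heq
    refine ⟨toSob (s + 1) w, Sob.ext_dist ?_⟩
    rw [dist_opB, ← heq]
    have e1 : (toSob (s + 1) w).rep =ᵐ[volume] w :=
      (Sob.rep_ae_eq_fn hs1 _).trans (fn_toSob (by linarith) hw')
    have e2 : deriv (toSob (s + 1) w).rep =ᵐ[volume] d := by
      have h1 := Sob.deriv_rep le_rfl hs (toSob (s + 1) w)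
      rw [h1]
      refine ofFun_real_inj (Sob.memLp_rep hs _) hd ?_
      rw [Sob.ofFun_rep hs, Sob.dist_deriv, toSob_dist hw', hwd]
    congr 1
    · refine ofFun_congr ?_
      filter_upwards [e1] with x hx; rw [hx]
    · congr 1
      refine ofFun_congr ?_
      filter_upwards [e2] with x hx; rw [hx]

/-! ### Openness, reciprocals and analytic dependence. -/

/-- The positive functions of the form `1 + γ`, `γ ∈ H^s`. -/
def posSet (s : ℝ) : Set (Sob s) := {γ | ∀ x, 0 < 1 + γ.rep x}

/-- A positive `1 + γ` is bounded below by some `m > 0`, and the Sobolev norm controls the sup norm.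
The `+ 1` in the radius only keeps the denominator positive. -/
theorem isOpen_posSet {s : ℝ} (hs : 1 / 2 < s) : IsOpen (posSet s) := by
  rw [Metric.isOpen_iff]
  intro γ hγ
  have h1 := (γ.tendsto_rep hs).const_add 1
  rw [add_zero] at h1
  obtain ⟨m, hm, hmγ⟩ := exists_pos_le (continuous_const.add (γ.continuous_rep hs)) hγ h1
  have hC : 0 < embC s + 1 := by linarith [embC_nonneg s]
  refine ⟨m / (embC s + 1), by positivity, fun δ hδ x => ?_⟩
  rw [Metric.mem_ball, dist_eq_norm, lt_div_iff₀ hC] at hδ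
  have h2 := (δ - γ).abs_rep_le hs x
  have h3 : δ.rep x = (δ - γ).rep x + γ.rep x := by rw [← Sob.rep_add hs, sub_add_cancel]
  have h4 := abs_le.mp h2
  have h5 : m ≤ 1 + γ.rep x := hmγ x
  rw [h3]
  nlinarith [norm_nonneg (δ - γ)]

theorem analyticAt_bilin {X E F G : Type*} [NormedAddCommGroup X] [NormedSpace ℝ X]
    [NormedAddCommGroup E] [NormedSpace ℝ E] [NormedAddCommGroup F] [NormedSpace ℝ F]
    [NormedAddCommGroup G] [NormedSpace ℝ G] (B : E →L[ℝ] F →L[ℝ] G) {f : X → E} {g : X → F} {p : X}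
    (hf : AnalyticAt ℝ f p) (hg : AnalyticAt ℝ g p) : AnalyticAt ℝ (fun q => B (f q) (g q)) p :=
  (B.analyticAt_bilinear (f p, g p)).comp₂ hf hg

/-- A bounded bijection of Banach spaces is invertible by the open mapping theorem, and inversion is
analytic at every invertible operator. Application of an operator to a vector is bilinear. -/
theorem analyticAt_inverse_apply {X E F : Type*} [NormedAddCommGroup X] [NormedSpace ℝ X]
    [NormedAddCommGroup E] [NormedSpace ℝ E] [CompleteSpace E] [NormedAddCommGroup F]
    [NormedSpace ℝ F] [CompleteSpace F] {L : X → E →L[ℝ] F} {y : X → F} {p : X}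
    (hL : AnalyticAt ℝ L p) (hy : AnalyticAt ℝ y p) (hb : Function.Bijective (L p)) :
    AnalyticAt ℝ (fun q => (L q).inverse (y q)) p := by
  set e := ContinuousLinearEquiv.ofBijective (L p) (LinearMap.ker_eq_bot.mpr hb.1)
    (LinearMap.range_eq_top.mpr hb.2)
  have he : (e : E →L[ℝ] F) = L p := ContinuousLinearEquiv.coe_ofBijective _ _ _
  have h1 : ContDiffAt ℝ ⊤ ContinuousLinearMap.inverse (e : E →L[ℝ] F) := contDiffAt_map_inverse e
  rw [he] at h1
  have h2 : AnalyticAt ℝ ContinuousLinearMap.inverse (L p) := h1.analyticAt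
  exact analyticAt_bilin (ContinuousLinearMap.id ℝ (F →L[ℝ] E)) (h2.comp hL) hy

theorem apply_inverse_of_bijective {E F : Type*}
    [NormedAddCommGroup E] [NormedSpace ℝ E] [CompleteSpace E] [NormedAddCommGroup F]
    [NormedSpace ℝ F] [CompleteSpace F] {L : E →L[ℝ] F} (hb : Function.Bijective L) (y : F) :
    L (L.inverse y) = y := by
  set e := ContinuousLinearEquiv.ofBijective L (LinearMap.ker_eq_bot.mpr hb.1)
    (LinearMap.range_eq_top.mpr hb.2)
  have he : (e : E →L[ℝ] F) = L := ContinuousLinearEquiv.coe_ofBijective _ _ _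
  rw [← he, ContinuousLinearMap.inverse_equiv]
  exact e.apply_symm_apply y

/-- `circ α β = (1 + α) (1 + β) - 1`. -/
def circ {s : ℝ} (hs : 1 / 2 < s) (α β : Sob s) : Sob s :=
  α + β + Sob.mul (by linarith) le_rfl hs α β

theorem rep_circ {s : ℝ} (hs : 1 / 2 < s) (α β : Sob s) (x : ℝ) :
    1 + (circ hs α β).rep x = (1 + α.rep x) * (1 + β.rep x) := by
  rw [circ, Sob.rep_add hs, Sob.rep_add hs, Sob.rep_mul hs]; ring

theorem rep_oneAddMul {s : ℝ} (hs : 1 / 2 < s) (α S : Sob s) (x : ℝ) :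
    (Sob.oneAddMul (by linarith) le_rfl hs α S).rep x = (1 + α.rep x) * S.rep x := by
  rw [Sob.oneAddMul_apply, Sob.rep_add hs, Sob.rep_mul hs]; ring

section Analytic

variable {X : Type*} [NormedAddCommGroup X] [NormedSpace ℝ X] {s : ℝ} {p : X} {α β : X → Sob s}

theorem analyticAt_mul {σ : ℝ} (hσ : 0 ≤ σ) (hr : σ ≤ s) (hs : 1 / 2 < s) {S : X → Sob σ}
    (hS : AnalyticAt ℝ S p) (hα : AnalyticAt ℝ α p) :
    AnalyticAt ℝ (fun q => Sob.mul hσ hr hs (S q) (α q)) p :=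
  analyticAt_bilin (Sob.mul hσ hr hs) hS hα

theorem analyticAt_circ (hs : 1 / 2 < s) (hα : AnalyticAt ℝ α p) (hβ : AnalyticAt ℝ β p) :
    AnalyticAt ℝ (fun q => circ hs (α q) (β q)) p :=
  (hα.add hβ).add (analyticAt_mul _ _ hs hα hβ)

theorem analyticAt_oneAddMul {σ : ℝ} (hσ : 0 ≤ σ) (hr : σ ≤ s) (hs : 1 / 2 < s)
    (hα : AnalyticAt ℝ α p) : AnalyticAt ℝ (fun q => Sob.oneAddMul hσ hr hs (α q)) p :=
  analyticAt_const.add (((Sob.mul hσ hr hs).flip.analyticAt _).comp hα)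

/-- The inverse is multiplication by `(1 + γ)⁻¹`, which lies in `1 + H^s` by `MemH.reciprocal`. -/
theorem oneAddMul_bijective (hs : 1 / 2 < s) {γ : Sob s} (hγ : γ ∈ posSet s) :
    Function.Bijective (Sob.oneAddMul (by linarith : (0 : ℝ) ≤ s) le_rfl hs γ) := by
  have hk := (γ.memH_rep hs).reciprocal hs (γ.continuous_rep hs) hγ
  have hkc : Continuous fun x => (1 + γ.rep x)⁻¹ - 1 :=
    ((continuous_const.add (γ.continuous_rep hs)).inv₀ fun x => (hγ x).ne').sub continuous_const
  refine ⟨fun S T hST => Sob.rep_inj hs (funext fun x => ?_), fun S => ?_⟩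
  · have h := congrArg (fun U => Sob.rep U x) hST
    simp only [rep_oneAddMul] at h
    exact mul_left_cancel₀ (hγ x).ne' h
  · refine ⟨Sob.oneAddMul (by linarith) le_rfl hs (toSob s (fun x => (1 + γ.rep x)⁻¹ - 1)) S,
      Sob.rep_inj hs (funext fun x => ?_)⟩
    rw [rep_oneAddMul, rep_oneAddMul, rep_toSob hs hk hkc, ← mul_assoc, add_sub_cancel,
      mul_inv_cancel₀ (hγ x).ne', one_mul]

/-- The reciprocal `1 / (1 + γ) - 1`. -/
def recip (hs : 1 / 2 < s) (γ : Sob s) : Sob s :=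
  -(Sob.oneAddMul (by linarith : (0 : ℝ) ≤ s) le_rfl hs γ).inverse γ

/-- Rests on `1/(1+γ) - 1 = -γ/(1+γ)`. Expressing the reciprocal through an operator inverse is what
makes its analyticity immediate. -/
theorem rep_recip (hs : 1 / 2 < s) {γ : Sob s} (hγ : γ ∈ posSet s) (x : ℝ) :
    1 + (recip hs γ).rep x = (1 + γ.rep x)⁻¹ := by
  have h1 := apply_inverse_of_bijective (oneAddMul_bijective hs hγ) γ
  have h2 := congrArg (fun U => Sob.rep U x) h1
  simp only [rep_oneAddMul] at h2
  have h3 : (recip hs γ).rep x =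
      -((Sob.oneAddMul (by linarith : (0 : ℝ) ≤ s) le_rfl hs γ).inverse γ).rep x := by
    rw [recip, ← neg_one_smul ℝ, Sob.rep_smul hs]; ring
  rw [h3, ← mul_eq_one_iff_eq_inv₀ (hγ x).ne']
  linear_combination -h2

theorem analyticAt_recip (hs : 1 / 2 < s) (hα : AnalyticAt ℝ α p) (hp : α p ∈ posSet s) :
    AnalyticAt ℝ (fun q => recip hs (α q)) p :=
  (analyticAt_inverse_apply (analyticAt_oneAddMul _ _ hs hα) hα (oneAddMul_bijective hs hp)).neg

/-- The operator is affine in its two coefficients, with composition of operators as the bounded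
bilinear map. -/
theorem analyticAt_opB (hs : 1 / 2 < s) (hα : AnalyticAt ℝ α p) (hβ : AnalyticAt ℝ β p) :
    AnalyticAt ℝ (fun q => opB hs (α q) (β q)) p := by
  have h1 := analyticAt_oneAddMul (by linarith : (0 : ℝ) ≤ s) le_rfl hs hα
  have h2 := analyticAt_oneAddMul (by linarith : (0 : ℝ) ≤ s) le_rfl hs hβ
  have c1 := analyticAt_bilin (ContinuousLinearMap.compL ℝ (Sob (s + 1)) (Sob s) (Sob (s - 1)))
    (analyticAt_const (v := Sob.incl (by linarith : s - 1 ≤ s)))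
    (analyticAt_bilin (ContinuousLinearMap.compL ℝ (Sob (s + 1)) (Sob s) (Sob s)) h1
      (analyticAt_const (v := Sob.incl (by linarith : s ≤ s + 1))))
  have c2 := analyticAt_bilin (ContinuousLinearMap.compL ℝ (Sob (s + 1)) (Sob s) (Sob (s - 1)))
    (analyticAt_const (v := Sob.deriv (by linarith : s - 1 + 1 ≤ s)))
    (analyticAt_bilin (ContinuousLinearMap.compL ℝ (Sob (s + 1)) (Sob s) (Sob s)) h2
      (analyticAt_const (v := Sob.deriv (le_refl (s + 1)))))
  exact ((analyticAt_const (v := (3 : ℝ))).smul c1).sub c2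

end Analytic

/-! ### Heights and flows in coordinates. -/

theorem exists_heightOf {s : ℝ} (hs : 1 / 2 < s) {h : ℝ → ℝ} (hh : h ∈ HeightSet s) :
    ∃ g ∈ posSet s, h = heightOf g := by
  have hr := rep_toSob hs hh.2.1 (hh.1.sub continuous_const)
  have he : h = heightOf (toSob s (fun x => h x - 1)) := by
    ext x; rw [heightOf, hr]; ring
  refine ⟨toSob s (fun x => h x - 1), fun x => ?_, he⟩
  have := congrFun he x
  rw [heightOf] at this
  rw [← this]
  exact hh.2.2 x

theorem heightOf_mem {s : ℝ} (hs : 1 / 2 < s) {g : Sob s} (hg : g ∈ posSet s) :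
    heightOf g ∈ HeightSet s :=
  ⟨continuous_const.add (g.continuous_rep hs),
    (g.memH_rep hs).congr (Eventually.of_forall fun x => by simp [heightOf]), hg⟩

theorem opA_heightOf {s : ℝ} (hs : 1 / 2 < s) (g : Sob s) (w : Sob (s + 1)) :
    opA s (heightOf g) w = (opB hs g (circ hs (circ hs g g) g) w).dist := by
  rw [dist_opB, opA]
  congr 1
  · congr 1; ext x; simp only [heightOf]; congr 1; ring
  · congr 2; ext x; simp only [heightOf, rep_circ]; congr 1; ring

theorem circ_mem_posSet {s : ℝ} (hs : 1 / 2 < s) {α β : Sob s} (hα : α ∈ posSet s)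
    (hβ : β ∈ posSet s) : circ hs α β ∈ posSet s := fun x => by
  rw [rep_circ]; exact mul_pos (hα x) (hβ x)

theorem recip_mem_posSet {s : ℝ} (hs : 1 / 2 < s) {α : Sob s} (hα : α ∈ posSet s) :
    recip hs α ∈ posSet s := fun x => by
  rw [rep_recip hs hα]; exact inv_pos.mpr (hα x)

theorem bijOn_opA {s : ℝ} (hs : 1 / 2 < s) {h : ℝ → ℝ} (hh : h ∈ HeightSet s) :
    Set.BijOn (opA s h) Set.univ (sobolevSubmodule (s - 1)) := by
  obtain ⟨g, hg, rfl⟩ := exists_heightOf hs hh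
  have hb := opB_bijective hs g (circ hs (circ hs g g) g) hg
    (circ_mem_posSet hs (circ_mem_posSet hs hg hg) hg)
  refine ⟨fun w _ => ?_, fun w _ w' _ hww => ?_, fun T hT => ?_⟩
  · rw [opA_heightOf hs]; exact Sob.dist_mem _
  · rw [opA_heightOf hs, opA_heightOf hs] at hww
    exact hb.1 (Sob.ext_dist hww)
  · obtain ⟨w, hw⟩ := hb.2 (Sob.mk T hT)
    exact ⟨w, trivial, by rw [opA_heightOf hs, hw, Sob.dist_mk]⟩

theorem opAInv_opA {s : ℝ} (hs : 1 / 2 < s) {h : ℝ → ℝ} (hh : h ∈ HeightSet s) (w : Sob (s + 1)) :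
    opAInv s h (opA s h w) = w :=
  Function.leftInverse_invFun
    (fun w w' hww => (bijOn_opA hs hh).injOn (Set.mem_univ w) (Set.mem_univ w') hww) w

theorem exists_flowOf {s : ℝ} (hs : 1 / 2 < s) {φ : ℝ → ℝ} (hφ : φ ∈ DiffGroup (s + 1)) :
    ∃ f : Sob (s + 1), φ = flowOf f :=
  ⟨toSob (s + 1) (fun x => φ x - x), by
    ext x
    rw [flowOf, rep_toSob (by linarith) hφ.2.1 (hφ.1.continuous.sub continuous_id)]; ring⟩

theorem hasDerivAt_flowOf {s : ℝ} (hs : 1 / 2 < s) (f : Sob (s + 1)) (x : ℝ) :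
    HasDerivAt (flowOf f) (1 + (Sob.deriv (le_refl (s + 1)) f).rep x) x :=
  (hasDerivAt_id x).add (f.hasDerivAt_rep le_rfl hs x)

theorem deriv_flowOf {s : ℝ} (hs : 1 / 2 < s) (f : Sob (s + 1)) (x : ℝ) :
    deriv (flowOf f) x = 1 + (Sob.deriv (le_refl (s + 1)) f).rep x :=
  (hasDerivAt_flowOf hs f x).deriv

theorem flowOf_mem_iff {s : ℝ} (hs : 1 / 2 < s) (f : Sob (s + 1)) :
    flowOf f ∈ DiffGroup (s + 1) ↔ Sob.deriv (le_refl (s + 1)) f ∈ posSet s := by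
  refine ⟨fun h x => by rw [← deriv_flowOf hs]; exact h.2.2 x, fun h => ⟨?_, ?_, fun x => ?_⟩⟩
  · exact contDiff_id.add (Sob.contDiff_rep le_rfl hs f)
  · exact (f.memH_rep (by linarith)).congr (Eventually.of_forall fun x => by simp [flowOf])
  · rw [deriv_flowOf hs]; exact h x

theorem heightOf_mem_iff {s : ℝ} (hs : 1 / 2 < s) (g : Sob s) :
    heightOf g ∈ HeightSet s ↔ g ∈ posSet s :=
  ⟨fun h => h.2.2, heightOf_mem hs⟩

theorem isOpen_domainF {s : ℝ} (hs : 1 / 2 < s) : IsOpen (domainF s) := by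
  have h : domainF s = (fun p : Sob (s + 1) × Sob (s + 1) × Sob s =>
      Sob.deriv (le_refl (s + 1)) p.1) ⁻¹' posSet s ∩ (fun p => p.2.2) ⁻¹' posSet s := by
    ext p
    rw [domainF, Set.mem_ofPred_eq, flowOf_mem_iff hs, heightOf_mem_iff hs]
    rfl
  rw [h]
  exact ((isOpen_posSet hs).preimage ((Sob.deriv (le_refl (s + 1))).continuous.comp continuous_fst)).inter
    ((isOpen_posSet hs).preimage (continuous_snd.comp continuous_snd))

/-- Surjectivity: `φ - id` is bounded, so `φ` tends to `±∞` with its argument. The derivative tends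
to 1 at infinity and is positive, hence bounded below; the Sobolev embedding bounds it above. -/
theorem exists_isDiffeo {s : ℝ} (hs : 1 / 2 < s) {f : Sob (s + 1)}
    (hf : Sob.deriv (le_refl (s + 1)) f ∈ posSet s) :
    Function.Bijective (flowOf f) ∧
      ∃ m M, IsDiffeo (flowOf f) (Function.invFun (flowOf f)) m M := by
  have hs1 : 1 / 2 < s + 1 := by linarith
  have hC := ((flowOf_mem_iff hs f).mpr hf).1
  have hd := deriv_flowOf hs f
  have hmono : StrictMono (flowOf f) := strictMono_of_deriv_pos fun x => by
    rw [hd]; exact hf x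
  have hsurj : Function.Surjective (flowOf f) := by
    have hb := f.abs_rep_le hs1
    refine hC.continuous.surjective ?_ ?_
    · refine tendsto_atTop_mono (fun x => ?_)
        (tendsto_atTop_add_const_right atTop (-(embC (s + 1) * ‖f‖)) tendsto_id)
      have := (abs_le.mp (hb x)).1
      simp only [flowOf, id]; linarith
    · refine tendsto_atBot_mono (fun x => ?_)
        (tendsto_atBot_add_const_right atBot (embC (s + 1) * ‖f‖) tendsto_id)
      have := (abs_le.mp (hb x)).2
      simp only [flowOf, id]; linarith
  set γ := Sob.deriv (le_refl (s + 1)) f with hγ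
  have h1 := (γ.tendsto_rep hs).const_add 1
  rw [add_zero] at h1
  obtain ⟨m, hm, hmγ⟩ := exists_pos_le (continuous_const.add (γ.continuous_rep hs)) hf h1
  refine ⟨⟨hmono.injective, hsurj⟩, m, 1 + embC s * ‖γ‖, hC,
    Function.leftInverse_invFun hmono.injective, Function.rightInverse_invFun hsurj, hm,
    fun x => by rw [hd]; exact hmγ x, fun x => ?_⟩
  rw [hd]
  have := (abs_le.mp (γ.abs_rep_le hs x)).2
  linarith

/-! ### The elliptic equation in Lagrangian variables. -/

section Lagrangian

variable {s : ℝ}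

/-- `1 / φ_x - 1` for `φ = id + f`. -/
def invJac (hs : 1 / 2 < s) (f : Sob (s + 1)) : Sob s := recip hs (Sob.deriv le_rfl f)

/-- `h₀ / φ_x - 1`. -/
def lagHeight (hs : 1 / 2 < s) (f : Sob (s + 1)) (g : Sob s) : Sob s := circ hs g (invJac hs f)

/-- `v_x / φ_x`. -/
def lagSlope (hs : 1 / 2 < s) (f v : Sob (s + 1)) : Sob s :=
  Sob.oneAddMul (by linarith) le_rfl hs (invJac hs f) (Sob.deriv le_rfl v)

/-- `h₀³ φ_x⁻⁴ - 1`. -/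
def lagCoeff (hs : 1 / 2 < s) (f : Sob (s + 1)) (g : Sob s) : Sob s :=
  circ hs (circ hs (circ hs g g) g)
    (circ hs (circ hs (invJac hs f) (invJac hs f)) (circ hs (invJac hs f) (invJac hs f)))

/-- `(h₀ / φ_x)³ (v_x / φ_x)²`. -/
def lagStress (hs : 1 / 2 < s) (f v : Sob (s + 1)) (g : Sob s) : Sob s :=
  Sob.oneAddMul (by linarith) le_rfl hs
    (circ hs (circ hs (lagHeight hs f g) (lagHeight hs f g)) (lagHeight hs f g))
    (Sob.mul (by linarith) le_rfl hs (lagSlope hs f v) (lagSlope hs f v))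

/-- `(3/2) ((h₀ / φ_x)² - 1) + 2 (h₀ / φ_x)³ (v_x / φ_x)²`. -/
def lagFlux (hs : 1 / 2 < s) (f v : Sob (s + 1)) (g : Sob s) : Sob s :=
  (3 / 2 : ℝ) • circ hs (lagHeight hs f g) (lagHeight hs f g) + (2 : ℝ) • lagStress hs f v g

/-- The solution `W` of `3 h₀ W - ∂ (h₀³ φ_x⁻⁴ W_x) = ∂ G` with the flux `G` above. -/
def lagSol (hs : 1 / 2 < s) (f v : Sob (s + 1)) (g : Sob s) : Sob (s + 1) :=
  (opB hs g (lagCoeff hs f g)).inverse (Sob.deriv (by linarith) (lagFlux hs f v g))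

theorem invJac_mem (hs : 1 / 2 < s) {f : Sob (s + 1)}
    (hf : Sob.deriv (le_refl (s + 1)) f ∈ posSet s) :
    invJac hs f ∈ posSet s := recip_mem_posSet hs hf

theorem rep_invJac (hs : 1 / 2 < s) {f : Sob (s + 1)}
    (hf : Sob.deriv (le_refl (s + 1)) f ∈ posSet s) (x : ℝ) : 1 + (invJac hs f).rep x = (deriv (flowOf f) x)⁻¹ := by
  rw [invJac, rep_recip hs hf, deriv_flowOf hs]

theorem rep_lagHeight (hs : 1 / 2 < s) {f : Sob (s + 1)}
    (hf : Sob.deriv (le_refl (s + 1)) f ∈ posSet s) (g : Sob s) (x : ℝ) :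
    1 + (lagHeight hs f g).rep x = heightOf g x / deriv (flowOf f) x := by
  rw [lagHeight, rep_circ, rep_invJac hs hf, heightOf, div_eq_mul_inv]

theorem rep_lagSlope (hs : 1 / 2 < s) {f : Sob (s + 1)}
    (hf : Sob.deriv (le_refl (s + 1)) f ∈ posSet s) (v : Sob (s + 1)) (x : ℝ) :
    (lagSlope hs f v).rep x = (deriv (flowOf f) x)⁻¹ * deriv v.rep x := by
  rw [lagSlope, rep_oneAddMul, rep_invJac hs hf, Sob.deriv_rep le_rfl hs]

theorem rep_lagCoeff (hs : 1 / 2 < s) {f : Sob (s + 1)}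
    (hf : Sob.deriv (le_refl (s + 1)) f ∈ posSet s) (g : Sob s) (x : ℝ) :
    1 + (lagCoeff hs f g).rep x = heightOf g x ^ 3 * (deriv (flowOf f) x)⁻¹ ^ 4 := by
  rw [lagCoeff]
  simp only [rep_circ, rep_invJac hs hf, heightOf]
  ring

theorem rep_lagStress (hs : 1 / 2 < s) {f : Sob (s + 1)}
    (hf : Sob.deriv (le_refl (s + 1)) f ∈ posSet s) (v : Sob (s + 1)) (g : Sob s) (x : ℝ) :
    (lagStress hs f v g).rep x = (heightOf g x / deriv (flowOf f) x) ^ 3 *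
      ((deriv (flowOf f) x)⁻¹ * deriv v.rep x) ^ 2 := by
  rw [lagStress, rep_oneAddMul, Sob.rep_mul hs, rep_circ, rep_circ, rep_lagHeight hs hf,
    rep_lagSlope hs hf]
  ring

theorem rep_lagFlux (hs : 1 / 2 < s) {f : Sob (s + 1)}
    (hf : Sob.deriv (le_refl (s + 1)) f ∈ posSet s) (v : Sob (s + 1)) (g : Sob s) (x : ℝ) :
    (lagFlux hs f v g).rep x = 3 * (((heightOf g x / deriv (flowOf f) x) ^ 2 - 1) / 2) +
      2 * (lagStress hs f v g).rep x := by
  have h := rep_circ hs (lagHeight hs f g) (lagHeight hs f g) x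
  rw [rep_lagHeight hs hf] at h
  rw [lagFlux, Sob.rep_add hs, Sob.rep_smul hs, Sob.rep_smul hs]
  linear_combination (3 / 2) * h

theorem opB_lagSol (hs : 1 / 2 < s) {f : Sob (s + 1)}
    (hf : Sob.deriv (le_refl (s + 1)) f ∈ posSet s) (v : Sob (s + 1)) {g : Sob s} (hg : g ∈ posSet s) :
    opB hs g (lagCoeff hs f g) (lagSol hs f v g) =
      Sob.deriv (by linarith) (lagFlux hs f v g) :=
  apply_inverse_of_bijective (opB_bijective hs _ _ hg (circ_mem_posSet hs
    (circ_mem_posSet hs (circ_mem_posSet hs hg hg) hg)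
    (circ_mem_posSet hs (circ_mem_posSet hs (invJac_mem hs hf) (invJac_mem hs hf))
      (circ_mem_posSet hs (invJac_mem hs hf) (invJac_mem hs hf))))) _

theorem memH_comp_inv (hs : 1 / 2 < s) {f : Sob (s + 1)}
    (hf : Sob.deriv (le_refl (s + 1)) f ∈ posSet s) {σ : ℝ} (h0 : 0 ≤ σ) (hσ : σ ≤ s + 1) {w : ℝ → ℝ} (hw : MemH σ w) :
    MemH σ (fun y => w (Function.invFun (flowOf f) y)) := by
  obtain ⟨-, m, M, hD⟩ := exists_isDiffeo hs hf
  refine hD.memH_comp hs ?_ h0 hσ hw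
  refine ((invJac hs f).memH_rep hs).congr (Eventually.of_forall fun x => ?_)
  dsimp only
  rw [← rep_invJac hs hf]; ring

theorem eulerH_mem (hs : 1 / 2 < s) {f : Sob (s + 1)}
    (hf : Sob.deriv (le_refl (s + 1)) f ∈ posSet s) {g : Sob s} (hg : g ∈ posSet s) :
    eulerH (flowOf f) (heightOf g) ∈ HeightSet s := by
  obtain ⟨-, m, M, hD⟩ := exists_isDiffeo hs hf
  have he : eulerH (flowOf f) (heightOf g) = fun y =>
      1 + (lagHeight hs f g).rep (Function.invFun (flowOf f) y) := by
    ext y; rw [rep_lagHeight hs hf]; rfl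
  rw [he]
  refine ⟨continuous_const.add (((lagHeight hs f g).continuous_rep hs).comp hD.continuous_inv), ?_,
    fun y => circ_mem_posSet hs hg (invJac_mem hs hf) _⟩
  simpa only [add_sub_cancel_left] using
    memH_comp_inv hs hf (by linarith) (by linarith) ((lagHeight hs f g).memH_rep hs)

theorem memH_eulerU (hs : 1 / 2 < s) {f : Sob (s + 1)}
    (hf : Sob.deriv (le_refl (s + 1)) f ∈ posSet s) (v : Sob (s + 1)) : MemH (s + 1) (eulerU (flowOf f) v.rep) :=
  memH_comp_inv hs hf (by linarith) le_rfl (v.memH_rep (by linarith))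

theorem deriv_comp_inv (hs : 1 / 2 < s) {f : Sob (s + 1)}
    (hf : Sob.deriv (le_refl (s + 1)) f ∈ posSet s) (v : Sob (s + 1)) (y : ℝ) :
    deriv (fun y => v.rep (Function.invFun (flowOf f) y)) y =
      (deriv (flowOf f) (Function.invFun (flowOf f) y))⁻¹ *
        deriv v.rep (Function.invFun (flowOf f) y) := by
  obtain ⟨-, m, M, hD⟩ := exists_isDiffeo hs hf
  have h1 := v.hasDerivAt_rep le_rfl hs (Function.invFun (flowOf f) y)
  rw [← Sob.deriv_rep le_rfl hs] at h1
  exact (h1.comp y (hD.hasDerivAt_inv y)).deriv.trans (mul_comm _ _)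

/-- Since `h h_x` is the derivative of `(h² - 1)/2`, the source is a pure derivative, and its flux
is the Lagrangian one transported by `φ⁻¹`. -/
theorem source_eq (hs : 1 / 2 < s) {f : Sob (s + 1)}
    (hf : Sob.deriv (le_refl (s + 1)) f ∈ posSet s) (v : Sob (s + 1)) {g : Sob s} (hg : g ∈ posSet s) :
    source s (eulerH (flowOf f) (heightOf g)) (eulerU (flowOf f) v.rep) =
      ∂_{(1 : ℝ)} (ofFun (fun y =>
        ((lagFlux hs f v g).rep (Function.invFun (flowOf f) y) : ℂ))) := by
  set η := lagHeight hs f g with hη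
  rw [source, mulDist_deriv hs (eulerH_mem hs hf hg)]
  have h1 : MemH s (fun y => (eulerH (flowOf f) (heightOf g) y ^ 2 - 1) / 2) := by
    refine ((memH_comp_inv hs hf (by linarith) (by linarith)
      ((circ hs η η).memH_rep hs)).const_mul (1 / 2)).congr (Eventually.of_forall fun y => ?_)
    have h := rep_circ hs η η (Function.invFun (flowOf f) y)
    rw [hη, rep_lagHeight hs hf] at h
    simp only [eulerH]
    linear_combination (1 / 2) * h
  have hst : ∀ y, eulerH (flowOf f) (heightOf g) y ^ 3 * deriv (eulerU (flowOf f) v.rep) y ^ 2 =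
      (lagStress hs f v g).rep (Function.invFun (flowOf f) y) := fun y => by
    rw [rep_lagStress hs hf, ← deriv_comp_inv hs hf]
    rfl
  have h2 : MemH s (fun y => eulerH (flowOf f) (heightOf g) y ^ 3 *
      deriv (eulerU (flowOf f) v.rep) y ^ 2) := by
    simp only [hst]
    exact memH_comp_inv hs hf (by linarith) (by linarith) ((lagStress hs f v g).memH_rep hs)
  have h3 : (fun y => ((lagFlux hs f v g).rep (Function.invFun (flowOf f) y) : ℂ)) = fun y =>
      ((3 * ((eulerH (flowOf f) (heightOf g) y ^ 2 - 1) / 2) +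
        2 * (eulerH (flowOf f) (heightOf g) y ^ 3 *
          deriv (eulerU (flowOf f) v.rep) y ^ 2) : ℝ) : ℂ) := by
    ext y
    rw [hst, rep_lagFlux hs hf]
    rfl
  rw [h3, ofFun_add_real (h1.1.const_mul 3) (h2.1.const_mul 2), ofFun_const_mul_real 3 h1.1,
    ofFun_const_mul_real 2 h2.1, LineDeriv.lineDerivOp_add, LineDeriv.lineDerivOp_smul,
    LineDeriv.lineDerivOp_smul]
  norm_num

/-- The conjugation: the Lagrangian equation, divided by `φ_x` and composed with `φ⁻¹`, is the
Eulerian one. This is the only link needed between the definition of `F` and the composition-free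
solution. -/
theorem opA_lagSol (hs : 1 / 2 < s) {f : Sob (s + 1)}
    (hf : Sob.deriv (le_refl (s + 1)) f ∈ posSet s) (v : Sob (s + 1)) {g : Sob s} (hg : g ∈ posSet s) :
    opA s (eulerH (flowOf f) (heightOf g)) (toSob (s + 1) (fun y =>
      (lagSol hs f v g).rep (Function.invFun (flowOf f) y))) =
      source s (eulerH (flowOf f) (heightOf g)) (eulerU (flowOf f) v.rep) := by
  have hs1 : 1 / 2 < s + 1 := by linarith
  obtain ⟨-, m, M, hD⟩ := exists_isDiffeo hs hf
  set φ := flowOf f with hφ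
  set ψ := Function.invFun φ with hψ
  set W := lagSol hs f v g with hW
  set b := lagCoeff hs f g with hb
  set G := lagFlux hs f v g with hG
  have hw : MemH (s + 1) (fun y => W.rep (ψ y)) :=
    memH_comp_inv hs hf (by linarith) le_rfl (W.memH_rep hs1)
  have hwrep : (toSob (s + 1) (fun y => W.rep (ψ y))).rep = fun y => W.rep (ψ y) :=
    rep_toSob hs1 hw ((W.continuous_rep hs1).comp hD.continuous_inv)
  rw [source_eq hs hf v hg, opA, hwrep]
  have hWs : MemH s W.rep := (W.memH_rep hs1).mono (by linarith)
  have hWx : MemH s (deriv W.rep) := by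
    rw [Sob.deriv_rep le_rfl hs]; exact Sob.memH_rep hs _
  have hbW : MemH s (fun x => (1 + b.rep x) * deriv W.rep x) :=
    (hWx.add (hWx.mul (by linarith) le_rfl hs (b.memH_rep hs))).congr
      (Eventually.of_forall fun x => by dsimp only; ring)
  have haW : MemH s (fun x => 3 * ((1 + g.rep x) * W.rep x)) :=
    ((hWs.add (hWs.mul (by linarith) le_rfl hs (g.memH_rep hs))).const_mul 3).congr
      (Eventually.of_forall fun x => by dsimp only; ring)
  have hGm : MemH s G.rep := G.memH_rep hs
  -- The two fluxes are combined before the chain rule is applied. Separately their derivatives are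
  -- only known to lie in `H^{s-1}`, but the derivative of the sum is `3 h₀ W`, which is square
  -- integrable as the chain rule requires.
  have hQ := hbW.add hGm
  have heq := congrArg Sob.dist (opB_lagSol hs hf v hg)
  rw [dist_opB, Sob.dist_deriv, ← G.ofFun_rep hs, sub_eq_iff_eq_add,
    ← LineDeriv.lineDerivOp_add, ← ofFun_add_real hGm.1 hbW.1] at heq
  have hder : ∂_{(1 : ℝ)} (ofFun (fun x => (((1 + b.rep x) * deriv W.rep x + G.rep x : ℝ) : ℂ))) =
      ofFun (fun x => ((3 * ((1 + g.rep x) * W.rep x) : ℝ) : ℂ)) := by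
    rw [heq]
    congr 2; ext x; rw [add_comm]
  have hk := memH_comp_inv hs hf (by linarith : (0 : ℝ) ≤ s) (by linarith) haW
  have hd' : MemLp (fun x => (((deriv φ x)⁻¹ : ℝ) : ℂ) *
      ((3 * ((1 + g.rep x) * W.rep x) : ℝ) : ℂ)) 2 (volume : Measure ℝ) := by
    have h1 := (haW.add (haW.mul (by linarith) le_rfl hs ((invJac hs f).memH_rep hs))).memLpC
    refine (memLp_congr_ae (Eventually.of_forall fun x => ?_)).mp h1
    have h2 := rep_invJac hs hf x
    rw [← h2]
    push_cast; ring
  have hchain := hD.lineDeriv_comp hQ.memLpC haW.memLpC hd' hder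
  -- The factor `1/φ_x` from the chain rule turns `h₀` into `h`. Of the four factors `1/φ_x` in the
  -- coefficient of `W_x`, three turn `h₀³` into `h³` and one turns `W_x` into the Eulerian
  -- derivative.
  have e1 : (fun y => (((deriv φ (ψ y))⁻¹ : ℝ) : ℂ) *
      ((3 * ((1 + g.rep (ψ y)) * W.rep (ψ y)) : ℝ) : ℂ)) =
      fun y => ((3 * eulerH φ (heightOf g) y * W.rep (ψ y) : ℝ) : ℂ) := by
    ext y
    rw [← Complex.ofReal_mul]
    congr 1
    simp only [eulerH, heightOf, div_eq_mul_inv, ← hψ]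
    ring
  have e2 : (fun y => (((1 + b.rep (ψ y)) * deriv W.rep (ψ y) + G.rep (ψ y) : ℝ) : ℂ)) =
      fun y => ((eulerH φ (heightOf g) y ^ 3 * deriv (fun y => W.rep (ψ y)) y + G.rep (ψ y) : ℝ)
        : ℂ) := by
    ext y
    congr 2
    rw [deriv_comp_inv hs hf, hb, rep_lagCoeff hs hf]
    simp only [eulerH, div_eq_mul_inv, ← hφ, ← hψ]
    ring
  have h3 := memH_comp_inv hs hf (by linarith : (0 : ℝ) ≤ s) (by linarith) hbW
  have h4 : MemH s (fun y => eulerH φ (heightOf g) y ^ 3 * deriv (fun y => W.rep (ψ y)) y) := by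
    refine h3.congr (Eventually.of_forall fun y => ?_)
    have := congrArg Complex.re (congrFun e2 y)
    simp only [Complex.ofReal_re] at this
    linarith
  have h5 : MemH s (fun y => G.rep (ψ y)) :=
    memH_comp_inv hs hf (by linarith) (by linarith) hGm
  rw [e1, e2, ofFun_add_real h4.1 h5.1, LineDeriv.lineDerivOp_add] at hchain
  rw [← hchain, add_sub_cancel_left]

/-- By injectivity of `A_h` the Eulerian solution is the Lagrangian one composed with `φ⁻¹`, and the
outer composition with `φ` in `F` cancels it. -/
theorem forceFun_eq (hs : 1 / 2 < s) {f : Sob (s + 1)}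
    (hf : Sob.deriv (le_refl (s + 1)) f ∈ posSet s) (v : Sob (s + 1)) {g : Sob s} (hg : g ∈ posSet s) :
    forceFun s (flowOf f) v.rep (heightOf g) = (-lagSol hs f v g).rep := by
  have hs1 : 1 / 2 < s + 1 := by linarith
  obtain ⟨-, m, M, hD⟩ := exists_isDiffeo hs hf
  have hw : MemH (s + 1) (fun y => (lagSol hs f v g).rep (Function.invFun (flowOf f) y)) :=
    memH_comp_inv hs hf (by linarith) le_rfl ((lagSol hs f v g).memH_rep hs1)
  ext x
  rw [forceFun, ← opA_lagSol hs hf v hg, opAInv_opA hs (eulerH_mem hs hf hg),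
    rep_toSob hs1 hw (((lagSol hs f v g).continuous_rep hs1).comp hD.continuous_inv),
    ← neg_one_smul ℝ (lagSol hs f v g), Sob.rep_smul hs1, neg_one_mul]
  dsimp only
  rw [hD.left_inv]

/-- Coefficients and flux are polynomials, in the algebra `H^s`, of `h₀ - 1`, `v_x` and `1/φ_x - 1`;
the solution applies the inverse of an analytic family of operators. -/
theorem analyticAt_lagSol (hs : 1 / 2 < s) {p : Sob (s + 1) × Sob (s + 1) × Sob s}
    (hp : Sob.deriv (le_refl (s + 1)) p.1 ∈ posSet s) (hg : p.2.2 ∈ posSet s) :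
    AnalyticAt ℝ (fun q : Sob (s + 1) × Sob (s + 1) × Sob s => lagSol hs q.1 q.2.1 q.2.2) p := by
  have a1 : AnalyticAt ℝ (fun q : Sob (s + 1) × Sob (s + 1) × Sob s => q.1) p := analyticAt_fst
  have a2 : AnalyticAt ℝ (fun q : Sob (s + 1) × Sob (s + 1) × Sob s => q.2.1) p :=
    analyticAt_fst.comp analyticAt_snd
  have a3 : AnalyticAt ℝ (fun q : Sob (s + 1) × Sob (s + 1) × Sob s => q.2.2) p :=
    analyticAt_snd.comp analyticAt_snd
  have k1 : AnalyticAt ℝ (fun q : Sob (s + 1) × Sob (s + 1) × Sob s => invJac hs q.1) p :=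
    analyticAt_recip hs (((Sob.deriv (le_refl (s + 1))).analyticAt _).comp a1) hp
  have v1 := ((Sob.deriv (le_refl (s + 1))).analyticAt _).comp a2
  have b1 := analyticAt_circ hs (analyticAt_circ hs (analyticAt_circ hs a3 a3) a3)
    (analyticAt_circ hs (analyticAt_circ hs k1 k1) (analyticAt_circ hs k1 k1))
  have η1 := analyticAt_circ hs a3 k1
  -- `s1` is the slope and `st1` below the stress, with multiplication by `1 + γ` written out as a
  -- sum.
  have s1 := v1.add (analyticAt_mul (by linarith : (0 : ℝ) ≤ s) le_rfl hs v1 k1)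
  have q1 := analyticAt_mul (by linarith : (0 : ℝ) ≤ s) le_rfl hs s1 s1
  have c1 := analyticAt_circ hs η1 η1
  have st1 := q1.add (analyticAt_mul (by linarith : (0 : ℝ) ≤ s) le_rfl hs q1
    (analyticAt_circ hs c1 η1))
  have G1 := ((analyticAt_const (v := (3 / 2 : ℝ))).smul c1).add
    ((analyticAt_const (v := (2 : ℝ))).smul st1)
  have D1 := ((Sob.deriv (by linarith : s - 1 + 1 ≤ s)).analyticAt _).comp G1
  refine analyticAt_inverse_apply (analyticAt_opB hs a3 b1) D1 ?_
  exact opB_bijective hs _ _ hg (circ_mem_posSet hs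
    (circ_mem_posSet hs (circ_mem_posSet hs hg hg) hg)
    (circ_mem_posSet hs (circ_mem_posSet hs (invJac_mem hs hp) (invJac_mem hs hp))
      (circ_mem_posSet hs (invJac_mem hs hp) (invJac_mem hs hp))))

end Lagrangian

end GreenNaghdi

end

/-! ### Conclusion. -/

open GreenNaghdi in
theorem theorem1 (s : ℝ) (hs : 1 / 2 < s) :
    -- the domain of `F` is open in the space of coordinates
    IsOpen (domainF s) ∧
    -- `A_h` maps `H^{s+1}(ℝ)` bijectively onto `H^{s-1}(ℝ)`
    (∀ h ∈ HeightSet s, Set.BijOn (opA s h) Set.univ (sobolevSubmodule (s - 1))) ∧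
    -- `F` is well defined on its domain, with values in `H^{s+1}(ℝ)`
    (∀ φ ∈ DiffGroup (s + 1), ∀ v : Sob (s + 1), ∀ h₀ ∈ HeightSet s,
      Function.Bijective φ ∧
      eulerH φ h₀ ∈ HeightSet s ∧
      MemH (s + 1) (eulerU φ v.rep) ∧
      source s (eulerH φ h₀) (eulerU φ v.rep) ∈ sobolevSubmodule (s - 1) ∧
      MemH (s + 1) (forceFun s φ v.rep h₀)) ∧
    -- `F` is real analytic
    AnalyticOnNhd ℝ (force s) (domainF s) := by
  have hs1 : 1 / 2 < s + 1 := by linarith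
  refine ⟨isOpen_domainF hs, fun h hh => bijOn_opA hs hh, fun φ hφ v h₀ hh₀ => ?_, fun p hp => ?_⟩
  · obtain ⟨f, rfl⟩ := exists_flowOf hs hφ
    obtain ⟨g, hg, rfl⟩ := exists_heightOf hs hh₀
    have hf := (flowOf_mem_iff hs f).mp hφ
    refine ⟨(exists_isDiffeo hs hf).1, eulerH_mem hs hf hg, memH_eulerU hs hf v, ?_, ?_⟩
    -- The source lies in `H^{s-1}` because it is a value of `A_h`.
    · rw [← opA_lagSol hs hf v hg]
      exact (bijOn_opA hs (eulerH_mem hs hf hg)).mapsTo (Set.mem_univ _)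
    · rw [forceFun_eq hs hf v hg]
      exact Sob.memH_rep hs1 _
  -- `force` agrees with the analytic expression on the domain only. The domain being open, they
  -- agree near each of its points, which suffices for analyticity there.
  · have hmem : ∀ q ∈ domainF s, force s q = -lagSol hs q.1 q.2.1 q.2.2 := by
      rintro q ⟨hq1, hq2⟩
      have hf := (flowOf_mem_iff hs q.1).mp hq1
      rw [force, forceFun_eq hs hf q.2.1 ((heightOf_mem_iff hs q.2.2).mp hq2), toSob_rep hs1]
    have ha := (analyticAt_lagSol hs ((flowOf_mem_iff hs p.1).mp hp.1)
      ((heightOf_mem_iff hs p.2.2).mp hp.2)).neg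
    refine ha.congr ?_
    filter_upwards [(isOpen_domainF hs).mem_nhds hp] with q hq
    exact (hmem q hq).symm
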